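/- Let $M$ be a connected Riemann surface and let $E=M\times\mathbb C^2$ with its trivial determinant. A smooth solution $(\nabla,\Phi,h)$ of the self-duality equations on $E$ consists of a Hermitian metric $h$, an $h$-unitary connection $\nabla$ inducing the trivial connection on $\det E$, and a trace-free $\Phi\in\Omega^{1,0}(M,\operatorname{End}E)$ with $$\bar\partial^\nabla\Phi=0,\qquad F^\nabla+[\Phi\wedge\Phi^{*_h}]=0;$$ it is an $\mathrm{SU}(2)$-solution if $h$ is positive definite with $\det h=1$, and an $\mathrm{SU}(1,1)$-solution if $h$ has signature $(1,1)$ with $\det h=-1$. Let $(\hat\nabla,\hat\Phi,\hat h)$ be an $\mathrm{SU}(1,1)$-solution with $\det\hat\Phi=-\omega^2$, $\omega\in\Omega^{1,0}(M)$, let $\hat L\subset E$ be a holomorphic line subbundle (for $\bar\partial^{\hat\nabla}$) with $\hat\Phi|_{\hat L}=-\omega$, and assume that $\hat L$ is nowhere null for $\hat h$. With respect to the $\hat h$-orthogonal splitting $E=\hat L^\dagger\oplus\hat L$ write $$\hat\nabla=\begin{pmatrix}\nabla_1&\alpha\\ \alpha^*&\nabla_2\end{pmatrix},\quad \hat\Phi=\begin{pmatrix}\omega&0\\-\gamma^*&-\omega\end{pmatrix},\quad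 \hat\Phi^{\dagger}=\begin{pmatrix}\bar\omega&\gamma\\0&-\bar\omega\end{pmatrix}$$ (where $\hat\Phi^\dagger$ is the $\hat h$-adjoint of $\hat\Phi$) and define $$\nabla=\begin{pmatrix}\nabla_1&\gamma\\-\gamma^*&\nabla_2\end{pmatrix},\quad \Phi=\begin{pmatrix}\omega&\alpha\\0&-\omega\end{pmatrix},\quad h=-\varepsilon\,\bigl(\hat h|_{\hat L}\oplus-\hat h|_{\hat L^\dagger}\bigr),$$ where $\varepsilon=1$ if $\hat h|_{\hat L}$ is negative and $\varepsilon=-1$ if it is positive (this sign is constant on $M$). Then: (1) $(\nabla,\Phi,h)$ is an $\mathrm{SU}(2)$-solution. (2) Let $\pi:X\to M$ be a holomorphic local homeomorphism from a connected Riemann surface (for instance the universal covering) and let $F:X\to\mathrm{SL}(2,\mathbb C)$ be a parallel frame of $\pi^*(\hat\nabla+\hat\Phi+\hat\Phi^{\dagger})$. Then $F$ is also a parallel frame of $\pi^*(\nabla+\Phi+\Phi^{*_h})$. The map $N=F^*\,\hat h\,F$ associated to $(\hat\nabla,\hat\Phi,\hat h)$ is a harmonic map into de Sitter space $\mathrm{dS}_3$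 (the Hermitian matrices of determinant $-1$), and the map $f=F^*\,h\,F$ associated to $(\nabla,\Phi,h)$ is a harmonic map into $\mathbb H^3$ (the positive definite Hermitian matrices of determinant $1$). Both are equivariant with respect to one and the same homomorphism from the group of homeomorphisms $g$ of $X$ with $\pi\circ g=\pi$ to $\mathrm{SL}(2,\mathbb C)$, which acts by $A\mapsto gAg^*$. (3) $\varepsilon f:X\to\mathbb H^3_\pm=\mathbb H^3\cup(-\mathbb H^3)$ is the dual map of $N$ with respect to $\eta=-2\pi^*\omega$, that is, with $\langle\cdot,\cdot\rangle$ the Minkowski inner product on Hermitian matrices with quadratic form $-\det$: $-\eta^2=\langle\partial N,\partial N\rangle$, $\langle \varepsilon f,N\rangle=0$, $\langle \varepsilon f,\varepsilon f\rangle=-1$, $\langle dN,\varepsilon f\rangle=-(\eta+\bar\eta)$, and, in every local holomorphic coordinate $x+iy$, $\det(N,\varepsilon f,N_x,N_y)>0$ wherever $N$ is an immersion. The determinant is taken in the coordinates $(x_0,x_1,x_2,x_3)\mapsto\begin{pmatrix}x_0+x_1&x_2+ix_3\\x_2-ix_3&x_0-x_1\end{pmatrix}$. -/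

import Mathlib

open scoped Manifold ContDiff Matrix Matrix.Norms.Elementwise ComplexOrder LinearAlgebra.Projectivization

/-- Complex `2 × 2` matrices (with the maximum norm of the entries). -/
abbrev Mat2 : Type := Matrix (Fin 2) (Fin 2) ℂ

noncomputable section

namespace Hitchin

/-! ### Differential forms on a Riemann surface -/

section Forms

variable {M : Type*} [TopologicalSpace M] [ChartedSpace ℂ M]
variable {V : Type*} [NormedAddCommGroup V] [NormedSpace ℝ V]

variable (M) in
/-- The local holomorphic coordinates `z = x + i y` of the Riemann surface `M`. -/
abbrev holCharts : Set (OpenPartialHomeomorph M ℂ) := IsManifold.maximalAtlas 𝓘(ℂ) ω M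

variable (M V) in
/-- (Not necessarily smooth) `V`-valued real `1`-forms on `M`; a complex-valued or
matrix-valued form is a real-linear map on each real tangent space. -/
abbrev OneForm : Type _ := ∀ p : M, TangentSpace 𝓘(ℝ, ℂ) p →ₗ[ℝ] V

/-- The differential of a map from the surface to a vector space. -/
def diff (f : M → V) : OneForm M V := fun p => (mvfderiv 𝓘(ℝ, ℂ) f p).toLinearMap

/-- The expression of a `1`-form in a local coordinate: the pull-back under `e.symm`. -/
def OneForm.inChart (α : OneForm M V) (e : OpenPartialHomeomorph M ℂ) (z : ℂ) : ℂ →ₗ[ℝ] V :=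
  α (e.symm z) ∘ₗ (mfderiv 𝓘(ℝ, ℂ) 𝓘(ℝ, ℂ) e.symm z).toLinearMap

/-- Smooth (`C^∞`) maps to a vector space. -/
def SmoothMap (f : M → V) : Prop := ContMDiff 𝓘(ℝ, ℂ) 𝓘(ℝ, V) ∞ f

/-- Smooth (`C^∞`) `1`-forms. -/
def SmoothForm (α : OneForm M V) : Prop :=
  ∀ e ∈ holCharts M, ∀ v : ℂ, ContDiffOn ℝ ∞ (fun z => α.inChart e z v) e.target

/-- Forms of type `(1,0)`: complex-linear in local coordinates. -/
def IsType10 [Module ℂ V] (α : OneForm M V) : Prop :=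
  ∀ e ∈ holCharts M, ∀ z ∈ e.target, ∀ v : ℂ,
    α.inChart e z (Complex.I * v) = Complex.I • α.inChart e z v

/-- The coefficient `(dα)(∂/∂x, ∂/∂y)` of the exterior derivative in the coordinate `e`. -/
def dCoeff (α : OneForm M V) (e : OpenPartialHomeomorph M ℂ) (z : ℂ) : V :=
  fderiv ℝ (fun w => α.inChart e w Complex.I) z 1 - fderiv ℝ (fun w => α.inChart e w 1) z Complex.I

/-- The coefficient `(α ∧ β)(∂/∂x, ∂/∂y)` for matrix-valued `1`-forms. -/
def wedgeCoeff (α β : OneForm M Mat2) (e : OpenPartialHomeomorph M ℂ) (z : ℂ) : Mat2 :=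
  α.inChart e z 1 * β.inChart e z Complex.I - α.inChart e z Complex.I * β.inChart e z 1

/-- Pull-back of a `1`-form under a map of surfaces. -/
def OneForm.pullback {X : Type*} [TopologicalSpace X] [ChartedSpace ℂ X] (α : OneForm M V)
    (π : X → M) : OneForm X V :=
  fun x => α (π x) ∘ₗ (mfderiv 𝓘(ℝ, ℂ) 𝓘(ℝ, ℂ) π x).toLinearMap

end Forms

/-! ### The self-duality equations on the trivial rank two bundle -/

/-- The value `v* H w` of the Hermitian form with Gram matrix `H` (conjugate-linear in `v`). -/
def herm (H : Mat2) (v w : Fin 2 → ℂ) : ℂ := star v ⬝ᵥ (H *ᵥ w)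

/-- The adjoint `v ↦ H⁻¹ (α v)* H` of an endomorphism-valued `1`-form with respect to the
(possibly indefinite) Hermitian metric `H`. -/
def adjForm {M : Type*} [TopologicalSpace M] [ChartedSpace ℂ M] (H : M → Mat2)
    (α : OneForm M Mat2) : OneForm M Mat2 := fun p =>
  LinearMap.mulLeftRight ℝ ((H p)⁻¹, H p) ∘ₗ
    (Matrix.conjTransposeLinearEquiv (Fin 2) (Fin 2) ℝ ℂ).toLinearMap ∘ₗ α p

/-- A connection `∇ = d + conn`, an endomorphism-valued `1`-form `higgs` and a Hermitian form
`metric` on the trivial bundle `M × ℂ²`. -/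
structure Data (M : Type*) [TopologicalSpace M] [ChartedSpace ℂ M] where
  conn : OneForm M Mat2
  higgs : OneForm M Mat2
  metric : M → Mat2

namespace Data

variable {M : Type*} [TopologicalSpace M] [ChartedSpace ℂ M] (D : Data M)

/-- The adjoint of the Higgs field with respect to the metric. -/
def higgsAdj : OneForm M Mat2 := adjForm D.metric D.higgs

/-- The self-duality equations for smooth `(∇, Φ, h)`: `h` is Hermitian, `∇` is unitary and induces
the trivial connection on the determinant, `Φ` is a trace-free `(1,0)`-form, `∂̄^∇ Φ = 0` and
`F^∇ + [Φ ∧ Φ*] = 0`. As `∂^∇ Φ` has type `(2,0)`, hence vanishes on a surface, `∂̄^∇ Φ` is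
`dΦ + A ∧ Φ + Φ ∧ A`; moreover `F^∇ = dA + A ∧ A` and `[Φ ∧ Φ*] = Φ ∧ Φ* + Φ* ∧ Φ`. -/
structure SelfDual : Prop where
  smooth_conn : SmoothForm D.conn
  smooth_higgs : SmoothForm D.higgs
  smooth_metric : SmoothMap D.metric
  hermitian : ∀ p, (D.metric p).IsHermitian
  unitary : ∀ p v, diff D.metric p v = (D.conn p v)ᴴ * D.metric p + D.metric p * D.conn p v
  trace_conn : ∀ p v, (D.conn p v).trace = 0
  trace_higgs : ∀ p v, (D.higgs p v).trace = 0
  type_higgs : IsType10 D.higgs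
  dbar_higgs : ∀ e ∈ holCharts M, ∀ z ∈ e.target,
    dCoeff D.higgs e z + wedgeCoeff D.conn D.higgs e z + wedgeCoeff D.higgs D.conn e z = 0
  curvature : ∀ e ∈ holCharts M, ∀ z ∈ e.target,
    dCoeff D.conn e z + wedgeCoeff D.conn D.conn e z
      + (wedgeCoeff D.higgs D.higgsAdj e z + wedgeCoeff D.higgsAdj D.higgs e z) = 0

/-- `SU(2)`-solutions: the metric is positive definite of determinant one. -/
structure IsSU2Solution : Prop extends D.SelfDual where
  posDef : ∀ p, (D.metric p).PosDef
  det_metric : ∀ p, (D.metric p).det = 1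

/-- `SU(1,1)`-solutions: the metric is Hermitian of determinant `-1`, i.e. of signature `(1,1)`. -/
structure IsSU11Solution : Prop extends D.SelfDual where
  det_metric : ∀ p, (D.metric p).det = -1

/-- A smooth line subbundle `L` of `M × ℂ²` which is holomorphic for `∂̄^∇`: locally `L` is spanned
by a smooth nowhere vanishing section `s` with `∂̄^∇ s ∈ L`, where
`2 (∂̄^∇ s)(v) = ∇_v s + i ∇_{iv} s`. -/
def IsHolomorphicLine (L : M → ℙ ℂ (Fin 2 → ℂ)) : Prop :=
  ∀ p : M, ∃ U : Set M, IsOpen U ∧ p ∈ U ∧ ∃ s : M → (Fin 2 → ℂ),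
    ContMDiffOn 𝓘(ℝ, ℂ) 𝓘(ℝ, Fin 2 → ℂ) ∞ s U ∧
    (∀ q ∈ U, s q ≠ 0 ∧ s q ∈ (L q).submodule) ∧
    ∀ e ∈ holCharts M, ∀ z ∈ e.target, e.symm z ∈ U → ∀ v : ℂ,
      ((diff s).inChart e z v + D.conn.inChart e z v *ᵥ s (e.symm z)) +
        Complex.I • ((diff s).inChart e z (Complex.I * v) +
          D.conn.inChart e z (Complex.I * v) *ᵥ s (e.symm z)) ∈ (L (e.symm z)).submodule

/-- `L` is a holomorphic line subbundle on which the Higgs field acts as multiplication by `κ`. -/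
def IsEigenline (κ : OneForm M ℂ) (L : M → ℙ ℂ (Fin 2 → ℂ)) : Prop :=
  D.IsHolomorphicLine L ∧
    ∀ p, ∀ s ∈ (L p).submodule, ∀ v, D.higgs p v *ᵥ s = κ p v • s

/-- The line bundle `L` is nowhere null for the metric. -/
def NowhereNull (L : M → ℙ ℂ (Fin 2 → ℂ)) : Prop :=
  ∀ p, ∀ s ∈ (L p).submodule, s ≠ 0 → herm (D.metric p) s s ≠ 0

/-- The sign of the metric on the (non-null) line `L p`. -/
def signOn (L : M → ℙ ℂ (Fin 2 → ℂ)) (p : M) : ℝ :=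
  Real.sign (herm (D.metric p) (L p).rep (L p).rep).re

/-- The metric-orthogonal projection onto the (non-null) line `L p`:
`w ↦ ⟨s, w⟩ / ⟨s, s⟩ • s` for any nonzero `s ∈ L p`. -/
def proj (L : M → ℙ ℂ (Fin 2 → ℂ)) (p : M) : Mat2 :=
  (herm (D.metric p) (L p).rep (L p).rep)⁻¹ •
    (Matrix.vecMulVec (L p).rep (star (L p).rep) * D.metric p)

/-- The projection onto the metric-orthogonal complement of `L p`, along `L p`. -/
def coproj (L : M → ℙ ℂ (Fin 2 → ℂ)) (p : M) : Mat2 := 1 - D.proj L p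

/-- For complementary projection fields `P` and `R`, the off-diagonal block `R ∘ ∇ ∘ P` of the
connection, `v ↦ R dP(v) + R A(v) P`; it is a `1`-form with values in `Hom(im P, im R)`. -/
def offBlock (P R : M → Mat2) : OneForm M Mat2 := fun p =>
  LinearMap.mulLeft ℝ (R p) ∘ₗ diff P p + LinearMap.mulLeftRight ℝ (R p, P p) ∘ₗ D.conn p

/-- The block `R B P` of an endomorphism-valued `1`-form `B`. -/
def block (P R : M → Mat2) (B : OneForm M Mat2) : OneForm M Mat2 := fun p =>
  LinearMap.mulLeftRight ℝ (R p, P p) ∘ₗ B p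

/-- Reversal of the signature flip along the `-om`-eigenline `L`. With respect to the orthogonal
splitting `ℂ² = L^† ⊕ L` the given data have the blocks
`∇̂ = (∇₁, α; α*, ∇₂)`, `Φ̂ = (om, 0; -γ*, -om)`, `Φ̂^† = (om̄, γ; 0, -om̄)`,
and the new data are
`∇ = (∇₁, γ; -γ*, ∇₂)`, `Φ = (om, α; 0, -om)`, `h = ± (ĥ|L ⊕ -ĥ|L^†)`,
where `±` is the sign of `ĥ` on `L`. -/
def reverseFlip (om : OneForm M ℂ) (L : M → ℙ ℂ (Fin 2 → ℂ)) : Data M where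
  conn := fun p =>
    D.conn p - D.offBlock (D.proj L) (D.coproj L) p - D.offBlock (D.coproj L) (D.proj L) p
      + block (D.proj L) (D.coproj L) D.higgsAdj p + block (D.coproj L) (D.proj L) D.higgs p
  higgs := fun p =>
    (om p).smulRight (D.coproj L p - D.proj L p) + D.offBlock (D.proj L) (D.coproj L) p
  metric := fun p => D.signOn L p • (D.metric p * (D.proj L p - D.coproj L p))

/-- The connection form of `∇ + Φ + Φ*`. -/
def totalForm : OneForm M Mat2 := fun p => D.conn p + D.higgs p + D.higgsAdj p

variable {X : Type*} [TopologicalSpace X] [ChartedSpace ℂ X]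

/-- `F : X → SL(2,ℂ)` is a parallel frame on `X` of the pull-back of `∇ + Φ + Φ*` under `π : X → M`:
`dF + π^*(A + Φ + Φ*) F = 0`. -/
structure IsParallelFrame (π : X → M) (F : X → Mat2) : Prop where
  smooth : SmoothMap F
  det_eq : ∀ x, (F x).det = 1
  parallel : ∀ x v, diff F x v + D.totalForm.pullback π x v * F x = 0

/-- The map associated to `(∇, Φ, h)` and a parallel frame: the metric in that frame. -/
def assocMap (π : X → M) (F : X → Mat2) : X → Mat2 := fun x => (F x)ᴴ * D.metric (π x) * F x

end Data

/-! ### Maps into hyperbolic and de Sitter space -/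

/-- The complex bilinear extension to `ℋ ⊗ ℂ = 𝔤𝔩(2,ℂ)` of the Minkowski inner product on the
Hermitian matrices `ℋ`, whose quadratic form is `-det`. -/
def mink (A B : Mat2) : ℂ := ((A * B).trace - A.trace * B.trace) / 2

/-- The coordinates in `ℝ^{1,3}` of `(x₀ + x₁, x₂ + i x₃; x₂ - i x₃, x₀ - x₁)`. -/
def minkCoord (A : Mat2) : Fin 4 → ℝ :=
  ![((A 0 0).re + (A 1 1).re) / 2, ((A 0 0).re - (A 1 1).re) / 2, (A 0 1).re, (A 0 1).im]

/-- Hyperbolic space `ℍ³ = ℍ³₊` : positive definite Hermitian matrices of determinant one. -/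
def hyp3 : Set Mat2 := {A | A.PosDef ∧ A.det = 1}

/-- The two-sheeted hyperboloid `ℍ³_±` : Hermitian matrices with `⟨A, A⟩ = -1`. -/
def hyp3pm : Set Mat2 := {A | A.IsHermitian ∧ mink A A = -1}

/-- De Sitter space: Hermitian matrices with `⟨A, A⟩ = 1`. -/
def deSitter3 : Set Mat2 := {A | A.IsHermitian ∧ mink A A = 1}

section Maps

variable {X : Type*} [TopologicalSpace X] [ChartedSpace ℂ X]

/-- Harmonic maps into a nondegenerate quadric `S ⊆ {⟨A, A⟩ = ±1}` of Minkowski space (`ℍ³` or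
`dS₃`): smooth maps with vanishing tension field, the tension field being the tangential part of
the coordinate Laplacian (up to the conformal factor of the domain). The tangent space at `f x`
consists of the Hermitian `Y` with `⟨Y, f x⟩ = 0`. -/
structure IsHarmonicInto (S : Set Mat2) (f : X → Mat2) : Prop where
  mem : ∀ x, f x ∈ S
  smooth : SmoothMap f
  tension : ∀ e ∈ holCharts X, ∀ z ∈ e.target, ∀ Y : Mat2, Y.IsHermitian →
    mink Y (f (e.symm z)) = 0 → mink Y (Laplacian.laplacian (f ∘ e.symm) z) = 0

/-- The derivative `∂f/∂z = (f_x - i f_y) / 2` in a local coordinate. -/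
def dz (f : X → Mat2) (e : OpenPartialHomeomorph X ℂ) (z : ℂ) : Mat2 :=
  (1 / 2 : ℂ) • ((diff f).inChart e z 1 - Complex.I • (diff f).inChart e z Complex.I)

/-- `f : X → ℍ³_±` is a dual map of `N : X → dS₃` with respect to the `(1,0)`-form `η`, a square
root of minus the Hopf differential `Q = ⟨∂N, ∂N⟩` of `N`. The orientation condition is imposed
where `N` is immersive, i.e. everywhere if `N` is an immersion. -/
structure IsDualMap (N f : X → Mat2) (η : OneForm X ℂ) : Prop where
  type_form : IsType10 η
  hopf : ∀ e ∈ holCharts X, ∀ z ∈ e.target,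
    -(η.inChart e z 1) ^ 2 = mink (dz N e z) (dz N e z)
  mem : ∀ x, f x ∈ hyp3pm
  tangent : ∀ x, mink (f x) (N x) = 0
  diff_eq : ∀ x v, mink (diff N x v) (f x) = -(η x v + star (η x v))
  orientation : ∀ e ∈ holCharts X, ∀ z ∈ e.target,
    Function.Injective (diff N (e.symm z)) →
      0 < (Matrix.of ![minkCoord (N (e.symm z)), minkCoord (f (e.symm z)),
        minkCoord ((diff N).inChart e z 1), minkCoord ((diff N).inChart e z Complex.I)]).det

end Maps

/-- The group of homeomorphisms of `X` that commute with the projection `π`. -/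
def deckGroup {X M : Type*} [TopologicalSpace X] (π : X → M) : Subgroup (X ≃ₜ X) where
  carrier := {g | ∀ x, π (g x) = π x}
  one_mem' := fun _ => rfl
  mul_mem' := fun {a b} ha hb x => (ha (b x)).trans (hb x)
  inv_mem' := fun {a} ha x => by
    have h := ha (a⁻¹ x)
    rw [show a (a⁻¹ x) = x from a.apply_symm_apply x] at h
    exact h.symm

/-- `f` is equivariant for `ρ : Γ → SL(2,ℂ)` acting on Hermitian matrices by `A ↦ g A g*`. -/
def IsEquivariant {X M : Type*} [TopologicalSpace X] {π : X → M}
    (ρ : deckGroup π →* Matrix.SpecialLinearGroup (Fin 2) ℂ) (f : X → Mat2) : Prop :=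
  ∀ (g : deckGroup π) (x : X),
    f (g.1 x) = (ρ g : Mat2) * f x * (ρ g : Mat2)ᴴ

end Hitchin

end

/-!
Let `P` be the `ĥ`-orthogonal projection onto the eigenline `L`, `R = 1 - P`, and `S = R - P` the
reflection. All data are split into blocks with respect to `P` and `R`. Write `A` for the connection
form of `∇̂`, `α` and `β` for its two off-diagonal blocks (the second fundamental forms of `L`),
`c = P Φ̂ R` and `g = R Φ̂^† P`. Then `Φ̂ = om S + c`, `Φ̂^† = om̄ S + g`, and the new data are
`A - α - β + g + c`, `om S + α` and `± ĥ S`. The change of sign of the metric on `L^†` turns the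
negative adjoints `α`, `β` into adjoints (`Data.IsFlippable.pair_flip`), so the new adjoint Higgs
field is `om̄ S + β` and the flat connection `∇ + Φ + Φ*` is literally unchanged
(`Data.IsFlippable.totalForm_flip`). This carries most of the theorem.

* Since `L` is holomorphic, `α` has type `(1,0)` (`Data.IsFlippable.sff_I_mul`), and so has the new
  Higgs field. The block of `∂̄ Φ̂ = 0` on `L^†` says `d om = 0`, and the block of the old curvature
  equation from `L` to `L^†` is then the new equation `∂̄^∇ Φ = 0`
  (`Data.IsFlippable.dbar_higgs_flip`). Given `∂̄^∇ Φ = 0`, the self-duality equation is flatness of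
  `∇ + Φ + Φ*` (`Data.IsUnitaryPair.curvature_totalForm`), which both data share.
* For a parallel frame `F` and `H = F* h F`, one has `dH = -2 F* h (Φ + Φ*) F`, and the equations
  `∂̄^∇ Φ = 0 = ∂^∇ Φ*` say that `Φ + Φ*` is divergence free. As the squares of trace-free
  `2 × 2` matrices are scalar, the Laplacian of `H` is a multiple of `H`, i.e. `H` is harmonic
  (`Data.IsLocalFrame.laplacian_localMap`).
* A homeomorphism `k` of `X` over `M` is smooth and maps a parallel frame `F` to the parallel frame
  `F ∘ k`, which is `F` times a constant matrix; this matrix is the holonomy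
  (`Data.IsParallelFrame.exists_holonomy`), and it does not involve the metric.
* The two associated maps are `F* ĥ F` and, up to sign, `F* ĥ S F`. As `X ↦ F* ĥ X F` scales the
  Minkowski form by `det ĥ = -1`, every condition on a dual map is a pointwise identity between
  traces of `S`, `om S + c` and `om̄ S + g`. The orientation comes out as
  `-4 tr (c g)`, which is positive because `-g` is the adjoint of `c` for the *definite* metric, and
  `c` is nonzero at immersive points (`Data.IsFlippable.isDualMap`).
-/

namespace Hitchin

/-! ### Calculus of matrix-valued functions -/

section MatrixCalculus

/-- Matrix multiplication as a continuous bilinear map. The entrywise norm on `Mat2` is not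
submultiplicative, so the product rule of normed algebras is not available. -/
noncomputable def mulCLM : Mat2 →L[ℝ] Mat2 →L[ℝ] Mat2 :=
  (LinearMap.mul ℝ Mat2).toContinuousBilinearMap

/-- Conjugate transposition as a continuous real-linear map. -/
noncomputable def conjTransposeCLM : Mat2 →L[ℝ] Mat2 :=
  (Matrix.conjTransposeLinearEquiv (Fin 2) (Fin 2) ℝ ℂ).toLinearMap.toContinuousLinearMap

/-- The adjugate of a `2 × 2` matrix, `A ↦ tr A - A`, as a continuous linear map. -/
noncomputable def adjugateCLM : Mat2 →L[ℝ] Mat2 :=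
  ((Matrix.traceLinearMap (Fin 2) ℝ ℂ).smulRight (1 : Mat2) - LinearMap.id).toContinuousLinearMap

lemma adjugateCLM_apply (A : Mat2) : adjugateCLM A = A.adjugate := by
  change A.trace • (1 : Mat2) - A = _
  rw [Matrix.adjugate_fin_two]
  ext i j
  fin_cases i <;> fin_cases j <;> simp [Matrix.trace_fin_two]

variable {E : Type*} [NormedAddCommGroup E] [NormedSpace ℝ E] {n : ℕ∞ω} {f g : E → Mat2}
  {s : Set E} {x : E}

lemma contDiffOn_mul (hf : ContDiffOn ℝ n f s) (hg : ContDiffOn ℝ n g s) :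
    ContDiffOn ℝ n (fun y => f y * g y) s :=
  (mulCLM.isBoundedBilinearMap.contDiff.comp_contDiffOn (hf.prodMk hg) :)

lemma contDiffOn_conjTranspose (hf : ContDiffOn ℝ n f s) :
    ContDiffOn ℝ n (fun y => (f y)ᴴ) s :=
  conjTransposeCLM.contDiff.comp_contDiffOn hf

lemma contDiffOn_adjugate (hf : ContDiffOn ℝ n f s) :
    ContDiffOn ℝ n (fun y => (f y).adjugate) s := by
  simpa only [← adjugateCLM_apply] using! adjugateCLM.contDiff.comp_contDiffOn hf

lemma differentiableAt_mul (hf : DifferentiableAt ℝ f x) (hg : DifferentiableAt ℝ g x) :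
    DifferentiableAt ℝ (fun y => f y * g y) x :=
  (mulCLM.hasFDerivAt_of_bilinear hf.hasFDerivAt hg.hasFDerivAt).differentiableAt

lemma fderiv_mul_apply (hf : DifferentiableAt ℝ f x) (hg : DifferentiableAt ℝ g x) (v : E) :
    fderiv ℝ (fun y => f y * g y) x v = fderiv ℝ f x v * g x + f x * fderiv ℝ g x v := by
  have h := mulCLM.hasFDerivAt_of_bilinear hf.hasFDerivAt hg.hasFDerivAt
  have h' : fderiv ℝ (fun y => f y * g y) x = _ := h.fderiv
  rw [h', add_comm]
  rfl

lemma fderiv_smul_apply {a : E → ℂ} (ha : DifferentiableAt ℝ a x) (hf : DifferentiableAt ℝ f x)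
    (v : E) : fderiv ℝ (fun y => a y • f y) x v = fderiv ℝ a x v • f x + a x • fderiv ℝ f x v :=
  (DFunLike.congr_fun (fderiv_fun_smul ha hf) v).trans (add_comm _ _)

lemma fderiv_add_apply (hf : DifferentiableAt ℝ f x) (hg : DifferentiableAt ℝ g x) (v : E) :
    fderiv ℝ (fun y => f y + g y) x v = fderiv ℝ f x v + fderiv ℝ g x v :=
  DFunLike.congr_fun (fderiv_fun_add hf hg) v

lemma differentiableAt_conjTranspose (hf : DifferentiableAt ℝ f x) :
    DifferentiableAt ℝ (fun y => (f y)ᴴ) x :=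
  conjTransposeCLM.differentiableAt.comp x hf

lemma fderiv_conjTranspose_apply (hf : DifferentiableAt ℝ f x) (v : E) :
    fderiv ℝ (fun y => (f y)ᴴ) x v = (fderiv ℝ f x v)ᴴ := by
  have h : HasFDerivAt (fun y => (f y)ᴴ) (conjTransposeCLM ∘L fderiv ℝ f x) x :=
    conjTransposeCLM.hasFDerivAt.comp x hf.hasFDerivAt
  rw [h.fderiv]
  rfl

end MatrixCalculus

/-! ### Forms and functions in holomorphic coordinates -/

section Charts

variable {M : Type*} [TopologicalSpace M] [ChartedSpace ℂ M]
variable {V : Type*} [NormedAddCommGroup V] [NormedSpace ℝ V]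

lemma contDiffGroupoid_restrict {φ : OpenPartialHomeomorph ℂ ℂ}
    (h : φ ∈ contDiffGroupoid ω 𝓘(ℂ)) : φ ∈ contDiffGroupoid ∞ 𝓘(ℝ, ℂ) := by
  simp only [contDiffGroupoid, mem_groupoid_of_pregroupoid, contDiffPregroupoid] at h ⊢
  simp only [mfld_simps] at h ⊢
  exact ⟨(h.1.restrict_scalars ℝ).of_le (by simp), (h.2.restrict_scalars ℝ).of_le (by simp)⟩

lemma mem_maximalAtlas_real {e : OpenPartialHomeomorph M ℂ} (he : e ∈ holCharts M) :
    e ∈ IsManifold.maximalAtlas 𝓘(ℝ, ℂ) ∞ M := by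
  intro c hc
  exact ⟨contDiffGroupoid_restrict (he c hc).1, contDiffGroupoid_restrict (he c hc).2⟩

lemma chartAt_mem_holCharts [IsManifold 𝓘(ℂ) ω M] (p : M) : chartAt ℂ p ∈ holCharts M :=
  IsManifold.chart_mem_maximalAtlas p

/-- A Riemann surface is a smooth real surface. -/
lemma isManifold_real [IsManifold 𝓘(ℂ) ω M] : IsManifold 𝓘(ℝ, ℂ) ∞ M where
  compatible he hc := contDiffGroupoid_restrict
    (HasGroupoid.compatible (G := contDiffGroupoid ω 𝓘(ℂ)) he hc)

variable {e : OpenPartialHomeomorph M ℂ} {z : ℂ}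

lemma mdifferentiableAt_symm (he : e ∈ holCharts M) (hz : z ∈ e.target) :
    MDifferentiableAt 𝓘(ℝ, ℂ) 𝓘(ℝ, ℂ) e.symm z :=
  (contMDiffAt_symm_of_mem_maximalAtlas (mem_maximalAtlas_real he) hz).mdifferentiableAt (by simp)

lemma mdifferentiable_chart (he : e ∈ holCharts M) :
    e.MDifferentiable 𝓘(ℝ, ℂ) 𝓘(ℝ, ℂ) :=
  ⟨(contMDiffOn_of_mem_maximalAtlas (mem_maximalAtlas_real he)).mdifferentiableOn (by simp),
   (contMDiffOn_symm_of_mem_maximalAtlas (mem_maximalAtlas_real he)).mdifferentiableOn (by simp)⟩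

lemma contDiffOn_comp_symm {f : M → V} {U : Set M} (hf : ContMDiffOn 𝓘(ℝ, ℂ) 𝓘(ℝ, V) ∞ f U)
    (he : e ∈ holCharts M) : ContDiffOn ℝ ∞ (f ∘ e.symm) (e.target ∩ e.symm ⁻¹' U) := by
  rw [← contMDiffOn_iff_contDiffOn]
  exact hf.comp ((contMDiffOn_symm_of_mem_maximalAtlas (mem_maximalAtlas_real he)).mono
    Set.inter_subset_left) Set.inter_subset_right

lemma SmoothMap.contDiffOn_comp_symm {f : M → V} (hf : SmoothMap f) (he : e ∈ holCharts M) :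
    ContDiffOn ℝ ∞ (f ∘ e.symm) e.target := by
  simpa using Hitchin.contDiffOn_comp_symm (ContMDiff.contMDiffOn (s := Set.univ) hf) he

lemma SmoothMap.differentiableAt_comp_symm {f : M → V} (hf : SmoothMap f) (he : e ∈ holCharts M)
    (hz : z ∈ e.target) : DifferentiableAt ℝ (f ∘ e.symm) z :=
  ((hf.contDiffOn_comp_symm he).contDiffAt (e.open_target.mem_nhds hz)).differentiableAt (by simp)

lemma contMDiffAt_of_contDiffAt {f : M → V} (he : e ∈ holCharts M) {p : M} (hp : p ∈ e.source)
    (h : ContDiffAt ℝ ∞ (f ∘ e.symm) (e p)) : ContMDiffAt 𝓘(ℝ, ℂ) 𝓘(ℝ, V) ∞ f p := by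
  have h1 := h.contMDiffAt.comp p
    (contMDiffAt_of_mem_maximalAtlas (mem_maximalAtlas_real he) hp)
  refine h1.congr_of_eventuallyEq ?_
  filter_upwards [e.open_source.mem_nhds hp] with q hq
  simp [e.left_inv hq]

lemma smoothMap_of_charts [IsManifold 𝓘(ℂ) ω M] {f : M → V}
    (h : ∀ e ∈ holCharts M, ContDiffOn ℝ ∞ (f ∘ e.symm) e.target) : SmoothMap f := fun p =>
  contMDiffAt_of_contDiffAt (chartAt_mem_holCharts p) (mem_chart_source ℂ p)
    ((h _ (chartAt_mem_holCharts p)).contDiffAt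
      ((chartAt ℂ p).open_target.mem_nhds (mem_chart_target ℂ p)))

lemma diff_inChart_of_mdifferentiableAt {f : M → V} (he : e ∈ holCharts M) (hz : z ∈ e.target)
    (hf : MDifferentiableAt 𝓘(ℝ, ℂ) 𝓘(ℝ, V) f (e.symm z)) (v : ℂ) :
    (diff f).inChart e z v = fderiv ℝ (f ∘ e.symm) z v := by
  have h := mfderiv_comp z hf (mdifferentiableAt_symm he hz)
  rw [← mfderiv_eq_fderiv, h]
  rfl

lemma SmoothMap.diff_inChart {f : M → V} (hf : SmoothMap f) (he : e ∈ holCharts M)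
    (hz : z ∈ e.target) (v : ℂ) : (diff f).inChart e z v = fderiv ℝ (f ∘ e.symm) z v :=
  diff_inChart_of_mdifferentiableAt he hz (hf.mdifferentiableAt (by simp)) v

lemma SmoothMap.smoothForm_diff {f : M → V} (hf : SmoothMap f) : SmoothForm (diff f) := by
  intro e he v
  have h : ContDiffOn ℝ ∞ (fun z => fderiv ℝ (f ∘ e.symm) z v) e.target :=
    ((hf.contDiffOn_comp_symm he).fderiv_of_isOpen e.open_target (by simp)).clm_apply
      contDiffOn_const
  exact h.congr fun z hz => hf.diff_inChart he hz v

/-- A coordinate represents every tangent vector, so that pointwise identities between forms can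
be checked in coordinates; the coordinate vector `u` serves forms with values in all spaces. -/
lemma inChart_surjective.{w} (he : e ∈ holCharts M) [IsManifold 𝓘(ℂ) ω M] {p : M}
    (hp : p ∈ e.source) (v : TangentSpace 𝓘(ℝ, ℂ) p) :
    ∃ u : ℂ, ∀ {V : Type w} [NormedAddCommGroup V] [NormedSpace ℝ V] (α : OneForm M V),
      α p v = α.inChart e (e p) u := by
  obtain ⟨p, z, hz, rfl⟩ : ∃ q, ∃ z, z ∈ e.target ∧ p = e.symm z :=
    ⟨p, e p, e.map_source hp, (e.left_inv hp).symm⟩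
  have := isManifold_real (M := M)
  have : IsManifold 𝓘(ℝ, ℂ) 1 M := IsManifold.of_le (n := ∞) (by simp)
  obtain ⟨u, hu⟩ := (mdifferentiable_chart he).symm.mfderiv_surjective (x := z) hz v
  refine ⟨u, fun {V} _ _ α => ?_⟩
  rw [e.right_inv hz]
  exact congrArg (α (e.symm z)) hu.symm

lemma smoothMap_mul [IsManifold 𝓘(ℂ) ω M] {f g : M → Mat2} (hf : SmoothMap f)
    (hg : SmoothMap g) : SmoothMap (fun p => f p * g p) :=
  smoothMap_of_charts fun _ he =>
    contDiffOn_mul (hf.contDiffOn_comp_symm he) (hg.contDiffOn_comp_symm he)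

lemma smoothMap_conjTranspose [IsManifold 𝓘(ℂ) ω M] {f : M → Mat2} (hf : SmoothMap f) :
    SmoothMap (fun p => (f p)ᴴ) :=
  smoothMap_of_charts fun _ he => contDiffOn_conjTranspose (hf.contDiffOn_comp_symm he)

lemma SmoothMap.const_sub {f : M → Mat2} (hf : SmoothMap f) (c : Mat2) :
    SmoothMap (fun p => c - f p) := contMDiff_const.sub hf

lemma diff_sub {f g : M → Mat2} (hf : SmoothMap f) (hg : SmoothMap g) (p : M)
    (v : TangentSpace 𝓘(ℝ, ℂ) p) :
    diff (fun p => f p - g p) p v = diff f p v - diff g p v :=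
  DFunLike.congr_fun (mvfderiv_sub (I := 𝓘(ℝ, ℂ)) (g := f) (g' := g) (x := p)
    (hf.mdifferentiableAt (by simp)) (hg.mdifferentiableAt (by simp))) v

lemma diff_const_sub {f : M → Mat2} (hf : SmoothMap f) (c : Mat2) (p : M)
    (v : TangentSpace 𝓘(ℝ, ℂ) p) : diff (fun p => c - f p) p v = -diff f p v := by
  have h := diff_sub (f := fun _ => c) contMDiff_const hf p v
  have h' : diff (fun _ : M => c) p v = 0 :=
    DFunLike.congr_fun (mvfderiv_const (I := 𝓘(ℝ, ℂ)) c (x := p)) v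
  rw [h, h', zero_sub]

lemma SmoothMap.const_smul {f : M → Mat2} (hf : SmoothMap f) (c : ℝ) :
    SmoothMap (fun p => c • f p) :=
  (c • ContinuousLinearMap.id ℝ Mat2).contDiff.contMDiff.comp hf

lemma diff_const_smul {f : M → Mat2} (hf : SmoothMap f) (c : ℝ) (p : M)
    (v : TangentSpace 𝓘(ℝ, ℂ) p) : diff (fun p => c • f p) p v = c • diff f p v := by
  have h := mvfderiv_smul (I := 𝓘(ℝ, ℂ)) (a := fun _ : M => c) (g := f) (x := p)
    mdifferentiableAt_const (hf.mdifferentiableAt (by simp))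
  rw [mvfderiv_const] at h
  have h' := DFunLike.congr_fun h v
  simpa using! h'

variable [IsManifold 𝓘(ℂ) ω M]

lemma diff_mul {f g : M → Mat2} (hf : SmoothMap f) (hg : SmoothMap g) (p : M)
    (v : TangentSpace 𝓘(ℝ, ℂ) p) :
    diff (fun p => f p * g p) p v = diff f p v * g p + f p * diff g p v := by
  have he := chartAt_mem_holCharts p
  have hz := mem_chart_target ℂ p
  obtain ⟨u, hu⟩ := inChart_surjective he (mem_chart_source ℂ p) v
  rw [hu, hu, hu, (smoothMap_mul hf hg).diff_inChart he hz, hf.diff_inChart he hz,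
    hg.diff_inChart he hz]
  have h := fderiv_mul_apply (hf.differentiableAt_comp_symm he hz)
    (hg.differentiableAt_comp_symm he hz) u
  simpa [(chartAt ℂ p).left_inv (mem_chart_source ℂ p)] using! h

lemma diff_conjTranspose {f : M → Mat2} (hf : SmoothMap f) (p : M)
    (v : TangentSpace 𝓘(ℝ, ℂ) p) :
    diff (fun p => (f p)ᴴ) p v = (diff f p v)ᴴ := by
  have he := chartAt_mem_holCharts p
  have hz := mem_chart_target ℂ p
  obtain ⟨u, hu⟩ := inChart_surjective he (mem_chart_source ℂ p) v
  rw [hu, hu, (smoothMap_conjTranspose hf).diff_inChart he hz, hf.diff_inChart he hz]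
  exact fderiv_conjTranspose_apply (hf.differentiableAt_comp_symm he hz) u

end Charts

/-! ### Block decomposition with respect to a projection -/

section Blocks

/-- `X` is a homomorphism from the image of the projection `P` to its kernel. -/
structure MapsOut (P X : Mat2) : Prop where
  left : P * X = 0
  right : X * P = X

/-- `X` is a homomorphism from the kernel of the projection `P` to its image. -/
structure MapsIn (P X : Mat2) : Prop where
  left : P * X = X
  right : X * P = 0

variable {P X Y : Mat2}

lemma MapsOut.left' (h : MapsOut P X) (Z : Mat2) : P * (X * Z) = 0 := by
  rw [← mul_assoc, h.left, zero_mul]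

lemma MapsOut.right' (h : MapsOut P X) (Z : Mat2) : X * (P * Z) = X * Z := by
  rw [← mul_assoc, h.right]

lemma MapsIn.left' (h : MapsIn P X) (Z : Mat2) : P * (X * Z) = X * Z := by
  rw [← mul_assoc, h.left]

lemma MapsIn.right' (h : MapsIn P X) (Z : Mat2) : X * (P * Z) = 0 := by
  rw [← mul_assoc, h.right, zero_mul]

lemma MapsOut.mul (h : MapsOut P X) (h' : MapsOut P Y) : X * Y = 0 := by
  rw [← h.right, mul_assoc, h'.left, mul_zero]

lemma MapsIn.mul (h : MapsIn P X) (h' : MapsIn P Y) : X * Y = 0 := by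
  rw [← h'.left, ← mul_assoc, h.right, zero_mul]

lemma MapsIn.trace_eq_zero (h : MapsIn P X) : X.trace = 0 := by
  rw [← h.left, Matrix.trace_mul_comm, h.right, Matrix.trace_zero]

lemma MapsOut.trace_eq_zero (h : MapsOut P X) : X.trace = 0 := by
  rw [← h.right, Matrix.trace_mul_comm, h.left, Matrix.trace_zero]

lemma mapsOut_block (hP : P * P = P) (X : Mat2) : MapsOut P ((1 - P) * X * P) where
  left := by simp [← mul_assoc, mul_sub, hP]
  right := by simp [mul_assoc, hP]

lemma mapsIn_block (hP : P * P = P) (X : Mat2) : MapsIn P (P * X * (1 - P)) where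
  left := by simp [← mul_assoc, hP]
  right := by simp [mul_assoc, sub_mul, hP]

variable {H A φ ψ dP dH α β g c : Mat2} {w : ℂ}

/-- The off-diagonal block of `d + A` is a homomorphism, as `dP` maps the image of `P` to its
kernel and vice versa. -/
lemma mapsOut_offBlock (hP : P * P = P) (hdP : dP * P + P * dP = dP) :
    MapsOut P ((1 - P) * dP + (1 - P) * A * P) := by
  have h : (1 - P) * dP = (1 - P) * dP * P := by
    have : (1 - P) * (P * dP) = 0 := by simp [sub_mul, ← mul_assoc, hP]
    conv_lhs => rw [← hdP, mul_add, this, add_zero, ← mul_assoc]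
  rw [h, ← add_mul, ← mul_add]
  exact mapsOut_block hP _

lemma mapsIn_offBlock (hP : P * P = P) (hdP : dP * P + P * dP = dP) :
    MapsIn P (P * -dP + P * A * (1 - P)) := by
  have h : P * -dP = P * -dP * (1 - P) := by
    have : P * (dP * P) = 0 := by
      have h1 : P * (dP * P + P * dP) = P * dP := by rw [hdP]
      rwa [mul_add, ← mul_assoc P P, hP, add_eq_right] at h1
    simp [mul_sub, mul_assoc, this]
  rw [h, ← add_mul, ← mul_add]
  exact mapsIn_block hP _

/-- The derivative of a projection in terms of its second fundamental forms: the part of the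
connection that commutes with the splitting makes the projection parallel. -/
lemma deriv_proj_eq (hα : α = (1 - P) * dP + (1 - P) * A * P) (hβ : β = P * -dP + P * A * (1 - P)) :
    dP = P * A - A * P + α - β := by
  rw [hα, hβ]
  noncomm_ring

/-- The two second fundamental forms of a unitary connection are negative adjoints. -/
lemma conjTranspose_offBlock (hP : P * P = P) (hPH : Pᴴ * H = H * P) (hdP : dP * P + P * dP = dP)
    (hdPH : dPᴴ * H + Pᴴ * dH = dH * P + H * dP) (hdH : dH = Aᴴ * H + H * A)
    (hα : α = (1 - P) * dP + (1 - P) * A * P) (hβ : β = P * -dP + P * A * (1 - P)) :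
    αᴴ * H = -(H * β) := by
  have hR : (1 - Pᴴ) * H = H * (1 - P) := by simp [sub_mul, mul_sub, hPH]
  have h1 : αᴴ * H = dPᴴ * H * (1 - P) + Pᴴ * (Aᴴ * H) * (1 - P) := by
    simp [hα, Matrix.conjTranspose_mul, mul_assoc, add_mul, hR]
  have h2 : dPᴴ * H = dH * P + H * dP - Pᴴ * dH := eq_sub_of_add_eq hdPH
  have h3 : dP * (1 - P) = P * dP := by rw [mul_sub, mul_one, sub_eq_iff_eq_add', hdP]
  have h4 : P * (1 - P) = 0 := by simp [mul_sub, hP]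
  have h5 : Aᴴ * H = dH - H * A := eq_sub_of_add_eq hdH.symm
  calc αᴴ * H = dH * (P * (1 - P)) + H * (dP * (1 - P)) - Pᴴ * H * A * (1 - P) := by
        rw [h1, h2, h5]; noncomm_ring
    _ = -(H * β) := by rw [h3, h4, hPH, hβ]; noncomm_ring

lemma conjTranspose_block (hPH : Pᴴ * H = H * P) (hφ : φᴴ * H = H * ψ) :
    (P * φ * (1 - P))ᴴ * H = H * ((1 - P) * ψ * P) := by
  have hR : (1 - Pᴴ) * H = H * (1 - P) := by simp [sub_mul, mul_sub, hPH]
  calc (P * φ * (1 - P))ᴴ * H = (1 - Pᴴ) * φᴴ * (Pᴴ * H) := by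
        simp [Matrix.conjTranspose_mul, mul_assoc]
    _ = (1 - Pᴴ) * (φᴴ * H) * P := by rw [hPH]; noncomm_ring
    _ = ((1 - Pᴴ) * H) * ψ * P := by rw [hφ]; noncomm_ring
    _ = _ := by rw [hR]; noncomm_ring

/-- Interchange of adjoints, as the metric is Hermitian. -/
lemma conjTranspose_mul_comm (hH : H.IsHermitian) (h : Xᴴ * H = H * Y) : Yᴴ * H = H * X := by
  have := congrArg Matrix.conjTranspose h
  simpa [Matrix.conjTranspose_mul, hH.eq] using this.symm

/-- The Higgs field is lower triangular with diagonal `(w, -w)`. -/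
lemma higgs_eq (hφP : φ * P = -w • P) (hφR : (1 - P) * φ * (1 - P) = w • (1 - P)) :
    φ = w • (1 - 2 • P) + P * φ * (1 - P) := by
  have h : φ = (1 - P) * φ * (1 - P) + P * φ * (1 - P) + φ * P := by noncomm_ring
  conv_lhs => rw [h, hφP, hφR]
  module

lemma higgsAdj_eq (hH : IsUnit H.det) (hPH : Pᴴ * H = H * P) (hφ : φᴴ * H = H * ψ)
    (hφw : φ = w • (1 - 2 • P) + P * φ * (1 - P)) :
    ψ = star w • (1 - 2 • P) + (1 - P) * ψ * P := by
  have h : H * ψ = H * (star w • (1 - 2 • P) + (1 - P) * ψ * P) := by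
    rw [mul_add, ← conjTranspose_block hPH hφ, ← hφ]
    conv_lhs => rw [hφw]
    rw [Matrix.conjTranspose_add, add_mul]
    congr 1
    simp [two_smul, add_mul, mul_add, sub_mul, mul_sub, hPH]
  have h' := congrArg (H⁻¹ * ·) h
  simpa [Matrix.nonsing_inv_mul_cancel_left _ _ hH] using h'

/-- The connection obtained by exchanging the second fundamental forms for the off-diagonal blocks
of the Higgs field and its adjoint is unitary for the metric with reversed sign on `ker P`. -/
lemma unitary_flip (σ : ℝ) (hdH : dH = Aᴴ * H + H * A) (hdP : dP = P * A - A * P + α - β)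
    (hα : MapsOut P α) (hβ : MapsIn P β) (hg : MapsOut P g) (hc : MapsIn P c)
    (hαβ : αᴴ * H = -(H * β)) (hβα : βᴴ * H = -(H * α)) (hgc : gᴴ * H = H * c)
    (hcg : cᴴ * H = H * g) :
    σ • (dH * (P - (1 - P)) + H * (dP + dP)) =
      (A - α - β + g + c)ᴴ * (σ • (H * (P - (1 - P)))) +
        σ • (H * (P - (1 - P))) * (A - α - β + g + c) := by
  have h : (A - α - β + g + c)ᴴ * H = Aᴴ * H + H * β + H * α + H * c + H * g := by
    simp only [Matrix.conjTranspose_add, Matrix.conjTranspose_sub, add_mul, sub_mul, hαβ, hβα,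
      hgc, hcg]
    abel
  rw [mul_smul_comm, smul_mul_assoc, ← mul_assoc, h, ← smul_add, hdH, hdP]
  congr 1
  simp only [mul_add, add_mul, mul_sub, sub_mul, mul_assoc, hα.left, hα.right, hβ.left, hβ.right,
    hg.left, hg.right, hc.left, hc.right, mul_zero, mul_one]
  abel

lemma conjTranspose_flip (σ : ℝ) (hPH : Pᴴ * H = H * P) (hβ : MapsIn P β)
    (hαβ : αᴴ * H = -(H * β)) :
    (w • (1 - 2 • P) + α)ᴴ * (σ • (H * (P - (1 - P)))) =
      σ • (H * (P - (1 - P))) * (star w • (1 - 2 • P) + β) := by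
  have h : (w • (1 - 2 • P) + α)ᴴ * H = H * (star w • (1 - 2 • P) - β) := by
    rw [Matrix.conjTranspose_add, add_mul, hαβ]
    simp [two_smul, add_mul, mul_add, hPH, sub_eq_add_neg, smul_add]
  rw [mul_smul_comm, smul_mul_assoc, ← mul_assoc, h]
  congr 1
  simp only [mul_add, mul_sub, sub_mul, mul_assoc, hβ.left, hβ.right, mul_zero,
    mul_one, smul_mul_assoc, mul_smul_comm]
  module

/-- The equation `∂̄^∇ Φ = 0` for the flipped data is the block of the curvature equation from the
image to the kernel of `P`. Subscripts denote values on `∂/∂x` and `∂/∂y`, `dA` is the coefficient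
of the exterior derivative, `w` and `w'` stand for `om` and `om̄`, and `i` for the imaginary
unit. -/
lemma dbar_flip {A₁ A₂ P₁ P₂ dA : Mat2} (w w' i : ℂ) (hP : P * P = P)
    (hα : MapsOut P α) (hβ : MapsIn P β) (hg : MapsOut P g) (hc : MapsIn P c)
    (hP₁ : P₁ = P * A₁ - A₁ * P + α - β)
    (hP₂ : P₂ = P * A₂ - A₂ * P + i • α + i • β)
    (hdA : dA + (A₁ * A₂ - A₂ * A₁) +
      (((w • (1 - 2 • P) + c) * (-i • (w' • (1 - 2 • P) + g)) -
        (i • (w • (1 - 2 • P) + c)) * (w' • (1 - 2 • P) + g)) +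
       ((w' • (1 - 2 • P) + g) * (i • (w • (1 - 2 • P) + c)) -
        (-i • (w' • (1 - 2 • P) + g)) * (w • (1 - 2 • P) + c))) = 0) :
    (-(2 * (i * w)) • P₁ + (2 * w) • P₂ - P₁ * P₂ + P₂ * P₁ - P₁ * A₂ * P + P₂ * A₁ * P
      + (1 - P) * dA * P + (1 - P) * A₂ * P₁ - (1 - P) * A₁ * P₂)
    + ((A₁ - α - β + g + c) * (i • (w • (1 - 2 • P) + α)) -
       (A₂ - i • α + i • β - i • g + i • c) * (w • (1 - 2 • P) + α))
    + ((w • (1 - 2 • P) + α) * (A₂ - i • α + i • β - i • g + i • c) -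
       (i • (w • (1 - 2 • P) + α)) * (A₁ - α - β + g + c)) = 0 := by
  have hP' (Z : Mat2) : P * (P * Z) = P * Z := by rw [← mul_assoc, hP]
  rw [eq_neg_of_add_eq_zero_left ((add_assoc _ _ _).symm.trans hdA), hP₁, hP₂]
  simp only [mul_add, add_mul, mul_sub, sub_mul, mul_assoc, smul_add, smul_sub, smul_mul_assoc,
    mul_smul_comm, smul_smul, mul_neg, neg_mul, neg_smul, smul_neg, mul_zero, zero_mul, smul_zero,
    mul_one, one_mul, hP, hP', hα.left, hα.right, hα.right', hg.left, hg.right, hg.left',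
    hβ.left, hβ.right, hβ.right', hc.left, hc.right, hc.left',
    hα.mul hα, hα.mul hg, hg.mul hα, hβ.mul hβ]
  module

/-- The block of the equation `∂̄^∇ Φ = 0` on the kernel of `P` says that the eigenvalue form is
closed. -/
lemma closed_eigenvalue {A₁ A₂ P₁ P₂ φ₁ φ₂ d₁φ₂ d₂φ₁ : Mat2} (w i d₁w₂ d₂w₁ : ℂ) (hP : P * P = P)
    (htr : P.trace = 1)
    (hα : MapsOut P α) (hβ : MapsIn P β) (hc : MapsIn P c)
    (hP₁ : P₁ = P * A₁ - A₁ * P + α - β)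
    (hP₂ : P₂ = P * A₂ - A₂ * P + i • α + i • β)
    (hφ₁ : φ₁ = w • (1 - 2 • P) + c) (hφ₂ : φ₂ = i • (w • (1 - 2 • P) + c))
    (h₁ : -P₁ * φ₂ + (1 - P) * d₁φ₂ = d₁w₂ • (1 - P) - (i * w) • P₁)
    (h₂ : -P₂ * φ₁ + (1 - P) * d₂φ₁ = d₂w₁ • (1 - P) - w • P₂)
    (hdφ : d₁φ₂ - d₂φ₁ + (A₁ * φ₂ - A₂ * φ₁) + (φ₁ * A₂ - φ₂ * A₁) = 0) :
    d₁w₂ = d₂w₁ := by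
  have hP' (Z : Mat2) : P * (P * Z) = P * Z := by rw [← mul_assoc, hP]
  have h : (d₁w₂ - d₂w₁) • (1 - P) = 0 := by
    have e : (d₁w₂ - d₂w₁) • (1 - P) =
        (-P₁ * φ₂ + P₂ * φ₁ + (1 - P) * (d₁φ₂ - d₂φ₁) + (i * w) • P₁ - w • P₂) * (1 - P) := by
      have e1 : (1 - P) * (1 - P) = 1 - P := by simp [mul_sub, sub_mul, hP]
      have e2 : (d₁w₂ - d₂w₁) • (1 - P) =
          -P₁ * φ₂ + P₂ * φ₁ + (1 - P) * (d₁φ₂ - d₂φ₁) + (i * w) • P₁ - w • P₂ := by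
        have f₁ : d₁w₂ • (1 - P) = -P₁ * φ₂ + (1 - P) * d₁φ₂ + (i * w) • P₁ := by rw [h₁]; abel
        have f₂ : d₂w₁ • (1 - P) = -P₂ * φ₁ + (1 - P) * d₂φ₁ + w • P₂ := by rw [h₂]; abel
        rw [sub_smul, f₁, f₂, neg_mul, neg_mul, mul_sub]
        abel
      rw [← e2, smul_mul_assoc, e1]
    have hdφ' : d₁φ₂ - d₂φ₁ = -((A₁ * φ₂ - A₂ * φ₁) + (φ₁ * A₂ - φ₂ * A₁)) :=
      eq_neg_of_add_eq_zero_left ((add_assoc _ _ _).symm.trans hdφ)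
    rw [e, hdφ', hφ₁, hφ₂, hP₁, hP₂]
    simp only [mul_add, add_mul, mul_sub, sub_mul, mul_assoc, smul_add, smul_sub, smul_mul_assoc,
      mul_smul_comm, smul_smul, mul_neg, neg_mul, smul_neg, mul_zero, zero_mul,
      smul_zero, mul_one, one_mul, hP, hP', hα.right, hβ.right,
      hc.left, hc.right, hc.left', hβ.mul hc]
    module
  have h' := congrArg Matrix.trace h
  rw [Matrix.trace_smul, Matrix.trace_sub, htr] at h'
  simp only [Matrix.trace_one, Fintype.card_fin, Matrix.trace_zero, smul_eq_mul] at h'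
  exact sub_eq_zero.mp (by linear_combination h')

/-- The equation for the adjoint Higgs field is the adjoint of the equation for the Higgs field. -/
lemma dbar_adjoint {A₁ A₂ H₁ H₂ φ₁ φ₂ ψ₁ ψ₂ d₁φ₂ d₂φ₁ d₁ψ₂ d₂ψ₁ : Mat2} (hH : IsUnit H.det)
    (hH₁ : H₁ = A₁ᴴ * H + H * A₁) (hH₂ : H₂ = A₂ᴴ * H + H * A₂)
    (h₁ : φ₁ᴴ * H = H * ψ₁) (h₂ : φ₂ᴴ * H = H * ψ₂)
    (h₁₂ : d₁φ₂ᴴ * H + φ₂ᴴ * H₁ = H₁ * ψ₂ + H * d₁ψ₂)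
    (h₂₁ : d₂φ₁ᴴ * H + φ₁ᴴ * H₂ = H₂ * ψ₁ + H * d₂ψ₁)
    (hφ : d₁φ₂ - d₂φ₁ + (A₁ * φ₂ - A₂ * φ₁) + (φ₁ * A₂ - φ₂ * A₁) = 0) :
    d₁ψ₂ - d₂ψ₁ + (A₁ * ψ₂ - A₂ * ψ₁) + (ψ₁ * A₂ - ψ₂ * A₁) = 0 := by
  have h : H * (d₁ψ₂ - d₂ψ₁ + (A₁ * ψ₂ - A₂ * ψ₁) + (ψ₁ * A₂ - ψ₂ * A₁)) =
      (d₁φ₂ - d₂φ₁ + (A₁ * φ₂ - A₂ * φ₁) + (φ₁ * A₂ - φ₂ * A₁))ᴴ * H := by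
    have e₁ : H * d₁ψ₂ = d₁φ₂ᴴ * H + φ₂ᴴ * H₁ - H₁ * ψ₂ := by rw [h₁₂]; abel
    have e₂ : H * d₂ψ₁ = d₂φ₁ᴴ * H + φ₁ᴴ * H₂ - H₂ * ψ₁ := by rw [h₂₁]; abel
    have f₁ (Z : Mat2) : φ₁ᴴ * (H * Z) = H * (ψ₁ * Z) := by rw [← mul_assoc, h₁, mul_assoc]
    have f₂ (Z : Mat2) : φ₂ᴴ * (H * Z) = H * (ψ₂ * Z) := by rw [← mul_assoc, h₂, mul_assoc]
    rw [mul_add, mul_add, mul_sub, e₁, e₂, hH₁, hH₂]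
    simp only [Matrix.conjTranspose_add, Matrix.conjTranspose_sub, Matrix.conjTranspose_mul,
      mul_add, add_mul, mul_sub, sub_mul, mul_assoc, h₁, h₂, f₁, f₂]
    abel
  rw [hφ, Matrix.conjTranspose_zero, zero_mul] at h
  have h' := congrArg (H⁻¹ * ·) h
  simpa only [Matrix.nonsing_inv_mul_cancel_left _ _ hH, mul_zero] using h'

end Blocks

/-! ### Smooth forms and the adjoint Higgs field -/

section SmoothForms

variable {M : Type*} [TopologicalSpace M] [ChartedSpace ℂ M]
variable {V : Type*} [NormedAddCommGroup V] [NormedSpace ℝ V]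

lemma SmoothForm.add {α β : OneForm M V} (hα : SmoothForm α) (hβ : SmoothForm β) :
    SmoothForm (fun p => α p + β p) := fun e he v => (hα e he v).add (hβ e he v)

lemma SmoothForm.sub {α β : OneForm M V} (hα : SmoothForm α) (hβ : SmoothForm β) :
    SmoothForm (fun p => α p - β p) := fun e he v => (hα e he v).sub (hβ e he v)

lemma SmoothForm.mulLeft {α : OneForm M Mat2} (hα : SmoothForm α) {f : M → Mat2}
    (hf : SmoothMap f) : SmoothForm (fun p => LinearMap.mulLeft ℝ (f p) ∘ₗ α p) := fun e he v =>
  contDiffOn_mul (hf.contDiffOn_comp_symm he) (hα e he v)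

lemma SmoothForm.mulLeftRight {α : OneForm M Mat2} (hα : SmoothForm α) {f g : M → Mat2}
    (hf : SmoothMap f) (hg : SmoothMap g) :
    SmoothForm (fun p => LinearMap.mulLeftRight ℝ (f p, g p) ∘ₗ α p) := fun e he v =>
  contDiffOn_mul (contDiffOn_mul (hf.contDiffOn_comp_symm he) (hα e he v))
    (hg.contDiffOn_comp_symm he)

lemma SmoothForm.conjTranspose {α : OneForm M Mat2} (hα : SmoothForm α) :
    SmoothForm (fun p =>
      (Matrix.conjTransposeLinearEquiv (Fin 2) (Fin 2) ℝ ℂ).toLinearMap ∘ₗ α p) := fun e he v =>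
  contDiffOn_conjTranspose (hα e he v)

lemma SmoothForm.smulRight {α : OneForm M ℂ} (hα : SmoothForm α) {f : M → Mat2}
    (hf : SmoothMap f) : SmoothForm (fun p => (α p).smulRight (f p)) := fun e he v =>
  (hα e he v).smul (hf.contDiffOn_comp_symm he)

variable {e : OpenPartialHomeomorph M ℂ} {z : ℂ}

lemma SmoothForm.differentiableAt {α : OneForm M V} (hα : SmoothForm α) (he : e ∈ holCharts M)
    (hz : z ∈ e.target) (v : ℂ) : DifferentiableAt ℝ (fun w => α.inChart e w v) z :=
  ((hα e he v).contDiffAt (e.open_target.mem_nhds hz)).differentiableAt (by simp)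

lemma dCoeff_add {α β : OneForm M V} (hα : SmoothForm α) (hβ : SmoothForm β)
    (he : e ∈ holCharts M) (hz : z ∈ e.target) :
    dCoeff (fun p => α p + β p) e z = dCoeff α e z + dCoeff β e z := by
  have h (v : ℂ) := fderiv_fun_add (hα.differentiableAt he hz v) (hβ.differentiableAt he hz v)
  have h' (v : ℂ) : (fun w => OneForm.inChart (fun p => α p + β p) e w v) =
    fun w => α.inChart e w v + β.inChart e w v := rfl
  simp only [dCoeff, h', h, add_apply]
  abel

end SmoothForms

namespace Data

variable {M : Type*} [TopologicalSpace M] [ChartedSpace ℂ M] {D : Data M}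

/-- Smooth data with a unitary connection and a Higgs field of type `(1,0)`, without trace
conditions and self-duality equations; `d` is the constant value of the determinant of the metric.
Both the given and the flipped data are of this kind, with `d = -1` and `d = 1`. -/
structure IsUnitaryPair (D : Data M) (d : ℂ) : Prop where
  smooth_conn : SmoothForm D.conn
  smooth_higgs : SmoothForm D.higgs
  smooth_metric : SmoothMap D.metric
  hermitian : ∀ p, (D.metric p).IsHermitian
  unitary : ∀ p v, diff D.metric p v = (D.conn p v)ᴴ * D.metric p + D.metric p * D.conn p v
  type_higgs : IsType10 D.higgs
  det_metric : ∀ p, (D.metric p).det = d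
  det_ne_zero : d ≠ 0

lemma higgsAdj_apply (p : M) (v : TangentSpace 𝓘(ℝ, ℂ) p) :
    D.higgsAdj p v = (D.metric p)⁻¹ * (D.higgs p v)ᴴ * D.metric p := rfl

namespace IsUnitaryPair

variable {d : ℂ} (hD : D.IsUnitaryPair d)
include hD

lemma isUnit_det (p : M) : IsUnit (D.metric p).det := by
  rw [hD.det_metric]
  exact hD.det_ne_zero.isUnit

lemma conjTranspose_higgs (p : M) (v : TangentSpace 𝓘(ℝ, ℂ) p) :
    (D.higgs p v)ᴴ * D.metric p = D.metric p * D.higgsAdj p v := by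
  rw [higgsAdj_apply, mul_assoc, Matrix.mul_nonsing_inv_cancel_left _ _ (hD.isUnit_det p)]

lemma higgsAdj_eq_of_conjTranspose {p : M} {v : TangentSpace 𝓘(ℝ, ℂ) p} {Y : Mat2}
    (h : (D.higgs p v)ᴴ * D.metric p = D.metric p * Y) : D.higgsAdj p v = Y := by
  rw [higgsAdj_apply, mul_assoc, h, Matrix.nonsing_inv_mul_cancel_left _ _ (hD.isUnit_det p)]

lemma smoothForm_higgsAdj [IsManifold 𝓘(ℂ) ω M] : SmoothForm D.higgsAdj := by
  have h : SmoothMap (fun p => (D.metric p)⁻¹) := by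
    have e : (fun p => (D.metric p)⁻¹) = fun p => d⁻¹ • (D.metric p).adjugate := by
      funext p
      rw [Matrix.inv_def, hD.det_metric, Ring.inverse_eq_inv']
    rw [e]
    exact smoothMap_of_charts fun _ he =>
      (contDiffOn_adjugate (hD.smooth_metric.contDiffOn_comp_symm he)).const_smul d⁻¹
  exact hD.smooth_higgs.conjTranspose.mulLeftRight h hD.smooth_metric

variable {e : OpenPartialHomeomorph M ℂ} {z : ℂ}

/-- The adjoint of a `(1,0)`-form has type `(0,1)`. -/
lemma higgsAdj_I_mul (he : e ∈ holCharts M) (hz : z ∈ e.target) (v : ℂ) :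
    D.higgsAdj.inChart e z (Complex.I * v) = -Complex.I • D.higgsAdj.inChart e z v := by
  apply hD.higgsAdj_eq_of_conjTranspose (p := e.symm z)
  have h := hD.type_higgs e he z hz v
  have h' := hD.conjTranspose_higgs (e.symm z) (mfderiv 𝓘(ℝ, ℂ) 𝓘(ℝ, ℂ) e.symm z v)
  change (D.higgs.inChart e z (Complex.I * v))ᴴ * D.metric (e.symm z) = _
  rw [h, Matrix.conjTranspose_smul, smul_mul_assoc, mul_smul_comm]
  have h'' : (D.higgs.inChart e z v)ᴴ * D.metric (e.symm z) =
    D.metric (e.symm z) * D.higgsAdj.inChart e z v := h'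
  rw [h'']
  simp

lemma fderiv_metric (he : e ∈ holCharts M) (hz : z ∈ e.target) (v : ℂ) :
    fderiv ℝ (D.metric ∘ e.symm) z v = (D.conn.inChart e z v)ᴴ * D.metric (e.symm z) +
      D.metric (e.symm z) * D.conn.inChart e z v :=
  (hD.smooth_metric.diff_inChart he hz v).symm.trans (hD.unitary _ _)

/-- The equation `∂^∇ Φ* = 0`. -/
lemma del_higgsAdj [IsManifold 𝓘(ℂ) ω M] (he : e ∈ holCharts M) (hz : z ∈ e.target)
    (h : dCoeff D.higgs e z + wedgeCoeff D.conn D.higgs e z + wedgeCoeff D.higgs D.conn e z = 0) :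
    dCoeff D.higgsAdj e z + wedgeCoeff D.conn D.higgsAdj e z
      + wedgeCoeff D.higgsAdj D.conn e z = 0 := by
  have key (u v : ℂ) :
      (fderiv ℝ (fun w => D.higgs.inChart e w u) z v)ᴴ * D.metric (e.symm z) +
        (D.higgs.inChart e z u)ᴴ * fderiv ℝ (D.metric ∘ e.symm) z v =
      fderiv ℝ (D.metric ∘ e.symm) z v * D.higgsAdj.inChart e z u +
        D.metric (e.symm z) * fderiv ℝ (fun w => D.higgsAdj.inChart e w u) z v := by
    have hH := hD.smooth_metric.differentiableAt_comp_symm he hz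
    have hφ := hD.smooth_higgs.differentiableAt he hz u
    have hψ := hD.smoothForm_higgsAdj.differentiableAt he hz u
    have e₁ := fderiv_mul_apply (differentiableAt_conjTranspose hφ) hH v
    rw [fderiv_conjTranspose_apply hφ] at e₁
    refine e₁.symm.trans (Eq.trans ?_ (fderiv_mul_apply hH hψ v))
    congr 2
    funext w
    exact hD.conjTranspose_higgs _ _
  exact dbar_adjoint (hD.isUnit_det (e.symm z)) (hD.fderiv_metric he hz 1)
    (hD.fderiv_metric he hz Complex.I) (hD.conjTranspose_higgs _ _) (hD.conjTranspose_higgs _ _)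
    (key Complex.I 1) (key 1 Complex.I) h

lemma wedgeCoeff_higgs_self (he : e ∈ holCharts M) (hz : z ∈ e.target) :
    wedgeCoeff D.higgs D.higgs e z = 0 := by
  have h := hD.type_higgs e he z hz 1
  rw [mul_one] at h
  simp [wedgeCoeff, h]

lemma wedgeCoeff_higgsAdj_self (he : e ∈ holCharts M) (hz : z ∈ e.target) :
    wedgeCoeff D.higgsAdj D.higgsAdj e z = 0 := by
  have h := hD.higgsAdj_I_mul he hz 1
  rw [mul_one] at h
  simp [wedgeCoeff, h]

/-- The curvature of `∇ + Φ + Φ*` is `F^∇ + [Φ ∧ Φ*]` once `∂̄^∇ Φ = 0`. -/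
lemma curvature_totalForm [IsManifold 𝓘(ℂ) ω M] (he : e ∈ holCharts M) (hz : z ∈ e.target)
    (h : dCoeff D.higgs e z + wedgeCoeff D.conn D.higgs e z + wedgeCoeff D.higgs D.conn e z = 0) :
    dCoeff D.totalForm e z + wedgeCoeff D.totalForm D.totalForm e z =
      dCoeff D.conn e z + wedgeCoeff D.conn D.conn e z
      + (wedgeCoeff D.higgs D.higgsAdj e z + wedgeCoeff D.higgsAdj D.higgs e z) := by
  have h₁ : dCoeff D.totalForm e z = dCoeff D.conn e z + dCoeff D.higgs e z +
      dCoeff D.higgsAdj e z := by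
    rw [← dCoeff_add hD.smooth_conn hD.smooth_higgs he hz,
      ← dCoeff_add (hD.smooth_conn.add hD.smooth_higgs) hD.smoothForm_higgsAdj he hz]
    rfl
  have h₂ : wedgeCoeff D.totalForm D.totalForm e z = wedgeCoeff D.conn D.conn e z +
      (wedgeCoeff D.higgs D.higgsAdj e z + wedgeCoeff D.higgsAdj D.higgs e z) +
      (wedgeCoeff D.conn D.higgs e z + wedgeCoeff D.higgs D.conn e z) +
      (wedgeCoeff D.conn D.higgsAdj e z + wedgeCoeff D.higgsAdj D.conn e z) +
      wedgeCoeff D.higgs D.higgs e z + wedgeCoeff D.higgsAdj D.higgsAdj e z := by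
    have h₃ (v : ℂ) : D.totalForm.inChart e z v = D.conn.inChart e z v + D.higgs.inChart e z v +
      D.higgsAdj.inChart e z v := rfl
    simp only [wedgeCoeff, h₃]
    noncomm_ring
  rw [h₁, h₂, hD.wedgeCoeff_higgs_self he hz, hD.wedgeCoeff_higgsAdj_self he hz]
  have h' := hD.del_higgsAdj he hz h
  refine eq_of_sub_eq_zero (Eq.trans ?_ ((congrArg₂ (· + ·) h h').trans (add_zero 0)))
  abel

end IsUnitaryPair

end Data

/-! ### The orthogonal projection onto a non-null line -/

section LineProjection

/-- The orthogonal projection onto the line spanned by `s`, for a Hermitian form `H` with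
`⟨s, s⟩ ≠ 0`. -/
noncomputable def lineProj (H : Mat2) (s : Fin 2 → ℂ) : Mat2 :=
  (herm H s s)⁻¹ • (Matrix.vecMulVec s (star s) * H)

variable {H P : Mat2} {s : Fin 2 → ℂ}

lemma herm_smul (H : Mat2) (a : ℂ) (s : Fin 2 → ℂ) :
    herm H (a • s) (a • s) = (Complex.normSq a : ℂ) * herm H s s := by
  rw [herm, star_smul, Matrix.mulVec_smul, smul_dotProduct, dotProduct_smul, smul_eq_mul,
    smul_eq_mul, ← mul_assoc, Complex.normSq_eq_conj_mul_self, herm]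
  rfl

lemma conj_herm (hH : H.IsHermitian) (s : Fin 2 → ℂ) : star (herm H s s) = herm H s s := by
  have h := Matrix.star_dotProduct s (H *ᵥ s)
  rw [Matrix.star_mulVec, hH.eq, ← Matrix.dotProduct_mulVec] at h
  exact h.symm

lemma lineProj_smul {a : ℂ} (ha : a ≠ 0) : lineProj H (a • s) = lineProj H s := by
  have h : Matrix.vecMulVec (a • s) (star (a • s)) =
      (Complex.normSq a : ℂ) • Matrix.vecMulVec s (star s) := by
    rw [star_smul, Matrix.vecMulVec_smul, Matrix.smul_vecMulVec, smul_smul,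
      Complex.normSq_eq_conj_mul_self]
    rfl
  have h0 : (Complex.normSq a : ℂ) ≠ 0 := by simpa using ha
  rw [lineProj, h, herm_smul, smul_mul_assoc, smul_smul, mul_inv, mul_comm (_⁻¹), mul_assoc,
    inv_mul_cancel₀ h0, mul_one, lineProj]

lemma lineProj_mulVec (w : Fin 2 → ℂ) :
    lineProj H s *ᵥ w = ((herm H s s)⁻¹ * herm H s w) • s := by
  rw [lineProj, Matrix.smul_mulVec, Matrix.vecMulVec_mul, Matrix.vecMulVec_mulVec,
    ← Matrix.dotProduct_mulVec, op_smul_eq_smul, ← herm, ← mul_smul]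

lemma lineProj_mulVec_self (hs : herm H s s ≠ 0) : lineProj H s *ᵥ s = s := by
  rw [lineProj_mulVec, inv_mul_cancel₀ hs, one_smul]

lemma lineProj_mul_self (hs : herm H s s ≠ 0) : lineProj H s * lineProj H s = lineProj H s := by
  refine Matrix.ext_of_mulVec_single fun i => ?_
  rw [← Matrix.mulVec_mulVec, lineProj_mulVec (Pi.single i 1), Matrix.mulVec_smul,
    lineProj_mulVec_self hs]

lemma trace_lineProj (hs : herm H s s ≠ 0) : (lineProj H s).trace = 1 := by
  rw [lineProj, Matrix.trace_smul, Matrix.vecMulVec_mul, Matrix.trace_vecMulVec, dotProduct_comm,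
    ← Matrix.dotProduct_mulVec]
  exact inv_mul_cancel₀ hs

lemma conjTranspose_lineProj (hH : H.IsHermitian) :
    (lineProj H s)ᴴ * H = H * lineProj H s := by
  have h : (Matrix.vecMulVec s (star s))ᴴ = Matrix.vecMulVec s (star s) := by
    rw [Matrix.conjTranspose_vecMulVec, star_star]
  rw [lineProj, Matrix.conjTranspose_smul, Matrix.conjTranspose_mul, h, hH.eq, star_inv₀,
    conj_herm hH]
  simp [mul_assoc]

lemma det_of_idempotent (hP : P * P = P) (htr : P.trace = 1) : P.det = 0 := by
  by_contra h
  have h1 : P = 1 := by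
    have := congrArg (P⁻¹ * ·) hP
    simpa [Matrix.nonsing_inv_mul_cancel_left _ _ (Ne.isUnit h),
      Matrix.nonsing_inv_mul _ (Ne.isUnit h)] using this
  rw [h1] at htr
  simp at htr

lemma det_one_sub (htr : P.trace = 1) : (1 - P).det = P.det := by
  rw [Matrix.trace_fin_two] at htr
  simp only [Matrix.det_fin_two, Matrix.sub_apply, Matrix.one_apply_eq, ne_eq, zero_ne_one,
    one_ne_zero, not_false_eq_true, Matrix.one_apply_ne]
  linear_combination -htr

/-- The kernel of a rank one projection is a line, so an endomorphism compresses to a scalar on it,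
namely to the trace of its compression. -/
lemma compress_ker (hP : P * P = P) (htr : P.trace = 1) (X : Mat2) :
    (1 - P) * X * (1 - P) = ((1 - P) * X).trace • (1 - P) := by
  have h (R : Mat2) : R * X * R = (R * X).trace • R - R.det • X.adjugate := by
    rw [Matrix.adjugate_fin_two, Matrix.det_fin_two]
    ext i j
    fin_cases i <;> fin_cases j <;>
      simp [Matrix.mul_apply, Fin.sum_univ_two, Matrix.trace_fin_two] <;> ring
  rw [h, det_one_sub htr, det_of_idempotent hP htr, zero_smul, sub_zero]

/-- Reversing the sign of a form on the kernel of `P` reverses the sign of its determinant. -/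
lemma det_flip (hP : P * P = P) (htr : P.trace = 1) : (P - (1 - P)).det = -1 := by
  have h := det_of_idempotent hP htr
  rw [Matrix.trace_fin_two] at htr
  rw [Matrix.det_fin_two] at h ⊢
  simp only [Matrix.sub_apply, Matrix.one_apply_eq, ne_eq, zero_ne_one,
    one_ne_zero, not_false_eq_true, Matrix.one_apply_ne]
  linear_combination 4 * h - 2 * htr

/-- A Hermitian `2 × 2` matrix of determinant one that is positive on one vector is positive
definite. -/
lemma posDef_of_det_pos {K : Mat2} (hK : K.IsHermitian) (hdet : K.det = 1)
    (hs : 0 < (herm K s s).re) : K.PosDef := by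
  have h00 : (K 0 0).im = 0 := Complex.conj_eq_iff_im.mp (hK.apply 0 0)
  have h11 : (K 1 1).im = 0 := Complex.conj_eq_iff_im.mp (hK.apply 1 1)
  have h10 : K 1 0 = (starRingEnd ℂ) (K 0 1) := (hK.apply 1 0).symm
  have hd : (K 0 0).re * (K 1 1).re - ((K 0 1).re ^ 2 + (K 0 1).im ^ 2) = 1 := by
    have := congrArg Complex.re hdet
    rw [Matrix.det_fin_two, h10] at this
    simp [h00, h11] at this
    linarith
  -- completing the square
  have key (w : Fin 2 → ℂ) : (K 0 0).re * (herm K w w).re =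
      Complex.normSq (K 0 0 * w 0 + K 0 1 * w 1) + Complex.normSq (w 1) := by
    simp only [herm, dotProduct, Matrix.mulVec, Fin.sum_univ_two, h10, Complex.normSq_apply]
    simp [h00, h11]
    linear_combination ((w 1).re ^ 2 + (w 1).im ^ 2) * hd
  have hpos : 0 < (K 0 0).re := by
    have h := key s
    by_contra hneg
    have h1 : (K 0 0).re * (herm K s s).re ≤ 0 :=
      mul_nonpos_of_nonpos_of_nonneg (not_lt.mp hneg) hs.le
    have h2 := Complex.normSq_nonneg (K 0 0 * s 0 + K 0 1 * s 1)
    have h3 := Complex.normSq_nonneg (s 1)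
    have h4 : (K 0 0).re = 0 := by
      have : (K 0 0).re * (herm K s s).re = 0 := by linarith
      exact (mul_eq_zero.mp this).resolve_right hs.ne'
    rw [h4] at hd
    nlinarith [sq_nonneg (K 0 1).re, sq_nonneg (K 0 1).im]
  refine Matrix.PosDef.of_dotProduct_mulVec_pos hK fun w hw => ?_
  have hre : herm K w w = ((herm K w w).re : ℂ) :=
    (Complex.conj_eq_iff_re.mp (conj_herm hK w)).symm
  change 0 < herm K w w
  rw [hre]
  norm_cast
  have h := key w
  have h5 : 0 < Complex.normSq (K 0 0 * w 0 + K 0 1 * w 1) + Complex.normSq (w 1) := by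
    by_cases h1 : w 1 = 0
    · have h0 : w 0 ≠ 0 := fun h0 => hw (by ext i; fin_cases i <;> simp [h0, h1])
      have hK0 : K 0 0 ≠ 0 := fun h' => by rw [h'] at hpos; simp at hpos
      simpa [h1] using mul_pos (Complex.normSq_pos.mpr hK0) (Complex.normSq_pos.mpr h0)
    · exact add_pos_of_nonneg_of_pos (Complex.normSq_nonneg _) (Complex.normSq_pos.mpr h1)
  rw [← h] at h5
  exact pos_of_mul_pos_right h5 hpos.le

end LineProjection

/-! ### The eigenline and its second fundamental forms -/

namespace Data

lemma rep_mem {M : Type*} (L : M → ℙ ℂ (Fin 2 → ℂ)) (p : M) : (L p).rep ∈ (L p).submodule := by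
  rw [Projectivization.submodule_eq]
  exact Submodule.mem_span_singleton_self _

lemma exists_smul_rep {M : Type*} {L : M → ℙ ℂ (Fin 2 → ℂ)} {p : M} {s : Fin 2 → ℂ}
    (hs : s ∈ (L p).submodule) (h0 : s ≠ 0) : ∃ a : ℂ, a ≠ 0 ∧ s = a • (L p).rep := by
  rw [Projectivization.submodule_eq, Submodule.mem_span_singleton] at hs
  obtain ⟨a, rfl⟩ := hs
  exact ⟨a, fun h => h0 (by simp [h]), rfl⟩

variable {M : Type*} [TopologicalSpace M] [ChartedSpace ℂ M]

/-- The hypotheses on the eigenline of an `SU(1,1)`-solution under which the signature flip can be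
reversed. -/
structure IsFlippable (D : Data M) (om : OneForm M ℂ) (L : M → ℙ ℂ (Fin 2 → ℂ)) : Prop where
  sol : D.IsSU11Solution
  smooth_om : SmoothForm om
  type_om : IsType10 om
  eigenline : D.IsEigenline (-om) L
  nonnull : D.NowhereNull L

lemma IsSU11Solution.isUnitaryPair {D : Data M} (hD : D.IsSU11Solution) :
    D.IsUnitaryPair (-1) where
  __ := hD.toSelfDual
  det_metric := hD.det_metric
  det_ne_zero := by simp

variable {D : Data M} {L : M → ℙ ℂ (Fin 2 → ℂ)}

lemma proj_eq_lineProj {p : M} {s : Fin 2 → ℂ} (hs : s ∈ (L p).submodule) (h0 : s ≠ 0) :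
    D.proj L p = lineProj (D.metric p) s := by
  obtain ⟨a, ha, rfl⟩ := exists_smul_rep hs h0
  exact (lineProj_smul ha).symm

lemma signOn_eq {p : M} {s : Fin 2 → ℂ} (hs : s ∈ (L p).submodule) (h0 : s ≠ 0) :
    D.signOn L p = Real.sign (herm (D.metric p) s s).re := by
  obtain ⟨a, ha, rfl⟩ := exists_smul_rep hs h0
  rw [herm_smul, Complex.re_ofReal_mul, signOn]
  have hr := Complex.normSq_pos.mpr ha
  rcases lt_trichotomy (herm (D.metric p) (L p).rep (L p).rep).re 0 with h | h | h
  · rw [Real.sign_of_neg h, Real.sign_of_neg (mul_neg_of_pos_of_neg hr h)]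
  · rw [h, mul_zero]
  · rw [Real.sign_of_pos h, Real.sign_of_pos (mul_pos hr h)]

lemma proj_mulVec_mem (p : M) (w : Fin 2 → ℂ) : D.proj L p *ᵥ w ∈ (L p).submodule := by
  have h : D.proj L p = lineProj (D.metric p) (L p).rep := rfl
  rw [h, lineProj_mulVec]
  exact Submodule.smul_mem _ _ (rep_mem L p)

end Data

lemma herm_eq_trace (H : Mat2) (s : Fin 2 → ℂ) :
    herm H s s = (Matrix.vecMulVec s (star s) * H).trace := by
  rw [Matrix.vecMulVec_mul, Matrix.trace_vecMulVec, dotProduct_comm, ← Matrix.dotProduct_mulVec,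
    herm]

lemma contDiffOn_lineProj {E : Type*} [NormedAddCommGroup E] [NormedSpace ℝ E] {n : ℕ∞ω}
    {H : E → Mat2} {s : E → Fin 2 → ℂ} {U : Set E} (hH : ContDiffOn ℝ n H U)
    (hs : ContDiffOn ℝ n s U) (h0 : ∀ x ∈ U, herm (H x) (s x) (s x) ≠ 0) :
    ContDiffOn ℝ n (fun x => lineProj (H x) (s x)) U := by
  have hW : ContDiffOn ℝ n (fun x => Matrix.vecMulVec (s x) (star (s x))) U := by
    refine contDiffOn_pi.mpr fun i => contDiffOn_pi.mpr fun j => ?_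
    exact (contDiffOn_pi.mp hs i).mul
      (Complex.conjCLE.contDiff.comp_contDiffOn (contDiffOn_pi.mp hs j))
  have hWH := contDiffOn_mul hW hH
  have htr : ContDiffOn ℝ n (fun x => herm (H x) (s x) (s x)) U := by
    simp only [herm_eq_trace]
    exact (LinearMap.toContinuousLinearMap
      (Matrix.traceLinearMap (Fin 2) ℝ ℂ)).contDiff.comp_contDiffOn hWH
  exact (htr.inv h0).smul hWH

namespace Data

variable {M : Type*} [TopologicalSpace M] [ChartedSpace ℂ M]
variable {D : Data M} {om : OneForm M ℂ} {L : M → ℙ ℂ (Fin 2 → ℂ)}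

lemma offBlock_apply (P R : M → Mat2) (p : M) (v : TangentSpace 𝓘(ℝ, ℂ) p) :
    D.offBlock P R p v = R p * diff P p v + R p * D.conn p v * P p := rfl

/-- The second fundamental form of the line, a form with values in `Hom(L, L^†)`. -/
lemma sff_apply (p : M) (v : TangentSpace 𝓘(ℝ, ℂ) p) :
    D.offBlock (D.proj L) (D.coproj L) p v = (1 - D.proj L p) * diff (D.proj L) p v +
      (1 - D.proj L p) * D.conn p v * D.proj L p := rfl

namespace IsFlippable

variable (hD : D.IsFlippable om L)
include hD

lemma pair : D.IsUnitaryPair (-1) := hD.sol.isUnitaryPair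

lemma herm_rep_ne_zero (p : M) : herm (D.metric p) (L p).rep (L p).rep ≠ 0 :=
  hD.nonnull p _ (rep_mem L p) (L p).rep_nonzero

lemma proj_mul_self (p : M) : D.proj L p * D.proj L p = D.proj L p :=
  lineProj_mul_self (hD.herm_rep_ne_zero p)

lemma trace_proj (p : M) : (D.proj L p).trace = 1 := trace_lineProj (hD.herm_rep_ne_zero p)

lemma conjTranspose_proj (p : M) : (D.proj L p)ᴴ * D.metric p = D.metric p * D.proj L p :=
  conjTranspose_lineProj (hD.pair.hermitian p)

lemma proj_mulVec_of_mem {p : M} {s : Fin 2 → ℂ} (hs : s ∈ (L p).submodule) :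
    D.proj L p *ᵥ s = s := by
  by_cases h0 : s = 0
  · simp [h0]
  · rw [proj_eq_lineProj hs h0, lineProj_mulVec_self (hD.nonnull p s hs h0)]

lemma smooth_proj [IsManifold 𝓘(ℂ) ω M] : SmoothMap (D.proj L) := by
  intro p
  obtain ⟨U, hU, hpU, s, hs, hsL, -⟩ := hD.eigenline.1 p
  have he := chartAt_mem_holCharts p
  set e := chartAt ℂ p
  have hp : p ∈ e.source := mem_chart_source ℂ p
  refine contMDiffAt_of_contDiffAt he hp ?_
  have hW : IsOpen (e.target ∩ e.symm ⁻¹' U) := e.isOpen_inter_preimage_symm hU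
  have hpW : e p ∈ e.target ∩ e.symm ⁻¹' U :=
    ⟨e.map_source hp, by simpa [e.left_inv hp] using hpU⟩
  have h := contDiffOn_lineProj
    ((hD.pair.smooth_metric.contDiffOn_comp_symm he).mono Set.inter_subset_left)
    (contDiffOn_comp_symm hs he)
    (fun z hz => hD.nonnull _ _ (hsL _ hz.2).2 (hsL _ hz.2).1)
  refine ((h.congr fun z hz => ?_).contDiffAt (hW.mem_nhds hpW))
  exact proj_eq_lineProj (hsL _ hz.2).2 (hsL _ hz.2).1

/-- The sign of the metric on the line is locally constant, as it can be computed with a continuous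
local section. -/
lemma signOn_const [IsManifold 𝓘(ℂ) ω M] [ConnectedSpace M] :
    ∃ ε : ℝ, (ε = 1 ∨ ε = -1) ∧ ∀ p, D.signOn L p = -ε := by
  have hre (p : M) : (herm (D.metric p) (L p).rep (L p).rep).re ≠ 0 := by
    intro h
    apply hD.herm_rep_ne_zero p
    rw [← Complex.conj_eq_iff_re.mp (conj_herm (hD.pair.hermitian p) _), h, Complex.ofReal_zero]
  have hloc : IsLocallyConstant (D.signOn L) := by
    refine (IsLocallyConstant.iff_eventually_eq _).mpr fun p => ?_
    obtain ⟨U, hU, hpU, s, hs, hsL, -⟩ := hD.eigenline.1 p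
    have hc : ContinuousAt (fun q => (herm (D.metric q) (s q) (s q)).re) p := by
      have h1 : ContinuousAt s p := hs.continuousOn.continuousAt (hU.mem_nhds hpU)
      have h2 : ContinuousAt D.metric p := hD.pair.smooth_metric.continuous.continuousAt
      have h3 : ContinuousAt (fun q => star (s q) ⬝ᵥ (D.metric q *ᵥ s q)) p := by
        have : Continuous fun x : Mat2 × (Fin 2 → ℂ) => star x.2 ⬝ᵥ (x.1 *ᵥ x.2) := by fun_prop
        exact ContinuousAt.comp (f := fun q => (D.metric q, s q)) this.continuousAt (h2.prodMk h1)
      exact Complex.continuous_re.continuousAt.comp h3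
    have hne : (herm (D.metric p) (s p) (s p)).re ≠ 0 := by
      obtain ⟨a, ha, h⟩ := exists_smul_rep (hsL p hpU).2 (hsL p hpU).1
      rw [h, herm_smul, Complex.re_ofReal_mul]
      exact mul_ne_zero (by simpa using ha) (hre p)
    have hsign (q : M) (hq : q ∈ U) := signOn_eq (D := D) (hsL q hq).2 (hsL q hq).1
    rcases hne.lt_or_gt with h | h
    · filter_upwards [hU.mem_nhds hpU, hc.eventually (gt_mem_nhds h)] with q hq hq'
      rw [hsign q hq, hsign p hpU, Real.sign_of_neg hq', Real.sign_of_neg h]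
    · filter_upwards [hU.mem_nhds hpU, hc.eventually (lt_mem_nhds h)] with q hq hq'
      rw [hsign q hq, hsign p hpU, Real.sign_of_pos hq', Real.sign_of_pos h]
  obtain ⟨p₀⟩ := (inferInstance : Nonempty M)
  have hconst (p : M) : D.signOn L p = D.signOn L p₀ :=
    hloc.apply_eq_of_preconnectedSpace p p₀
  refine ⟨-D.signOn L p₀, ?_, fun p => by rw [hconst p, neg_neg]⟩
  rcases (hre p₀).lt_or_gt with h | h
  · exact .inl (by rw [signOn, Real.sign_of_neg h, neg_neg])
  · exact .inr (by rw [signOn, Real.sign_of_pos h])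

variable [IsManifold 𝓘(ℂ) ω M]

lemma diff_proj (p : M) (v : TangentSpace 𝓘(ℝ, ℂ) p) :
    diff (D.proj L) p v * D.proj L p + D.proj L p * diff (D.proj L) p v =
      diff (D.proj L) p v := by
  have h := diff_mul hD.smooth_proj hD.smooth_proj p v
  rw [funext hD.proj_mul_self] at h
  exact h.symm

lemma diff_proj_adjoint (p : M) (v : TangentSpace 𝓘(ℝ, ℂ) p) :
    (diff (D.proj L) p v)ᴴ * D.metric p + (D.proj L p)ᴴ * diff D.metric p v =
      diff D.metric p v * D.proj L p + D.metric p * diff (D.proj L) p v := by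
  have h := diff_mul (smoothMap_conjTranspose hD.smooth_proj) hD.pair.smooth_metric p v
  rw [funext hD.conjTranspose_proj, diff_mul hD.pair.smooth_metric hD.smooth_proj,
    diff_conjTranspose hD.smooth_proj] at h
  exact h.symm

lemma sff'_apply (p : M) (v : TangentSpace 𝓘(ℝ, ℂ) p) :
    D.offBlock (D.coproj L) (D.proj L) p v = D.proj L p * -diff (D.proj L) p v +
      D.proj L p * D.conn p v * (1 - D.proj L p) := by
  rw [offBlock_apply]
  have h := diff_const_sub hD.smooth_proj 1 p v
  exact congrArg (fun X => D.proj L p * X + D.proj L p * D.conn p v * (1 - D.proj L p)) h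

lemma mapsOut_sff (p : M) (v : TangentSpace 𝓘(ℝ, ℂ) p) :
    MapsOut (D.proj L p) (D.offBlock (D.proj L) (D.coproj L) p v) :=
  mapsOut_offBlock (hD.proj_mul_self p) (hD.diff_proj p v)

lemma mapsIn_sff' (p : M) (v : TangentSpace 𝓘(ℝ, ℂ) p) :
    MapsIn (D.proj L p) (D.offBlock (D.coproj L) (D.proj L) p v) := by
  rw [hD.sff'_apply]
  exact mapsIn_offBlock (hD.proj_mul_self p) (hD.diff_proj p v)

lemma diff_proj_eq (p : M) (v : TangentSpace 𝓘(ℝ, ℂ) p) :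
    diff (D.proj L) p v = D.proj L p * D.conn p v - D.conn p v * D.proj L p +
      D.offBlock (D.proj L) (D.coproj L) p v - D.offBlock (D.coproj L) (D.proj L) p v :=
  deriv_proj_eq (sff_apply p v) (hD.sff'_apply p v)

lemma conjTranspose_sff (p : M) (v : TangentSpace 𝓘(ℝ, ℂ) p) :
    (D.offBlock (D.proj L) (D.coproj L) p v)ᴴ * D.metric p =
      -(D.metric p * D.offBlock (D.coproj L) (D.proj L) p v) :=
  conjTranspose_offBlock (hD.proj_mul_self p) (hD.conjTranspose_proj p) (hD.diff_proj p v)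
    (hD.diff_proj_adjoint p v) (hD.pair.unitary p v) (sff_apply p v) (hD.sff'_apply p v)

lemma conjTranspose_sff' (p : M) (v : TangentSpace 𝓘(ℝ, ℂ) p) :
    (D.offBlock (D.coproj L) (D.proj L) p v)ᴴ * D.metric p =
      -(D.metric p * D.offBlock (D.proj L) (D.coproj L) p v) := by
  have h := hD.conjTranspose_sff p v
  rw [← mul_neg] at h
  have h' := conjTranspose_mul_comm (hD.pair.hermitian p) h
  rw [Matrix.conjTranspose_neg, neg_mul] at h'
  rw [← h', neg_neg]

end IsFlippable
end Data

lemma fderiv_mulVec_apply {E : Type*} [NormedAddCommGroup E] [NormedSpace ℝ E] {f : E → Mat2}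
    {s : E → Fin 2 → ℂ} {x : E} (hf : DifferentiableAt ℝ f x) (hs : DifferentiableAt ℝ s x)
    (v : E) : fderiv ℝ (fun y => f y *ᵥ s y) x v =
      fderiv ℝ f x v *ᵥ s x + f x *ᵥ fderiv ℝ s x v := by
  have h := (Matrix.mulVecBilin ℝ ℝ : Mat2 →ₗ[ℝ] _).toContinuousBilinearMap.hasFDerivAt_of_bilinear
    hf.hasFDerivAt hs.hasFDerivAt
  have h' : fderiv ℝ (fun y => f y *ᵥ s y) x = _ := h.fderiv
  rw [h', add_comm]
  rfl

namespace Data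
namespace IsFlippable

variable {M : Type*} [TopologicalSpace M] [ChartedSpace ℂ M] [IsManifold 𝓘(ℂ) ω M]
variable {D : Data M} {om : OneForm M ℂ} {L : M → ℙ ℂ (Fin 2 → ℂ)} (hD : D.IsFlippable om L)
variable {e : OpenPartialHomeomorph M ℂ} {z : ℂ}
include hD

/-- As the line is holomorphic, its second fundamental form has type `(1,0)`. -/
lemma sff_I_mul (he : e ∈ holCharts M) (hz : z ∈ e.target) (v : ℂ) :
    (D.offBlock (D.proj L) (D.coproj L)).inChart e z (Complex.I * v) =
      Complex.I • (D.offBlock (D.proj L) (D.coproj L)).inChart e z v := by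
  obtain ⟨U, hU, hpU, s, hs, hsL, hhol⟩ := hD.eigenline.1 (e.symm z)
  set P := D.proj L (e.symm z) with hPdef
  have hs0 := hsL _ hpU
  have hW : e.target ∩ e.symm ⁻¹' U ∈ nhds z :=
    (e.isOpen_inter_preimage_symm hU).mem_nhds ⟨hz, hpU⟩
  have hPs : P *ᵥ s (e.symm z) = s (e.symm z) := hD.proj_mulVec_of_mem hs0.2
  have hdP := hD.smooth_proj.differentiableAt_comp_symm he hz
  have hds : DifferentiableAt ℝ (s ∘ e.symm) z :=
    ((contDiffOn_comp_symm hs he).contDiffAt hW).differentiableAt (by simp)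
  have hmds : MDifferentiableAt 𝓘(ℝ, ℂ) 𝓘(ℝ, Fin 2 → ℂ) s (e.symm z) :=
    (hs.contMDiffAt (hU.mem_nhds hpU)).mdifferentiableAt (by simp)
  -- on the line, the second fundamental form is the component of `∇ s` orthogonal to the line
  have key (u : ℂ) : (D.offBlock (D.proj L) (D.coproj L)).inChart e z u *ᵥ s (e.symm z) =
      (1 - P) *ᵥ ((diff s).inChart e z u + D.conn.inChart e z u *ᵥ s (e.symm z)) := by
    have h₁ : (D.offBlock (D.proj L) (D.coproj L)).inChart e z u =
        (1 - P) * (diff (D.proj L)).inChart e z u + (1 - P) * D.conn.inChart e z u * P := rfl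
    have h₂ : fderiv ℝ (fun w => (D.proj L ∘ e.symm) w *ᵥ (s ∘ e.symm) w) z =
        fderiv ℝ (s ∘ e.symm) z := by
      refine Filter.EventuallyEq.fderiv_eq ?_
      filter_upwards [hW] with w hw
      exact hD.proj_mulVec_of_mem (hsL _ hw.2).2
    have h₃ : (diff s).inChart e z u =
        (diff (D.proj L)).inChart e z u *ᵥ s (e.symm z) + P *ᵥ (diff s).inChart e z u := by
      have h := diff_inChart_of_mdifferentiableAt he hz hmds u
      refine h.trans (Eq.trans ?_ (congrArg₂ (fun X Y => X *ᵥ s (e.symm z) + P *ᵥ Y)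
        (hD.smooth_proj.diff_inChart he hz u) h).symm)
      exact (DFunLike.congr_fun h₂ u).symm.trans (fderiv_mulVec_apply hdP hds u)
    have h₄ : (1 - P) *ᵥ (P *ᵥ (diff s).inChart e z u) = 0 := by
      rw [Matrix.mulVec_mulVec, sub_mul, one_mul, hD.proj_mul_self, sub_self, Matrix.zero_mulVec]
    have h₅ : (1 - P) *ᵥ (diff s).inChart e z u =
        (1 - P) *ᵥ ((diff (D.proj L)).inChart e z u *ᵥ s (e.symm z)) := by
      conv_lhs => rw [h₃, Matrix.mulVec_add, h₄, add_zero]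
    rw [h₁, Matrix.add_mulVec, ← Matrix.mulVec_mulVec, ← Matrix.mulVec_mulVec, hPs,
      ← Matrix.mulVec_mulVec, Matrix.mulVec_add, h₅]
  have hR {w : Fin 2 → ℂ} (hw : w ∈ (L (e.symm z)).submodule) : (1 - P) *ᵥ w = 0 := by
    rw [Matrix.sub_mulVec, Matrix.one_mulVec, hD.proj_mulVec_of_mem hw, sub_self]
  have h := hR (hhol e he z hz hpU v)
  rw [Matrix.mulVec_add, Matrix.mulVec_smul, ← key, ← key] at h
  have hm (u : ℂ) : (D.offBlock (D.proj L) (D.coproj L)).inChart e z u * P =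
    (D.offBlock (D.proj L) (D.coproj L)).inChart e z u := (hD.mapsOut_sff _ _).right
  set α₁ := (D.offBlock (D.proj L) (D.coproj L)).inChart e z v
  set α₂ := (D.offBlock (D.proj L) (D.coproj L)).inChart e z (Complex.I * v)
  have h0 : (α₂ - Complex.I • α₁) *ᵥ s (e.symm z) = 0 := by
    have h1 : (α₂ - Complex.I • α₁) *ᵥ s (e.symm z) =
        -Complex.I • (α₁ *ᵥ s (e.symm z) + Complex.I • α₂ *ᵥ s (e.symm z)) := by
      rw [Matrix.sub_mulVec, Matrix.smul_mulVec, smul_add, smul_smul]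
      simp only [neg_mul, Complex.I_mul_I, neg_neg, one_smul, neg_smul]
      abel
    rw [h1, h, smul_zero]
  have hX : (α₂ - Complex.I • α₁) * P = α₂ - Complex.I • α₁ := by
    rw [sub_mul, smul_mul_assoc, hm, hm]
  refine sub_eq_zero.mp ?_
  rw [← hX]
  refine Matrix.ext_of_mulVec_single fun i => ?_
  rw [← Matrix.mulVec_mulVec, hPdef, proj_eq_lineProj hs0.2 hs0.1, lineProj_mulVec,
    Matrix.mulVec_smul, h0, smul_zero, Matrix.zero_mulVec]

/-- The other second fundamental form is a negative adjoint of the first and has type `(0,1)`. -/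
lemma sff'_I_mul (he : e ∈ holCharts M) (hz : z ∈ e.target) (v : ℂ) :
    (D.offBlock (D.coproj L) (D.proj L)).inChart e z (Complex.I * v) =
      -Complex.I • (D.offBlock (D.coproj L) (D.proj L)).inChart e z v := by
  have h (u : ℂ) : ((D.offBlock (D.proj L) (D.coproj L)).inChart e z u)ᴴ * D.metric (e.symm z) =
      -(D.metric (e.symm z) * (D.offBlock (D.coproj L) (D.proj L)).inChart e z u) :=
    hD.conjTranspose_sff _ _
  have h₁ := h (Complex.I * v)
  rw [hD.sff_I_mul he hz, Matrix.conjTranspose_smul, smul_mul_assoc, h v] at h₁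
  have h₂ : D.metric (e.symm z) *
      (D.offBlock (D.coproj L) (D.proj L)).inChart e z (Complex.I * v) = D.metric (e.symm z) *
      (-Complex.I • (D.offBlock (D.coproj L) (D.proj L)).inChart e z v) := by
    rw [mul_smul_comm, ← neg_inj, ← h₁]
    simp
  have h₃ := congrArg ((D.metric (e.symm z))⁻¹ * ·) h₂
  simpa only [Matrix.nonsing_inv_mul_cancel_left _ _ (hD.pair.isUnit_det _)] using h₃

omit [IsManifold 𝓘(ℂ) ω M] in
lemma higgs_mul_proj (p : M) (v : TangentSpace 𝓘(ℝ, ℂ) p) :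
    D.higgs p v * D.proj L p = -om p v • D.proj L p := by
  refine Matrix.ext_of_mulVec_single fun i => ?_
  rw [← Matrix.mulVec_mulVec, hD.eigenline.2 p _ (proj_mulVec_mem p _), Matrix.smul_mulVec]
  rfl

omit [IsManifold 𝓘(ℂ) ω M] in
lemma coproj_higgs_coproj (p : M) (v : TangentSpace 𝓘(ℝ, ℂ) p) :
    (1 - D.proj L p) * D.higgs p v * (1 - D.proj L p) = om p v • (1 - D.proj L p) := by
  rw [compress_ker (hD.proj_mul_self p) (hD.trace_proj p), sub_mul, one_mul, Matrix.trace_sub,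
    hD.sol.trace_higgs, Matrix.trace_mul_comm, hD.higgs_mul_proj, Matrix.trace_smul,
    hD.trace_proj]
  simp

omit [IsManifold 𝓘(ℂ) ω M] in
/-- The Higgs field in blocks: `(om, 0; -γ*, -om)`. -/
lemma higgs_split (p : M) (v : TangentSpace 𝓘(ℝ, ℂ) p) :
    D.higgs p v = om p v • (1 - 2 • D.proj L p) +
      D.proj L p * D.higgs p v * (1 - D.proj L p) :=
  higgs_eq (hD.higgs_mul_proj p v) (hD.coproj_higgs_coproj p v)

omit [IsManifold 𝓘(ℂ) ω M] in
lemma higgsAdj_split (p : M) (v : TangentSpace 𝓘(ℝ, ℂ) p) :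
    D.higgsAdj p v = star (om p v) • (1 - 2 • D.proj L p) +
      (1 - D.proj L p) * D.higgsAdj p v * D.proj L p :=
  higgsAdj_eq (hD.pair.isUnit_det p) (hD.conjTranspose_proj p) (hD.pair.conjTranspose_higgs p v)
    (hD.higgs_split p v)

end IsFlippable

/-! ### The flipped data -/

variable {M : Type*} [TopologicalSpace M] [ChartedSpace ℂ M]
variable {D : Data M} {om : OneForm M ℂ} {L : M → ℙ ℂ (Fin 2 → ℂ)}

lemma reverseFlip_conn (p : M) (v : TangentSpace 𝓘(ℝ, ℂ) p) :
    (D.reverseFlip om L).conn p v =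
      D.conn p v - D.offBlock (D.proj L) (D.coproj L) p v - D.offBlock (D.coproj L) (D.proj L) p v
      + (1 - D.proj L p) * D.higgsAdj p v * D.proj L p
      + D.proj L p * D.higgs p v * (1 - D.proj L p) := rfl

lemma reverseFlip_higgs (p : M) (v : TangentSpace 𝓘(ℝ, ℂ) p) :
    (D.reverseFlip om L).higgs p v =
      om p v • (1 - 2 • D.proj L p) + D.offBlock (D.proj L) (D.coproj L) p v := by
  have h : (1 : Mat2) - 2 • D.proj L p = (1 - D.proj L p) - D.proj L p := by rw [two_smul]; abel
  rw [h]
  rfl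

lemma reverseFlip_metric (p : M) :
    (D.reverseFlip om L).metric p =
      D.signOn L p • (D.metric p * (D.proj L p - (1 - D.proj L p))) := rfl

namespace IsFlippable

variable [IsManifold 𝓘(ℂ) ω M] [ConnectedSpace M] (hD : D.IsFlippable om L)
variable {e : OpenPartialHomeomorph M ℂ} {z : ℂ}
include hD

omit [IsManifold 𝓘(ℂ) ω M] [ConnectedSpace M] in
lemma det_metric_flip (p : M) {σ : ℝ} (hσ : σ = 1 ∨ σ = -1) :
    (σ • (D.metric p * (D.proj L p - (1 - D.proj L p)))).det = 1 := by
  have h : (D.metric p * (D.proj L p - (1 - D.proj L p))).det = 1 := by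
    rw [Matrix.det_mul, det_flip (hD.proj_mul_self p) (hD.trace_proj p), hD.pair.det_metric]
    norm_num
  rcases hσ with rfl | rfl
  · rw [one_smul, h]
  · rw [neg_one_smul, Matrix.det_neg, h]
    simp

/-- The flipped connection is unitary for the flipped metric, and the flipped Higgs field is of type
`(1,0)`. -/
lemma pair_flip : (D.reverseFlip om L).IsUnitaryPair 1 := by
  obtain ⟨ε, hε, hσ⟩ := hD.signOn_const
  have hmetric : (D.reverseFlip om L).metric =
      fun p => (-ε) • (D.metric p * (D.proj L p - (1 - D.proj L p))) := by
    funext p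
    rw [reverseFlip_metric, hσ]
  have hcop : SmoothMap (D.coproj L) := hD.smooth_proj.const_sub 1
  have hdif : SmoothMap (fun p => D.proj L p - (1 - D.proj L p)) :=
    ContMDiff.sub hD.smooth_proj hcop
  have hsff : SmoothForm (D.offBlock (D.proj L) (D.coproj L)) :=
    (hD.smooth_proj.smoothForm_diff.mulLeft hcop).add
      (hD.pair.smooth_conn.mulLeftRight hcop hD.smooth_proj)
  have hsff' : SmoothForm (D.offBlock (D.coproj L) (D.proj L)) :=
    (hcop.smoothForm_diff.mulLeft hD.smooth_proj).add
      (hD.pair.smooth_conn.mulLeftRight hD.smooth_proj hcop)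
  refine ⟨?_, ?_, ?_, ?_, ?_, ?_, ?_, one_ne_zero⟩
  · exact ((((hD.pair.smooth_conn.sub hsff).sub hsff').add
      (hD.pair.smoothForm_higgsAdj.mulLeftRight hcop hD.smooth_proj)).add
      (hD.pair.smooth_higgs.mulLeftRight hD.smooth_proj hcop))
  · exact (hD.smooth_om.smulRight (ContMDiff.sub hcop hD.smooth_proj)).add hsff
  · rw [hmetric]
    exact (smoothMap_mul hD.pair.smooth_metric hdif).const_smul (-ε)
  · intro p
    rw [reverseFlip_metric, Matrix.IsHermitian, Matrix.conjTranspose_smul,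
      Matrix.conjTranspose_mul, (hD.pair.hermitian p).eq]
    simp [sub_mul, mul_sub, hD.conjTranspose_proj]
  · intro p v
    have h₁ : diff (D.reverseFlip om L).metric p v = (-ε) •
        (diff D.metric p v * (D.proj L p - (1 - D.proj L p)) +
          D.metric p * (diff (D.proj L) p v + diff (D.proj L) p v)) := by
      have h₂ := diff_sub hD.smooth_proj hcop p v
      rw [hmetric, diff_const_smul (smoothMap_mul hD.pair.smooth_metric hdif),
        diff_mul hD.pair.smooth_metric hdif]
      erw [h₂, diff_const_sub hD.smooth_proj 1 p v]
      rw [sub_neg_eq_add]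
    rw [h₁, reverseFlip_metric, hσ, reverseFlip_conn]
    exact unitary_flip (-ε) (hD.pair.unitary p v) (hD.diff_proj_eq p v) (hD.mapsOut_sff p v)
      (hD.mapsIn_sff' p v) (mapsOut_block (hD.proj_mul_self p) _)
      (mapsIn_block (hD.proj_mul_self p) _) (hD.conjTranspose_sff p v) (hD.conjTranspose_sff' p v)
      (conjTranspose_mul_comm (hD.pair.hermitian p)
        (conjTranspose_block (hD.conjTranspose_proj p) (hD.pair.conjTranspose_higgs p v)))
      (conjTranspose_block (hD.conjTranspose_proj p) (hD.pair.conjTranspose_higgs p v))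
  · intro e he z hz v
    have h (u : ℂ) : (D.reverseFlip om L).higgs.inChart e z u =
      om.inChart e z u • (1 - 2 • D.proj L (e.symm z)) +
        (D.offBlock (D.proj L) (D.coproj L)).inChart e z u := reverseFlip_higgs _ _
    rw [h, h, hD.type_om e he z hz, hD.sff_I_mul he hz, smul_add, smul_smul, smul_eq_mul]
  · intro p
    rw [reverseFlip_metric, hσ]
    exact hD.det_metric_flip p (by rcases hε with rfl | rfl <;> simp)

end IsFlippable
end Data

/-! ### Self-duality of the flipped data -/

section

variable {M : Type*} [TopologicalSpace M] [ChartedSpace ℂ M]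
variable {V : Type*} [NormedAddCommGroup V] [NormedSpace ℝ V]

/-- `d(df) = 0`. -/
lemma dCoeff_diff {f : M → V} (hf : SmoothMap f) {e : OpenPartialHomeomorph M ℂ} {z : ℂ}
    (he : e ∈ holCharts M) (hz : z ∈ e.target) : dCoeff (diff f) e z = 0 := by
  have hc : ContDiffAt ℝ ∞ (f ∘ e.symm) z :=
    (hf.contDiffOn_comp_symm he).contDiffAt (e.open_target.mem_nhds hz)
  have hc₂ : ContDiffAt ℝ 2 (f ∘ e.symm) z := by exact_mod_cast contDiffAt_infty.mp hc 2
  have hd : DifferentiableAt ℝ (fderiv ℝ (f ∘ e.symm)) z :=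
    (hc₂.fderiv_right (m := 1) (by norm_num)).differentiableAt (by simp)
  have h (u v : ℂ) : fderiv ℝ (fun w => (diff f).inChart e w u) z v =
      fderiv ℝ (fderiv ℝ (f ∘ e.symm)) z v u := by
    have h₁ : (fun w => (diff f).inChart e w u) =ᶠ[nhds z] fun w => fderiv ℝ (f ∘ e.symm) w u := by
      filter_upwards [e.open_target.mem_nhds hz] with w hw using hf.diff_inChart he hw u
    rw [h₁.fderiv_eq, fderiv_clm_apply hd (differentiableAt_const u)]
    simp
  rw [dCoeff, h, h, sub_eq_zero]
  exact (hc₂.isSymmSndFDerivAt (by simp)) 1 Complex.I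

/-- The definition of `dCoeff` for matrix-valued forms, in terms of the standard topology and
module structure of the space of matrices. -/
lemma dCoeff_mat (α : OneForm M Mat2) (e : OpenPartialHomeomorph M ℂ) (z : ℂ) :
    dCoeff α e z = fderiv ℝ (fun w => α.inChart e w Complex.I) z 1 -
      fderiv ℝ (fun w => α.inChart e w 1) z Complex.I := rfl

end

namespace Data
namespace IsFlippable

variable {M : Type*} [TopologicalSpace M] [ChartedSpace ℂ M]
variable {D : Data M} {om : OneForm M ℂ} {L : M → ℙ ℂ (Fin 2 → ℂ)}
variable [IsManifold 𝓘(ℂ) ω M] [ConnectedSpace M] (hD : D.IsFlippable om L)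
variable {e : OpenPartialHomeomorph M ℂ} {z : ℂ}
include hD

lemma higgsAdj_flip (p : M) (v : TangentSpace 𝓘(ℝ, ℂ) p) :
    (D.reverseFlip om L).higgsAdj p v =
      star (om p v) • (1 - 2 • D.proj L p) + D.offBlock (D.coproj L) (D.proj L) p v := by
  apply hD.pair_flip.higgsAdj_eq_of_conjTranspose
  rw [reverseFlip_higgs, reverseFlip_metric]
  exact conjTranspose_flip _ (hD.conjTranspose_proj p) (hD.mapsIn_sff' p v)
    (hD.conjTranspose_sff p v)

/-- The two solutions have the same associated flat connection. -/
lemma totalForm_flip : (D.reverseFlip om L).totalForm = D.totalForm := by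
  funext p
  ext1 v
  change (D.reverseFlip om L).conn p v + (D.reverseFlip om L).higgs p v +
    (D.reverseFlip om L).higgsAdj p v = D.conn p v + D.higgs p v + D.higgsAdj p v
  rw [reverseFlip_conn, reverseFlip_higgs, hD.higgsAdj_flip]
  conv_rhs => rw [hD.higgs_split p v, hD.higgsAdj_split p v]
  abel

omit [ConnectedSpace M] in
lemma fderiv_proj (he : e ∈ holCharts M) (hz : z ∈ e.target) (v : ℂ) :
    fderiv ℝ (D.proj L ∘ e.symm) z v = (diff (D.proj L)).inChart e z v :=
  (hD.smooth_proj.diff_inChart he hz v).symm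

omit [ConnectedSpace M] in
lemma fderiv_coproj (he : e ∈ holCharts M) (hz : z ∈ e.target) (v : ℂ) :
    fderiv ℝ (fun w => 1 - D.proj L (e.symm w)) z v = -(diff (D.proj L)).inChart e z v := by
  rw [← hD.fderiv_proj he hz]
  have h := fderiv_const_sub (𝕜 := ℝ) (f := D.proj L ∘ e.symm) (x := z) (1 : Mat2)
  exact DFunLike.congr_fun h v

omit [ConnectedSpace M] in
lemma differentiableAt_coproj (he : e ∈ holCharts M) (hz : z ∈ e.target) :
    DifferentiableAt ℝ (fun w => 1 - D.proj L (e.symm w)) z :=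
  (hD.smooth_proj.const_sub 1).differentiableAt_comp_symm he hz

omit [IsManifold 𝓘(ℂ) ω M] [ConnectedSpace M] in
/-- The Higgs field acts on the quotient by `L` as multiplication by `om`. -/
lemma coproj_mul_higgs (p : M) (v : TangentSpace 𝓘(ℝ, ℂ) p) :
    (1 - D.proj L p) * D.higgs p v = om p v • (1 - D.proj L p) := by
  have h : (1 - D.proj L p) * D.higgs p v = (1 - D.proj L p) * D.higgs p v * (1 - D.proj L p) +
      (1 - D.proj L p) * (D.higgs p v * D.proj L p) := by noncomm_ring
  rw [h, hD.coproj_higgs_coproj, hD.higgs_mul_proj, mul_smul_comm, sub_mul, one_mul,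
    hD.proj_mul_self, sub_self, smul_zero, add_zero]

omit [ConnectedSpace M] in
/-- The derivative of the identity `R Φ = om R`, with `R` the projection onto `L^†`. -/
lemma fderiv_coproj_mul_higgs (he : e ∈ holCharts M) (hz : z ∈ e.target) (u v : ℂ) :
    -(diff (D.proj L)).inChart e z v * D.higgs.inChart e z u +
      (1 - D.proj L (e.symm z)) * fderiv ℝ (fun w => D.higgs.inChart e w u) z v =
    fderiv ℝ (fun w => om.inChart e w u) z v • (1 - D.proj L (e.symm z)) -
      om.inChart e z u • (diff (D.proj L)).inChart e z v := by
  have hR := hD.differentiableAt_coproj he hz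
  have h₁ := fderiv_mul_apply hR (hD.pair.smooth_higgs.differentiableAt he hz u) v
  have h₂ := fderiv_smul_apply (hD.smooth_om.differentiableAt he hz u) hR v
  have h₃ : (fun w => (1 - D.proj L (e.symm w)) * D.higgs.inChart e w u) =
      fun w => om.inChart e w u • (1 - D.proj L (e.symm w)) :=
    funext fun w => hD.coproj_mul_higgs _ _
  rw [h₃, h₂] at h₁
  rw [hD.fderiv_coproj he hz] at h₁
  rw [← h₁, smul_neg, ← sub_eq_add_neg]

omit [IsManifold 𝓘(ℂ) ω M] [ConnectedSpace M] in
lemma inChart_I (he : e ∈ holCharts M) (hz : z ∈ e.target) :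
    om.inChart e z Complex.I = Complex.I * om.inChart e z 1 := by
  simpa using hD.type_om e he z hz 1

omit [ConnectedSpace M] in
lemma diff_proj_one (e : OpenPartialHomeomorph M ℂ) (z : ℂ) :
    (diff (D.proj L)).inChart e z 1 = D.proj L (e.symm z) * D.conn.inChart e z 1 -
      D.conn.inChart e z 1 * D.proj L (e.symm z) +
      (D.offBlock (D.proj L) (D.coproj L)).inChart e z 1 -
      (D.offBlock (D.coproj L) (D.proj L)).inChart e z 1 := hD.diff_proj_eq _ _

omit [ConnectedSpace M] in
lemma diff_proj_I (he : e ∈ holCharts M) (hz : z ∈ e.target) :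
    (diff (D.proj L)).inChart e z Complex.I = D.proj L (e.symm z) * D.conn.inChart e z Complex.I -
      D.conn.inChart e z Complex.I * D.proj L (e.symm z) +
      Complex.I • (D.offBlock (D.proj L) (D.coproj L)).inChart e z 1 +
      Complex.I • (D.offBlock (D.coproj L) (D.proj L)).inChart e z 1 := by
  have hα := hD.sff_I_mul he hz 1
  have hβ := hD.sff'_I_mul he hz 1
  rw [mul_one] at hα hβ
  have h : (diff (D.proj L)).inChart e z Complex.I =
      D.proj L (e.symm z) * D.conn.inChart e z Complex.I -
      D.conn.inChart e z Complex.I * D.proj L (e.symm z) +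
      (D.offBlock (D.proj L) (D.coproj L)).inChart e z Complex.I -
      (D.offBlock (D.coproj L) (D.proj L)).inChart e z Complex.I := hD.diff_proj_eq _ _
  rw [h, hα, hβ, neg_smul, sub_neg_eq_add]

omit [ConnectedSpace M] in
/-- The eigenvalue form is closed. -/
lemma dCoeff_om (he : e ∈ holCharts M) (hz : z ∈ e.target) : dCoeff om e z = 0 := by
  have hφ := hD.pair.type_higgs e he z hz 1
  rw [mul_one] at hφ
  have h₁ := hD.fderiv_coproj_mul_higgs he hz Complex.I 1
  have h₂ := hD.fderiv_coproj_mul_higgs he hz 1 Complex.I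
  have hφ₁ : D.higgs.inChart e z 1 = om.inChart e z 1 • (1 - 2 • D.proj L (e.symm z)) +
    D.proj L (e.symm z) * D.higgs.inChart e z 1 * (1 - D.proj L (e.symm z)) := hD.higgs_split _ _
  rw [hD.inChart_I he hz] at h₁
  exact sub_eq_zero.mpr (closed_eigenvalue (om.inChart e z 1) Complex.I _ _
    (hD.proj_mul_self (e.symm z)) (hD.trace_proj (e.symm z)) (hD.mapsOut_sff _ _)
    (hD.mapsIn_sff' _ _) (mapsIn_block (hD.proj_mul_self _) _) (hD.diff_proj_one e z)
    (hD.diff_proj_I he hz) hφ₁ (hφ.trans (congrArg _ hφ₁)) h₁ h₂ (hD.sol.dbar_higgs e he z hz))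

omit [ConnectedSpace M] in
/-- The product rule for the new Higgs field `om (R - P) + R dP + R A P`. -/
lemma fderiv_flip_higgs (he : e ∈ holCharts M) (hz : z ∈ e.target) (u v : ℂ) :
    fderiv ℝ (fun w => (D.reverseFlip om L).higgs.inChart e w u) z v =
      fderiv ℝ (fun w => om.inChart e w u) z v • (1 - 2 • D.proj L (e.symm z)) -
        (2 * om.inChart e z u) • (diff (D.proj L)).inChart e z v -
        (diff (D.proj L)).inChart e z v * (diff (D.proj L)).inChart e z u +
        (1 - D.proj L (e.symm z)) * fderiv ℝ (fun w => (diff (D.proj L)).inChart e w u) z v -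
        (diff (D.proj L)).inChart e z v * D.conn.inChart e z u * D.proj L (e.symm z) +
        (1 - D.proj L (e.symm z)) * fderiv ℝ (fun w => D.conn.inChart e w u) z v *
          D.proj L (e.symm z) +
        (1 - D.proj L (e.symm z)) * D.conn.inChart e z u * (diff (D.proj L)).inChart e z v := by
  have hR := hD.differentiableAt_coproj he hz
  have hP := hD.smooth_proj.differentiableAt_comp_symm he hz
  have hB := hD.smooth_proj.smoothForm_diff.differentiableAt he hz u
  have hA := hD.pair.smooth_conn.differentiableAt he hz u
  have hw := hD.smooth_om.differentiableAt he hz u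
  have hRP : DifferentiableAt ℝ
      (fun w => (1 - D.proj L (e.symm w)) - D.proj L (e.symm w)) z := hR.sub hP
  have e₀ : (fun w => (D.reverseFlip om L).higgs.inChart e w u) = fun w =>
      om.inChart e w u • ((1 - D.proj L (e.symm w)) - D.proj L (e.symm w)) +
        ((1 - D.proj L (e.symm w)) * (diff (D.proj L)).inChart e w u +
          (1 - D.proj L (e.symm w)) * D.conn.inChart e w u * D.proj L (e.symm w)) := rfl
  have hRA := differentiableAt_mul hR hA
  have e₁ : fderiv ℝ (fun w => (1 - D.proj L (e.symm w)) - D.proj L (e.symm w)) z v =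
      fderiv ℝ (fun w => 1 - D.proj L (e.symm w)) z v - fderiv ℝ (D.proj L ∘ e.symm) z v :=
    DFunLike.congr_fun (fderiv_fun_sub hR hP) v
  have e₂ : fderiv ℝ (fun w => (1 - D.proj L (e.symm w)) * D.conn.inChart e w u *
      D.proj L (e.symm w)) z v = _ := fderiv_mul_apply hRA hP v
  have hS : DifferentiableAt ℝ (fun w =>
      om.inChart e w u • ((1 - D.proj L (e.symm w)) - D.proj L (e.symm w))) z := hw.smul hRP
  have hRB := differentiableAt_mul hR hB
  have hRAP : DifferentiableAt ℝ (fun w =>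
      (1 - D.proj L (e.symm w)) * D.conn.inChart e w u * D.proj L (e.symm w)) z :=
    differentiableAt_mul hRA hP
  have hT : DifferentiableAt ℝ (fun w => (1 - D.proj L (e.symm w)) *
      (diff (D.proj L)).inChart e w u +
      (1 - D.proj L (e.symm w)) * D.conn.inChart e w u * D.proj L (e.symm w)) z := hRB.add hRAP
  rw [e₀, fderiv_add_apply hS hT, fderiv_add_apply hRB hRAP,
    fderiv_smul_apply hw hRP, fderiv_mul_apply hR hB, e₂, fderiv_mul_apply hR hA, e₁,
    hD.fderiv_coproj he hz, hD.fderiv_proj he hz]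
  simp only [Function.comp_apply, add_mul, neg_mul]
  module

/-- `∂̄^∇ Φ = 0` for the flipped data. -/
lemma dbar_higgs_flip (he : e ∈ holCharts M) (hz : z ∈ e.target) :
    dCoeff (D.reverseFlip om L).higgs e z
      + wedgeCoeff (D.reverseFlip om L).conn (D.reverseFlip om L).higgs e z
      + wedgeCoeff (D.reverseFlip om L).higgs (D.reverseFlip om L).conn e z = 0 := by
  have hB : fderiv ℝ (fun w => (diff (D.proj L)).inChart e w Complex.I) z 1 =
      fderiv ℝ (fun w => (diff (D.proj L)).inChart e w 1) z Complex.I :=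
    sub_eq_zero.mp (dCoeff_diff hD.smooth_proj he hz)
  have hw : fderiv ℝ (fun w => om.inChart e w Complex.I) z 1 =
      fderiv ℝ (fun w => om.inChart e w 1) z Complex.I := sub_eq_zero.mp (hD.dCoeff_om he hz)
  have hα := hD.sff_I_mul he hz 1
  have hβ := hD.sff'_I_mul he hz 1
  have hφ := hD.pair.type_higgs e he z hz 1
  have hψ := hD.pair.higgsAdj_I_mul he hz 1
  rw [mul_one] at hα hβ hφ hψ
  have hφ₁ : D.higgs.inChart e z 1 = om.inChart e z 1 • (1 - 2 • D.proj L (e.symm z)) +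
    D.proj L (e.symm z) * D.higgs.inChart e z 1 * (1 - D.proj L (e.symm z)) := hD.higgs_split _ _
  have hψ₁ : D.higgsAdj.inChart e z 1 =
    star (om.inChart e z 1) • (1 - 2 • D.proj L (e.symm z)) +
    (1 - D.proj L (e.symm z)) * D.higgsAdj.inChart e z 1 * D.proj L (e.symm z) :=
    hD.higgsAdj_split (e.symm z) (mfderiv 𝓘(ℝ, ℂ) 𝓘(ℝ, ℂ) e.symm z (1 : ℂ))
  have hcurv := hD.sol.curvature e he z hz
  rw [wedgeCoeff, wedgeCoeff, wedgeCoeff, hφ, hψ, hφ₁, hψ₁] at hcurv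
  have hout : MapsOut (D.proj L (e.symm z))
    ((D.offBlock (D.proj L) (D.coproj L)).inChart e z 1) := hD.mapsOut_sff _ _
  have hin : MapsIn (D.proj L (e.symm z))
    ((D.offBlock (D.coproj L) (D.proj L)).inChart e z 1) := hD.mapsIn_sff' _ _
  have key := dbar_flip (om.inChart e z 1) (star (om.inChart e z 1)) Complex.I
    (hD.proj_mul_self (e.symm z)) hout hin
    (mapsOut_block (hD.proj_mul_self (e.symm z)) _) (mapsIn_block (hD.proj_mul_self (e.symm z)) _)
    (hD.diff_proj_one e z) (hD.diff_proj_I he hz) hcurv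
  have hA₁ : (D.reverseFlip om L).conn.inChart e z 1 = D.conn.inChart e z 1 -
      (D.offBlock (D.proj L) (D.coproj L)).inChart e z 1 -
      (D.offBlock (D.coproj L) (D.proj L)).inChart e z 1 +
      (1 - D.proj L (e.symm z)) * D.higgsAdj.inChart e z 1 * D.proj L (e.symm z) +
      D.proj L (e.symm z) * D.higgs.inChart e z 1 * (1 - D.proj L (e.symm z)) := rfl
  have hA₂ : (D.reverseFlip om L).conn.inChart e z Complex.I = D.conn.inChart e z Complex.I -
      Complex.I • (D.offBlock (D.proj L) (D.coproj L)).inChart e z 1 +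
      Complex.I • (D.offBlock (D.coproj L) (D.proj L)).inChart e z 1 -
      Complex.I • ((1 - D.proj L (e.symm z)) * D.higgsAdj.inChart e z 1 * D.proj L (e.symm z)) +
      Complex.I • (D.proj L (e.symm z) * D.higgs.inChart e z 1 * (1 - D.proj L (e.symm z))) := by
    have h : (D.reverseFlip om L).conn.inChart e z Complex.I = D.conn.inChart e z Complex.I -
      (D.offBlock (D.proj L) (D.coproj L)).inChart e z Complex.I -
      (D.offBlock (D.coproj L) (D.proj L)).inChart e z Complex.I +
      (1 - D.proj L (e.symm z)) * D.higgsAdj.inChart e z Complex.I * D.proj L (e.symm z) +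
      D.proj L (e.symm z) * D.higgs.inChart e z Complex.I * (1 - D.proj L (e.symm z)) := rfl
    rw [h, hα, hβ, hφ, hψ, mul_smul_comm, smul_mul_assoc, mul_smul_comm, smul_mul_assoc, neg_smul,
      neg_smul, sub_neg_eq_add, ← sub_eq_add_neg]
  have hΦ₁ : (D.reverseFlip om L).higgs.inChart e z 1 =
      om.inChart e z 1 • (1 - 2 • D.proj L (e.symm z)) +
      (D.offBlock (D.proj L) (D.coproj L)).inChart e z 1 := reverseFlip_higgs _ _
  have hΦ₂ := hD.pair_flip.type_higgs e he z hz 1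
  rw [mul_one] at hΦ₂
  rw [wedgeCoeff, wedgeCoeff, dCoeff_mat, hΦ₂, hΦ₁, hA₁, hA₂, hD.fderiv_flip_higgs he hz,
    hD.fderiv_flip_higgs he hz, hB, hw, hD.inChart_I he hz]
  refine Eq.trans ?_ key
  have hdA : (1 - D.proj L (e.symm z)) * dCoeff D.conn e z * D.proj L (e.symm z) =
      (1 - D.proj L (e.symm z)) * fderiv ℝ (fun w => D.conn.inChart e w Complex.I) z 1 *
        D.proj L (e.symm z) -
      (1 - D.proj L (e.symm z)) * fderiv ℝ (fun w => D.conn.inChart e w 1) z Complex.I *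
        D.proj L (e.symm z) := by rw [dCoeff_mat, mul_sub, sub_mul]
  congr 2
  rw [hdA]
  module

lemma selfDual_flip : (D.reverseFlip om L).SelfDual where
  smooth_conn := hD.pair_flip.smooth_conn
  smooth_higgs := hD.pair_flip.smooth_higgs
  smooth_metric := hD.pair_flip.smooth_metric
  hermitian := hD.pair_flip.hermitian
  unitary := hD.pair_flip.unitary
  type_higgs := hD.pair_flip.type_higgs
  trace_conn p v := by
    have hα := hD.mapsOut_sff p v
    have hβ := hD.mapsIn_sff' p v
    rw [reverseFlip_conn]
    simp only [Matrix.trace_add, Matrix.trace_sub, hα.trace_eq_zero, hβ.trace_eq_zero,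
      hD.sol.trace_conn, (mapsOut_block (hD.proj_mul_self p) _).trace_eq_zero,
      (mapsIn_block (hD.proj_mul_self p) _).trace_eq_zero]
    simp
  trace_higgs p v := by
    rw [reverseFlip_higgs, Matrix.trace_add, (hD.mapsOut_sff p v).trace_eq_zero,
      Matrix.trace_smul, Matrix.trace_sub, Matrix.trace_smul, hD.trace_proj]
    simp
  dbar_higgs e he z hz := hD.dbar_higgs_flip he hz
  -- both curvature equations say that the common connection `∇ + Φ + Φ*` is flat
  curvature e he z hz := by
    rw [← hD.pair_flip.curvature_totalForm he hz (hD.dbar_higgs_flip he hz), hD.totalForm_flip,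
      hD.pair.curvature_totalForm he hz (hD.sol.dbar_higgs e he z hz)]
    exact hD.sol.curvature e he z hz

/-- The flipped metric is definite: it has determinant one, and is positive on `L` by the choice of
the sign. -/
lemma isSU2Solution_flip : (D.reverseFlip om L).IsSU2Solution where
  __ := hD.selfDual_flip
  det_metric := hD.pair_flip.det_metric
  posDef p := by
    refine posDef_of_det_pos (s := (L p).rep) (hD.pair_flip.hermitian p)
      (hD.pair_flip.det_metric p) ?_
    have h₁ : ((D.proj L p) - (1 - D.proj L p)) *ᵥ (L p).rep = (L p).rep := by
      rw [Matrix.sub_mulVec, Matrix.sub_mulVec, hD.proj_mulVec_of_mem (rep_mem L p),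
        Matrix.one_mulVec, sub_self, sub_zero]
    have h₂ : herm ((D.reverseFlip om L).metric p) (L p).rep (L p).rep =
        (D.signOn L p : ℂ) * herm (D.metric p) (L p).rep (L p).rep := by
      rw [reverseFlip_metric, herm, Matrix.smul_mulVec, ← Matrix.mulVec_mulVec, h₁,
        dotProduct_smul, Complex.real_smul, herm]
    rw [h₂, Complex.re_ofReal_mul, signOn]
    have hne : (herm (D.metric p) (L p).rep (L p).rep).re ≠ 0 := by
      intro h
      apply hD.herm_rep_ne_zero p
      rw [← Complex.conj_eq_iff_re.mp (conj_herm (hD.pair.hermitian p) _), h, Complex.ofReal_zero]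
    exact Real.sign_mul_pos_of_ne_zero _ hne

end IsFlippable
end Data

/-! ### Holomorphic local homeomorphisms -/

/-- The inverse of an injective holomorphic function is holomorphic: it is continuous, and
differentiable away from the isolated critical points, which are therefore removable. -/
lemma differentiableOn_symm_of_differentiableOn (ψ : OpenPartialHomeomorph ℂ ℂ)
    (hψ : DifferentiableOn ℂ ψ ψ.source) : DifferentiableOn ℂ ψ.symm ψ.target := by
  intro w hw
  have hz : ψ.symm w ∈ ψ.source := ψ.map_target hw
  have han : AnalyticAt ℂ ψ (ψ.symm w) := hψ.analyticAt (ψ.open_source.mem_nhds hz)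
  have hpunct : ∀ᶠ z in nhdsWithin (ψ.symm w) {ψ.symm w}ᶜ, deriv ψ z ≠ 0 := by
    refine han.deriv.eventually_eq_zero_or_eventually_ne_zero.resolve_left fun h0 => ?_
    obtain ⟨r, hr, hball⟩ := Metric.eventually_nhds_iff_ball.mp
      (h0.and (ψ.open_source.mem_nhds hz))
    have hconst : ∀ z ∈ Metric.ball (ψ.symm w) r, ψ z = ψ (ψ.symm w) := fun z hzr =>
      Metric.isOpen_ball.is_const_of_deriv_eq_zero (convex_ball _ _).isPreconnected
        (hψ.mono fun y hy => (hball y hy).2) (fun y hy => (hball y hy).1) hzr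
        (Metric.mem_ball_self hr)
    have hmem : ψ.symm w + (r / 2 : ℝ) ∈ Metric.ball (ψ.symm w) r := by
      rw [mem_ball_iff_norm, add_sub_cancel_left, Complex.norm_real, Real.norm_eq_abs,
        abs_of_pos (half_pos hr)]
      exact half_lt_self hr
    have := ψ.injOn (hball _ hmem).2 hz (hconst _ hmem)
    rw [add_eq_left, Complex.ofReal_eq_zero] at this
    exact (half_pos hr).ne' this
  have hcont : ContinuousAt ψ.symm w := ψ.continuousAt_symm hw
  have htend : Filter.Tendsto ψ.symm (nhdsWithin w {w}ᶜ)
      (nhdsWithin (ψ.symm w) {ψ.symm w}ᶜ) := by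
    refine tendsto_nhdsWithin_iff.mpr ⟨hcont.mono_left nhdsWithin_le_nhds, ?_⟩
    filter_upwards [self_mem_nhdsWithin,
      nhdsWithin_le_nhds (ψ.open_target.mem_nhds hw)] with y hy hyt h
    exact hy (ψ.symm.injOn hyt hw h)
  refine (Complex.analyticAt_of_differentiable_on_punctured_nhds_of_continuousAt ?_
    hcont).differentiableAt.differentiableWithinAt
  filter_upwards [htend.eventually hpunct,
    nhdsWithin_le_nhds (ψ.open_target.mem_nhds hw)] with y hy hyt
  have hd : HasDerivAt ψ (deriv ψ (ψ.symm y)) (ψ.symm y) :=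
    ((hψ _ (ψ.map_target hyt)).differentiableAt
      (ψ.open_source.mem_nhds (ψ.map_target hyt))).hasDerivAt
  exact (ψ.hasDerivAt_symm hyt hy hd).differentiableAt

section LocalHomeomorph

variable {M : Type*} [TopologicalSpace M] [ChartedSpace ℂ M] [IsManifold 𝓘(ℂ) ω M]
variable {X : Type*} [TopologicalSpace X] [ChartedSpace ℂ X]

/-- A homeomorphism onto an open subset of `ℂ` with holomorphic inverse is a holomorphic
coordinate. -/
lemma mem_holCharts_of_contMDiffOn_symm (e : OpenPartialHomeomorph M ℂ)
    (he : ContMDiffOn 𝓘(ℂ) 𝓘(ℂ) ω e.symm e.target) : e ∈ holCharts M := by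
  refine e.mem_maximalAtlas_of_contMDiffOn (fun p hp => ?_) he
  set c := chartAt ℂ p with hc
  have hcM : c ∈ holCharts M := chartAt_mem_holCharts p
  have hpc : p ∈ c.source := mem_chart_source ℂ p
  -- the inverse of the coordinate change is holomorphic
  have h₁ : DifferentiableOn ℂ (e.symm.trans c) (e.symm.trans c).source := by
    have h : ContMDiffOn 𝓘(ℂ) 𝓘(ℂ) ω (e.symm.trans c) (e.symm.trans c).source := by
      refine (contMDiffOn_of_mem_maximalAtlas hcM).comp (he.mono ?_) ?_
      · exact fun z hz => hz.1
      · exact fun z hz => hz.2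
    exact (contMDiffOn_iff_contDiffOn.mp h).differentiableOn (by simp)
  have h₂ := differentiableOn_symm_of_differentiableOn _ h₁
  have hmem : c p ∈ (e.symm.trans c).target := by
    refine ⟨c.map_source hpc, ?_⟩
    change c.symm (c p) ∈ e.symm.target
    rw [c.left_inv hpc]
    exact hp
  have h₃ : ContMDiffAt 𝓘(ℂ) 𝓘(ℂ) ω (e.symm.trans c).symm (c p) :=
    ((h₂.analyticAt ((e.symm.trans c).open_target.mem_nhds hmem)).contDiffAt).contMDiffAt
  have h₄ := h₃.comp p (contMDiffAt_of_mem_maximalAtlas hcM hpc)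
  refine (h₄.congr_of_eventuallyEq ?_).contMDiffWithinAt
  filter_upwards [c.open_source.mem_nhds hpc] with q hq
  simp [c.left_inv hq]

/-- Along a holomorphic local homeomorphism `π`, every coordinate of `X` is locally of the form
`e' ∘ π` for a coordinate `e'` of `M`. -/
lemma exists_chart_of_isLocalHomeomorph {π : X → M} (hπ : IsLocalHomeomorph π)
    (hol : ContMDiff 𝓘(ℂ) 𝓘(ℂ) ω π) {e : OpenPartialHomeomorph X ℂ} (he : e ∈ holCharts X)
    {z : ℂ} (hz : z ∈ e.target) :
    ∃ e' ∈ holCharts M, z ∈ e'.target ∧ e'.target ⊆ e.target ∧ ⇑e'.symm = π ∘ e.symm := by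
  obtain ⟨φ, hφ, rfl⟩ := hπ (e.symm z)
  refine ⟨φ.symm.trans e, ?_, ?_, ?_, rfl⟩
  · refine mem_holCharts_of_contMDiffOn_symm _ ?_
    exact hol.comp_contMDiffOn ((contMDiffOn_symm_of_mem_maximalAtlas he).mono fun w hw => hw.1)
  · exact ⟨hz, hφ⟩
  · exact fun w hw => hw.1

variable [IsManifold 𝓘(ℂ) ω X]

lemma contMDiff_real_of_isLocalHomeomorph {π : X → M} (hπ : IsLocalHomeomorph π)
    (hol : ContMDiff 𝓘(ℂ) 𝓘(ℂ) ω π) : ContMDiff 𝓘(ℝ, ℂ) 𝓘(ℝ, ℂ) ∞ π := by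
  intro x
  have he := chartAt_mem_holCharts x
  set e := chartAt ℂ x
  have hx : x ∈ e.source := mem_chart_source ℂ x
  obtain ⟨e', he', hz, -, hsymm⟩ := exists_chart_of_isLocalHomeomorph hπ hol he (e.map_source hx)
  have h := (contMDiffAt_symm_of_mem_maximalAtlas (mem_maximalAtlas_real he') hz).comp x
    (contMDiffAt_of_mem_maximalAtlas (mem_maximalAtlas_real he) hx)
  refine h.congr_of_eventuallyEq ?_
  filter_upwards [e.open_source.mem_nhds hx] with y hy
  simp [hsymm, e.left_inv hy]

omit [IsManifold 𝓘(ℂ) ω M] [IsManifold 𝓘(ℂ) ω X] in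
/-- In corresponding coordinates, a form and its pull-back have the same expression. -/
lemma pullback_inChart {V : Type*} [NormedAddCommGroup V] [NormedSpace ℝ V] {π : X → M}
    (hπ : ContMDiff 𝓘(ℝ, ℂ) 𝓘(ℝ, ℂ) ∞ π) {e : OpenPartialHomeomorph X ℂ} (he : e ∈ holCharts X)
    {e' : OpenPartialHomeomorph M ℂ} (hsymm : ⇑e'.symm = π ∘ e.symm) (α : OneForm M V) {z : ℂ}
    (hz : z ∈ e.target) : (α.pullback π).inChart e z = α.inChart e' z := by
  have h₁ : α.inChart e' z = α.pullback (⇑e'.symm) z := rfl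
  have h₂ := mfderiv_comp z (hπ.mdifferentiableAt (by simp)) (mdifferentiableAt_symm he hz)
  rw [h₁, hsymm, OneForm.pullback, h₂]
  rfl

end LocalHomeomorph

/-! ### The metric in a parallel frame -/

lemma laplacian_eq_fderiv {V : Type*} [NormedAddCommGroup V] [NormedSpace ℝ V] {f : ℂ → V} {z : ℂ}
    (hf : ContDiffAt ℝ 2 f z) : Laplacian.laplacian f z =
      fderiv ℝ (fun w => fderiv ℝ f w 1) z 1 +
        fderiv ℝ (fun w => fderiv ℝ f w Complex.I) z Complex.I := by
  have hd : DifferentiableAt ℝ (fderiv ℝ f) z :=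
    (hf.fderiv_right (m := 1) (by norm_num)).differentiableAt (by simp)
  have h (u : ℂ) : fderiv ℝ (fun w => fderiv ℝ f w u) z u = fderiv ℝ (fderiv ℝ f) z u u := by
    rw [fderiv_clm_apply hd (differentiableAt_const u)]
    simp
  rw [h, h, InnerProductSpace.laplacian_eq_iteratedFDeriv_complexPlane]
  simp [iteratedFDeriv_two_apply]

lemma laplacian_mat {f : ℂ → Mat2} {z : ℂ} (hf : ContDiffAt ℝ 2 f z) :
    Laplacian.laplacian f z = fderiv ℝ (fun w => fderiv ℝ f w 1) z 1 +
        fderiv ℝ (fun w => fderiv ℝ f w Complex.I) z Complex.I := laplacian_eq_fderiv hf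

/-- For trace-free `2 × 2` matrices, `X² = - det X`. -/
lemma sq_of_trace_eq_zero {X : Mat2} (h : X.trace = 0) : X * X = -X.det • (1 : Mat2) := by
  rw [Matrix.trace_fin_two] at h
  have h' : X 1 1 = -X 0 0 := by linear_combination h
  ext i j
  fin_cases i <;> fin_cases j <;> simp [Matrix.mul_apply, Fin.sum_univ_two, Matrix.det_fin_two, h']
    <;> ring

lemma fderiv_fun_smul_of_eventuallyEq {f g : ℂ → Mat2} {z : ℂ} (c : ℂ)
    (h : f =ᶠ[nhds z] fun w => c • g w) (hg : DifferentiableAt ℝ g z) (v : ℂ) :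
    fderiv ℝ f z v = c • fderiv ℝ g z v := by
  rw [h.fderiv_eq, fderiv_smul_apply (differentiableAt_const c) hg]
  simp

/-- The derivative of `G* H Ψ G` for a parallel frame `G`, when `dH = A* H + H A` and `Ψ` is
self-adjoint. -/
lemma deriv_frame_conj {G H A Ψ Y dY : Mat2} (hΨ : Ψᴴ * H = H * Ψ) :
    ((-(A + Ψ) * G)ᴴ * H + Gᴴ * (Aᴴ * H + H * A)) * (Y * G) +
      Gᴴ * H * (dY * G + Y * (-(A + Ψ) * G)) =
      Gᴴ * H * (dY + (A * Y - Y * A) - (Ψ * Y + Y * Ψ)) * G := by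
  have h : (-(A + Ψ) * G)ᴴ * H = -(Gᴴ * (Aᴴ * H)) - Gᴴ * H * Ψ := by
    rw [Matrix.conjTranspose_mul, Matrix.conjTranspose_neg, Matrix.conjTranspose_add, mul_assoc,
      neg_mul, add_mul, hΨ]
    noncomm_ring
  rw [h]
  noncomm_ring

namespace Data

variable {M : Type*} [TopologicalSpace M] [ChartedSpace ℂ M] [IsManifold 𝓘(ℂ) ω M]
variable {D : Data M} {d : ℂ}

/-- The self-adjoint form `Φ + Φ*`. -/
noncomputable def higgsSum (D : Data M) : OneForm M Mat2 := fun p => D.higgs p + D.higgsAdj p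

variable (hp : D.IsUnitaryPair d) {e : OpenPartialHomeomorph M ℂ} {z : ℂ}

omit [IsManifold 𝓘(ℂ) ω M] in
lemma IsUnitaryPair.conjTranspose_higgsSum (hp : D.IsUnitaryPair d) (p : M)
    (v : TangentSpace 𝓘(ℝ, ℂ) p) :
    (D.higgsSum p v)ᴴ * D.metric p = D.metric p * D.higgsSum p v := by
  have h₁ := hp.conjTranspose_higgs p v
  have h₂ := conjTranspose_mul_comm (hp.hermitian p) h₁
  change (D.higgs p v + D.higgsAdj p v)ᴴ * D.metric p = D.metric p * (D.higgs p v + D.higgsAdj p v)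
  rw [Matrix.conjTranspose_add, add_mul, mul_add, h₁, h₂, add_comm]

lemma IsUnitaryPair.smoothForm_higgsSum (hp : D.IsUnitaryPair d) : SmoothForm D.higgsSum :=
  hp.smooth_higgs.add hp.smoothForm_higgsAdj

omit [IsManifold 𝓘(ℂ) ω M] in
lemma IsUnitaryPair.trace_higgsSum (hp : D.IsUnitaryPair d) (htr : ∀ p v, (D.higgs p v).trace = 0)
    (p : M) (v : TangentSpace 𝓘(ℝ, ℂ) p) : (D.higgsSum p v).trace = 0 := by
  change (D.higgs p v + D.higgsAdj p v).trace = 0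
  rw [Matrix.trace_add, htr, zero_add, higgsAdj_apply, Matrix.trace_mul_comm, ← mul_assoc,
    Matrix.mul_nonsing_inv _ (hp.isUnit_det p), one_mul, Matrix.trace_conjTranspose, htr, star_zero]

/-- The equations `∂̄^∇ Φ = 0` and `∂^∇ Φ* = 0` say that `Φ + Φ*` is divergence free. -/
lemma IsUnitaryPair.div_higgsSum (hp : D.IsUnitaryPair d) (he : e ∈ holCharts M)
    (hz : z ∈ e.target)
    (h : dCoeff D.higgs e z + wedgeCoeff D.conn D.higgs e z + wedgeCoeff D.higgs D.conn e z = 0) :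
    (fderiv ℝ (fun w => D.higgsSum.inChart e w 1) z 1 +
      (D.conn.inChart e z 1 * D.higgsSum.inChart e z 1 -
        D.higgsSum.inChart e z 1 * D.conn.inChart e z 1)) +
    (fderiv ℝ (fun w => D.higgsSum.inChart e w Complex.I) z Complex.I +
      (D.conn.inChart e z Complex.I * D.higgsSum.inChart e z Complex.I -
        D.higgsSum.inChart e z Complex.I * D.conn.inChart e z Complex.I)) = 0 := by
  have h' := hp.del_higgsAdj he hz h
  have hφ (w : ℂ) (hw : w ∈ e.target) :
      D.higgs.inChart e w Complex.I = Complex.I • D.higgs.inChart e w 1 := by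
    simpa using hp.type_higgs e he w hw 1
  have hψ (w : ℂ) (hw : w ∈ e.target) :
      D.higgsAdj.inChart e w Complex.I = -Complex.I • D.higgsAdj.inChart e w 1 := by
    simpa using hp.higgsAdj_I_mul he hw 1
  have dφ := hp.smooth_higgs.differentiableAt he hz
  have dψ := hp.smoothForm_higgsAdj.differentiableAt he hz
  have hφd (v : ℂ) : fderiv ℝ (fun w => D.higgs.inChart e w Complex.I) z v =
      Complex.I • fderiv ℝ (fun w => D.higgs.inChart e w 1) z v :=
    fderiv_fun_smul_of_eventuallyEq _
      (by filter_upwards [e.open_target.mem_nhds hz] with w hw using hφ w hw) (dφ 1) v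
  have hψd (v : ℂ) : fderiv ℝ (fun w => D.higgsAdj.inChart e w Complex.I) z v =
      -Complex.I • fderiv ℝ (fun w => D.higgsAdj.inChart e w 1) z v :=
    fderiv_fun_smul_of_eventuallyEq _
      (by filter_upwards [e.open_target.mem_nhds hz] with w hw using hψ w hw) (dψ 1) v
  have hs (u v : ℂ) : fderiv ℝ (fun w => D.higgsSum.inChart e w u) z v =
      fderiv ℝ (fun w => D.higgs.inChart e w u) z v +
        fderiv ℝ (fun w => D.higgsAdj.inChart e w u) z v := fderiv_add_apply (dφ u) (dψ u) v
  have hs' (u : ℂ) : D.higgsSum.inChart e z u =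
    D.higgs.inChart e z u + D.higgsAdj.inChart e z u := rfl
  rw [dCoeff_mat, wedgeCoeff, wedgeCoeff, hφ z hz, hφd] at h
  rw [dCoeff_mat, wedgeCoeff, wedgeCoeff, hψ z hz, hψd] at h'
  have key := congrArg₂ (fun X Y => -Complex.I • X + Complex.I • Y) h h'
  simp only [smul_zero, add_zero] at key
  rw [hs, hs, hs', hs', hφ z hz, hψ z hz, hφd, hψd, ← key]
  simp only [smul_add, smul_sub, mul_add, add_mul, smul_mul_assoc, mul_smul_comm, smul_smul,
    neg_mul, mul_neg, neg_neg, Complex.I_mul_I, neg_smul, one_smul, smul_neg]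
  abel

end Data

namespace Data

section LocalFrame

variable {M : Type*} [TopologicalSpace M] [ChartedSpace ℂ M]

/-- `G` is a parallel frame of `∇ + Φ + Φ*` in the coordinate `e` of `M`. -/
structure IsLocalFrame (D : Data M) (e : OpenPartialHomeomorph M ℂ) (G : ℂ → Mat2) : Prop where
  smooth : ContDiffOn ℝ ∞ G e.target
  parallel : ∀ z ∈ e.target, ∀ v, fderiv ℝ G z v = -D.totalForm.inChart e z v * G z

/-- The metric in the frame `G`. -/
noncomputable def localMap (D : Data M) (e : OpenPartialHomeomorph M ℂ) (G : ℂ → Mat2) (z : ℂ) :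
    Mat2 :=
  (G z)ᴴ * D.metric (e.symm z) * G z

namespace IsLocalFrame

variable {D : Data M} {d : ℂ} {e : OpenPartialHomeomorph M ℂ} {G : ℂ → Mat2} {z : ℂ}
variable (hG : D.IsLocalFrame e G)
include hG

lemma differentiableAt (hz : z ∈ e.target) : DifferentiableAt ℝ G z :=
  (hG.smooth.contDiffAt (e.open_target.mem_nhds hz)).differentiableAt (by simp)

lemma parallel' (hz : z ∈ e.target) (v : ℂ) :
    fderiv ℝ G z v = -(D.conn.inChart e z v + D.higgsSum.inChart e z v) * G z := by
  rw [hG.parallel z hz v]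
  congr 2
  change D.conn.inChart e z v + D.higgs.inChart e z v + D.higgsAdj.inChart e z v =
    D.conn.inChart e z v + (D.higgs.inChart e z v + D.higgsAdj.inChart e z v)
  exact add_assoc _ _ _

variable (hp : D.IsUnitaryPair d) (he : e ∈ holCharts M)
include hp he

lemma contDiffOn_localMap : ContDiffOn ℝ ∞ (D.localMap e G) e.target :=
  contDiffOn_mul (contDiffOn_mul (contDiffOn_conjTranspose hG.smooth)
    (hp.smooth_metric.contDiffOn_comp_symm he)) hG.smooth

/-- The derivative of `G* H Y G` along a parallel frame `G` is governed by the covariant derivative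
of `Y` and its anticommutator with `Φ + Φ*`. -/
lemma fderiv_frame_conj (hz : z ∈ e.target) {Y : ℂ → Mat2} (hY : DifferentiableAt ℝ Y z) (v : ℂ) :
    fderiv ℝ (fun w => (G w)ᴴ * D.metric (e.symm w) * (Y w * G w)) z v =
      (G z)ᴴ * D.metric (e.symm z) * (fderiv ℝ Y z v +
        (D.conn.inChart e z v * Y z - Y z * D.conn.inChart e z v) -
        (D.higgsSum.inChart e z v * Y z + Y z * D.higgsSum.inChart e z v)) * G z := by
  have dG := hG.differentiableAt hz
  have dG' := differentiableAt_conjTranspose dG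
  have dH : DifferentiableAt ℝ (fun w => D.metric (e.symm w)) z :=
    hp.smooth_metric.differentiableAt_comp_symm he hz
  have hH : fderiv ℝ (fun w => D.metric (e.symm w)) z v = _ := hp.fderiv_metric he hz v
  rw [fderiv_mul_apply (differentiableAt_mul dG' dH) (differentiableAt_mul hY dG),
    fderiv_mul_apply dG' dH, fderiv_mul_apply hY dG, fderiv_conjTranspose_apply dG, hH,
    hG.parallel' hz]
  exact deriv_frame_conj (hp.conjTranspose_higgsSum _ _)

/-- The map associated to a parallel frame has the differential `-2 G* H (Φ + Φ*) G`. -/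
lemma fderiv_localMap (hz : z ∈ e.target) (v : ℂ) :
    fderiv ℝ (D.localMap e G) z v = (-2 : ℂ) •
      ((G z)ᴴ * D.metric (e.symm z) * (D.higgsSum.inChart e z v * G z)) := by
  have h := hG.fderiv_frame_conj hp he hz (Y := fun _ => 1) (differentiableAt_const _) v
  have h₁ : D.localMap e G = fun w => (G w)ᴴ * D.metric (e.symm w) * (1 * G w) := by
    funext w
    rw [one_mul, localMap]
  have h₂ : fderiv ℝ (fun _ : ℂ => (1 : Mat2)) z v = 0 := by simp
  rw [h₁, h, h₂]
  simp only [mul_one, one_mul, sub_self, add_zero, zero_sub]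
  rw [neg_smul, two_smul]
  noncomm_ring

variable [IsManifold 𝓘(ℂ) ω M]

/-- The metric in a parallel frame is harmonic: its Laplacian is normal to the quadric. -/
lemma laplacian_localMap (htr : ∀ p v, (D.higgs p v).trace = 0) (hz : z ∈ e.target)
    (h : dCoeff D.higgs e z + wedgeCoeff D.conn D.higgs e z + wedgeCoeff D.higgs D.conn e z = 0) :
    Laplacian.laplacian (D.localMap e G) z =
      (-4 * ((D.higgsSum.inChart e z 1).det + (D.higgsSum.inChart e z Complex.I).det)) •
        D.localMap e G z := by
  have hN : ContDiffAt ℝ ∞ (D.localMap e G) z :=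
    (hG.contDiffOn_localMap hp he).contDiffAt (e.open_target.mem_nhds hz)
  have hN₂ : ContDiffAt ℝ 2 (D.localMap e G) z := by exact_mod_cast contDiffAt_infty.mp hN 2
  have hsq (v : ℂ) : D.higgsSum.inChart e z v * D.higgsSum.inChart e z v =
      -(D.higgsSum.inChart e z v).det • (1 : Mat2) :=
    sq_of_trace_eq_zero (hp.trace_higgsSum htr _ _)
  -- the second derivatives; by Cayley–Hamilton the anticommutator term is a scalar
  have hsnd (u : ℂ) : fderiv ℝ (fun w => fderiv ℝ (D.localMap e G) w u) z u =
      (-2 : ℂ) • ((G z)ᴴ * D.metric (e.symm z) *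
        (fderiv ℝ (fun w => D.higgsSum.inChart e w u) z u +
        (D.conn.inChart e z u * D.higgsSum.inChart e z u -
          D.higgsSum.inChart e z u * D.conn.inChart e z u) +
        (2 * (D.higgsSum.inChart e z u).det) • (1 : Mat2)) * G z) := by
    have hY := hp.smoothForm_higgsSum.differentiableAt he hz u
    have dG := hG.differentiableAt hz
    have dH : DifferentiableAt ℝ (fun w => D.metric (e.symm w)) z :=
      hp.smooth_metric.differentiableAt_comp_symm he hz
    rw [fderiv_fun_smul_of_eventuallyEq (-2)
      (by filter_upwards [e.open_target.mem_nhds hz] with w hw using hG.fderiv_localMap hp he hw u)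
      (differentiableAt_mul (differentiableAt_mul (differentiableAt_conjTranspose dG) dH)
        (differentiableAt_mul hY dG)), hG.fderiv_frame_conj hp he hz hY, hsq]
    congr 4
    module
  have hdiv := hp.div_higgsSum he hz h
  rw [laplacian_mat hN₂, hsnd, hsnd, ← smul_add, ← add_mul, ← mul_add]
  rw [show ∀ a b c d : Mat2, (a + b) + (c + d) = (a + c) + (b + d) from fun a b c d => by abel,
    hdiv, zero_add, ← add_smul, mul_smul_comm, mul_one, smul_mul_assoc, smul_smul, localMap]
  congr 1
  ring

end IsLocalFrame

end LocalFrame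

section ParallelFrame

variable {M : Type*} [TopologicalSpace M] [ChartedSpace ℂ M]
variable {X : Type*} [TopologicalSpace X] [ChartedSpace ℂ X]
variable {D : Data M} {d : ℂ} {π : X → M} {F : X → Mat2}

/-- In corresponding coordinates of `X` and `M`, a parallel frame of the pull-back is a parallel
frame on `M`. -/
lemma IsParallelFrame.isLocalFrame (hF : D.IsParallelFrame π F)
    (hπ : ContMDiff 𝓘(ℝ, ℂ) 𝓘(ℝ, ℂ) ∞ π) {e : OpenPartialHomeomorph X ℂ} (he : e ∈ holCharts X)
    {e' : OpenPartialHomeomorph M ℂ} (hsub : e'.target ⊆ e.target)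
    (hsymm : ⇑e'.symm = π ∘ e.symm) : D.IsLocalFrame e' (F ∘ e.symm) where
  smooth := (hF.smooth.contDiffOn_comp_symm he).mono hsub
  parallel z hz v := by
    have h₁ := hF.smooth.diff_inChart he (hsub hz) v
    have h₂ := congrArg (fun α => α v) (pullback_inChart hπ he hsymm D.totalForm (hsub hz))
    have h₃ : (diff F).inChart e z v + (D.totalForm.pullback π).inChart e z v * F (e.symm z) = 0 :=
      hF.parallel _ _
    have h₄ : (D.totalForm.pullback π).inChart e z v = D.totalForm.inChart e' z v := h₂
    rw [h₄] at h₃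
    rw [neg_mul]
    exact h₁.symm.trans (eq_neg_of_add_eq_zero_left h₃)

omit [ChartedSpace ℂ X] in
lemma assocMap_comp_symm (D : Data M) {e : OpenPartialHomeomorph X ℂ}
    {e' : OpenPartialHomeomorph M ℂ} (hsymm : ⇑e'.symm = π ∘ e.symm) :
    D.assocMap π F ∘ e.symm = D.localMap e' (F ∘ e.symm) := by
  funext w
  simp only [Function.comp_apply, localMap, assocMap, hsymm]

lemma smoothMap_assocMap [IsManifold 𝓘(ℂ) ω X] (hp : D.IsUnitaryPair d)
    (hπ : ContMDiff 𝓘(ℝ, ℂ) 𝓘(ℝ, ℂ) ∞ π) (hF : SmoothMap F) : SmoothMap (D.assocMap π F) :=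
  smoothMap_mul (smoothMap_mul (smoothMap_conjTranspose hF)
    (ContMDiff.comp hp.smooth_metric hπ)) hF

variable [IsManifold 𝓘(ℂ) ω M] [IsManifold 𝓘(ℂ) ω X]

/-- The map associated to a solution is harmonic into every quadric that contains its image. -/
lemma isHarmonicInto_assocMap {S : Set Mat2} (hp : D.IsUnitaryPair d) (hD : D.SelfDual)
    (hπ : IsLocalHomeomorph π) (hol : ContMDiff 𝓘(ℂ) 𝓘(ℂ) ω π) (hF : D.IsParallelFrame π F)
    (hS : ∀ x, D.assocMap π F x ∈ S) : IsHarmonicInto S (D.assocMap π F) where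
  mem := hS
  smooth := smoothMap_assocMap hp (contMDiff_real_of_isLocalHomeomorph hπ hol) hF.smooth
  tension e he z hz Y _ hYf := by
    obtain ⟨e', he', hz', hsub, hsymm⟩ := exists_chart_of_isLocalHomeomorph hπ hol he hz
    have hG := hF.isLocalFrame (contMDiff_real_of_isLocalHomeomorph hπ hol) he hsub hsymm
    have h₁ := hG.laplacian_localMap hp he' hD.trace_higgs hz' (hD.dbar_higgs e' he' z hz')
    have h₂ : D.assocMap π F (e.symm z) = D.localMap e' (F ∘ e.symm) z :=
      congrFun (assocMap_comp_symm D hsymm) z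
    rw [h₂] at hYf
    have h₃ : ∀ (c : ℂ) (A B : Mat2), mink A (c • B) = c * mink A B := fun c A B => by
      simp only [mink, mul_smul_comm, Matrix.trace_smul, smul_eq_mul]
      ring
    rw [assocMap_comp_symm D hsymm]
    refine (congrArg (mink Y) h₁).trans ?_
    rw [h₃, hYf, mul_zero]

end ParallelFrame
end Data

/-! ### Minkowski geometry of `2 × 2` matrices -/

section Minkowski

variable {A B C K X Y c g : Mat2}

lemma mink_smul_left (a : ℂ) (X Y : Mat2) : mink (a • X) Y = a * mink X Y := by
  simp only [mink, smul_mul_assoc, Matrix.trace_smul, smul_eq_mul]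
  ring

lemma mink_smul_right (a : ℂ) (X Y : Mat2) : mink X (a • Y) = a * mink X Y := by
  simp only [mink, mul_smul_comm, Matrix.trace_smul, smul_eq_mul]
  ring

lemma mink_self (X : Mat2) : mink X X = -X.det := by
  simp only [mink, Matrix.trace_fin_two, Matrix.mul_apply, Fin.sum_univ_two, Matrix.det_fin_two]
  ring

/-- The Minkowski form is the polarization of `-det`, and `det` is multiplicative. -/
lemma mink_mul_mul (A B X Y : Mat2) :
    mink (A * X * B) (A * Y * B) = A.det * B.det * mink X Y := by
  simp only [mink, Matrix.trace_fin_two, Matrix.mul_apply, Fin.sum_univ_two, Matrix.det_fin_two]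
  ring

lemma mink_of_trace_eq_zero (h : Y.trace = 0) : mink X Y = (X * Y).trace / 2 := by
  rw [mink, h, mul_zero, sub_zero]

/-- The volume form of Minkowski space in terms of matrix products, with the orientation given by
the coordinates `minkCoord`. -/
lemma det_minkCoord {W : Mat2} (hX : X.IsHermitian) (hY : Y.IsHermitian) (hC : C.IsHermitian)
    (hW : W.IsHermitian) :
    (Matrix.of ![minkCoord X, minkCoord Y, minkCoord C, minkCoord W]).det =
      -(X * Y.adjugate * C * W.adjugate).trace.im / 2 := by
  have h00 {Z : Mat2} (hZ : Z.IsHermitian) : (Z 0 0).im = 0 :=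
    Complex.conj_eq_iff_im.mp (hZ.apply 0 0)
  have h11 {Z : Mat2} (hZ : Z.IsHermitian) : (Z 1 1).im = 0 :=
    Complex.conj_eq_iff_im.mp (hZ.apply 1 1)
  have h10 {Z : Mat2} (hZ : Z.IsHermitian) : Z 1 0 = (starRingEnd ℂ) (Z 0 1) :=
    (hZ.apply 1 0).symm
  simp only [Matrix.adjugate_fin_two, Matrix.trace_fin_two, Matrix.mul_apply, Fin.sum_univ_two,
    Matrix.of_apply, Matrix.cons_val_zero, Matrix.cons_val_one, h10 hX, h10 hY, h10 hC, h10 hW,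
    Complex.add_im, Complex.mul_im, Complex.mul_re, Complex.add_re, Complex.neg_re, Complex.neg_im,
    Complex.conj_re, Complex.conj_im, h00 hX, h00 hY, h00 hC, h00 hW, h11 hX, h11 hY, h11 hC,
    h11 hW, Matrix.cons_val', Matrix.cons_val_fin_one]
  simp [minkCoord, Matrix.det_succ_row_zero, Fin.sum_univ_succ, Fin.succAbove]
  ring

open scoped MatrixOrder in
/-- If `-g` is the adjoint of `c` for a positive definite form, then `tr (c g)` is minus the squared
norm of `c`. -/
lemma trace_mul_neg (hK : K.PosDef) (hcg : cᴴ * K = -(K * g)) (hc : c ≠ 0) : (c * g).trace < 0 := by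
  obtain ⟨A, rfl⟩ : ∃ A : Mat2, K = Aᴴ * A :=
    CStarAlgebra.nonneg_iff_eq_star_mul_self.mp hK.posSemidef.nonneg
  have hA : IsUnit A.det := by
    have h := hK.det_pos.ne'
    rw [Matrix.det_mul] at h
    exact (right_ne_zero_of_mul h).isUnit
  have hA' : IsUnit Aᴴ.det := by
    rw [Matrix.det_conjTranspose]
    exact hA.star
  -- in an orthonormal basis for `K`, `-g` is the conjugate transpose of `c`
  have h₁ : (A * c * A⁻¹)ᴴ = -(A * g * A⁻¹) := by
    have h₂ : Aᴴ * ((A * c * A⁻¹)ᴴ * A) = Aᴴ * (-(A * g * A⁻¹) * A) := by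
      rw [Matrix.conjTranspose_mul, Matrix.conjTranspose_mul, ← mul_assoc, ← mul_assoc,
        ← Matrix.conjTranspose_mul, Matrix.nonsing_inv_mul _ hA, Matrix.conjTranspose_one, one_mul,
        mul_assoc, hcg, neg_mul, Matrix.nonsing_inv_mul_cancel_right _ _ hA, mul_neg, mul_assoc]
    have h₃ := congrArg (fun Z => (Aᴴ)⁻¹ * Z) h₂
    simp only [Matrix.nonsing_inv_mul_cancel_left _ _ hA'] at h₃
    have h₄ := congrArg (fun Z => Z * A⁻¹) h₃
    simpa only [Matrix.mul_nonsing_inv_cancel_right _ _ hA] using h₄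
  have h₂ : (A * c * A⁻¹ * (A * c * A⁻¹)ᴴ).trace = -(c * g).trace := by
    have h₃ : A * c * A⁻¹ * -(A * g * A⁻¹) = -(A * (c * g) * A⁻¹) := by
      rw [mul_neg, mul_assoc (A * c), mul_assoc A g, Matrix.nonsing_inv_mul_cancel_left _ _ hA]
      noncomm_ring
    rw [h₁, h₃, Matrix.trace_neg, Matrix.trace_mul_comm, Matrix.nonsing_inv_mul_cancel_left _ _ hA]
  rw [← neg_pos, ← h₂]
  refine lt_of_le_of_ne (Matrix.posSemidef_self_mul_conjTranspose _).trace_nonneg (Ne.symm ?_)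
  rw [Ne, Matrix.trace_mul_conjTranspose_self_eq_zero_iff]
  intro h₀
  apply hc
  have h₃ := congrArg (fun Z => A⁻¹ * (Z * A)) h₀
  simpa [mul_assoc, Matrix.nonsing_inv_mul _ hA, Matrix.nonsing_inv_mul_cancel_left _ _ hA] using h₃

lemma eq_zero_of_conjTranspose_mul {H : Mat2} (hH : IsUnit H.det) (h : cᴴ * H = H * g)
    (hc : c = 0) : g = 0 := by
  rw [hc, Matrix.conjTranspose_zero, zero_mul] at h
  rw [← Matrix.nonsing_inv_mul_cancel_left H g hH, ← h, mul_zero]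

lemma adjugate_of_trace_eq_zero (h : X.trace = 0) : X.adjugate = -X := by
  rw [← adjugateCLM_apply]
  change X.trace • (1 : Mat2) - X = _
  rw [h, zero_smul, zero_sub]

lemma trace_mul_adjugate_mul (A B X Y Z W : Mat2) :
    (A * X * B * (A * Y * B).adjugate * (A * Z * B) * (A * W * B).adjugate).trace =
      (A.det * B.det) ^ 2 * (X * Y.adjugate * Z * W.adjugate).trace := by
  have hB (U : Mat2) : B * (B.adjugate * U) = B.det • U := by
    rw [← mul_assoc, Matrix.mul_adjugate, smul_mul_assoc, one_mul]
  have hA (U : Mat2) : A.adjugate * (A * U) = A.det • U := by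
    rw [← mul_assoc, Matrix.adjugate_mul, smul_mul_assoc, one_mul]
  have h : A * X * B * (A * Y * B).adjugate * (A * Z * B) * (A * W * B).adjugate =
      (A.det * B.det ^ 2) • (A * (X * Y.adjugate * Z * W.adjugate) * A.adjugate) := by
    simp only [Matrix.adjugate_mul_distrib, mul_assoc, hB, hA, mul_smul_comm,
      smul_mul_assoc, smul_smul]
    congr 1
    ring
  rw [h, Matrix.trace_smul, Matrix.trace_mul_comm, hA, Matrix.trace_smul, smul_eq_mul, smul_eq_mul]
  ring

/-- The triple product `tr (S (φ + ψ) (φ - ψ))` for `φ = w S + c`, `ψ = w' S + g` and the reflection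
`S = 1 - 2 P`: only the off-diagonal blocks contribute. -/
lemma trace_flip_mul {P : Mat2} {w w' : ℂ} (hP : P * P = P) (htr : P.trace = 1) (hc : MapsIn P c)
    (hg : MapsOut P g) :
    ((1 - 2 • P) * (w • (1 - 2 • P) + c + (w' • (1 - 2 • P) + g)) *
      (w • (1 - 2 • P) + c - (w' • (1 - 2 • P) + g))).trace = 2 * (c * g).trace := by
  obtain ⟨hSS, hSc, hSg, hcS, hgS⟩ : (1 - 2 • P) * (1 - 2 • P) = 1 ∧ (1 - 2 • P) * c = -c ∧
      (1 - 2 • P) * g = g ∧ c * (1 - 2 • P) = c ∧ g * (1 - 2 • P) = -g := by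
    simp only [sub_mul, mul_sub, one_mul, mul_one, smul_mul_assoc, mul_smul_comm, hP, hc.left,
      hc.right, hg.left, hg.right, smul_zero, sub_zero, true_and]
    refine ⟨?_, ?_, ?_⟩ <;> abel
  have htc := hc.trace_eq_zero
  have htg := hg.trace_eq_zero
  have htS : (1 - 2 • P).trace = 0 := by
    rw [Matrix.trace_sub, Matrix.trace_smul, htr, Matrix.trace_one, Fintype.card_fin]
    norm_num
  have hcc := hc.mul hc
  have hgg := hg.mul hg
  generalize 1 - 2 • P = S at *
  simp only [mul_add, add_mul, mul_sub, mul_smul_comm, smul_mul_assoc]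
  simp only [hSS, hSc, hSg, hcS, hgS, one_mul, hcc, hgg, neg_mul, Matrix.trace_add,
    Matrix.trace_sub, Matrix.trace_smul, Matrix.trace_neg, Matrix.trace_zero, htc, htg, htS,
    smul_eq_mul, Matrix.trace_mul_comm g c]
  ring

end Minkowski

namespace Data

/-! ### The dual map -/

variable {M : Type*} [TopologicalSpace M] [ChartedSpace ℂ M]
variable {D : Data M} {d : ℂ} {om : OneForm M ℂ} {L : M → ℙ ℂ (Fin 2 → ℂ)}
variable {X : Type*} {π : X → M} {F : X → Mat2}

/-- In `Ψ_x - i Ψ_y` for `Ψ = Φ + Φ*` only the part of type `(1,0)` survives. -/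
lemma dz_frame (A B φ ψ : Mat2) :
    (1 / 2 : ℂ) • ((-2 : ℂ) • (A * (φ + ψ) * B) -
      Complex.I • ((-2 : ℂ) • (A * (Complex.I • (φ - ψ)) * B))) = (-2 : ℂ) • (A * φ * B) := by
  have h : Complex.I • ((-2 : ℂ) • (A * (Complex.I • (φ - ψ)) * B)) =
      (2 : ℂ) • (A * (φ - ψ) * B) := by
    rw [mul_smul_comm, smul_mul_assoc, smul_smul, smul_smul]
    congr 1
    linear_combination (-2) * Complex.I_mul_I
  rw [h, mul_add, mul_sub, add_mul, sub_mul]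
  module

lemma IsUnitaryPair.higgsSum_I (hp : D.IsUnitaryPair d) {e : OpenPartialHomeomorph M ℂ}
    (he : e ∈ holCharts M) {z : ℂ} (hz : z ∈ e.target) :
    D.higgsSum.inChart e z Complex.I =
      Complex.I • (D.higgs.inChart e z 1 - D.higgsAdj.inChart e z 1) := by
  have h₁ : D.higgs.inChart e z Complex.I = Complex.I • D.higgs.inChart e z 1 := by
    simpa using hp.type_higgs e he z hz 1
  have h₂ : D.higgsAdj.inChart e z Complex.I = -Complex.I • D.higgsAdj.inChart e z 1 := by
    simpa using hp.higgsAdj_I_mul he hz 1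
  change D.higgs.inChart e z Complex.I + D.higgsAdj.inChart e z Complex.I = _
  rw [h₁, h₂, neg_smul, smul_sub, sub_eq_add_neg]

lemma assocMap_eq (x : X) : D.assocMap π F x = (F x)ᴴ * D.metric (π x) * 1 * F x := by
  rw [mul_one, assocMap]

/-- Up to sign, the map associated to the flipped data is `F* ĥ S F`, with `S` the reflection in
the eigenline. -/
lemma smul_assocMap_flip {ε : ℝ} (hε : ε = 1 ∨ ε = -1) (hs : ∀ p, D.signOn L p = -ε) (x : X) :
    ε • (D.reverseFlip om L).assocMap π F x =
      (F x)ᴴ * D.metric (π x) * (1 - 2 • D.proj L (π x)) * F x := by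
  have h : ε • (D.reverseFlip om L).metric (π x) =
      D.metric (π x) * (1 - 2 • D.proj L (π x)) := by
    have h' : ε * -ε = -1 := by rcases hε with rfl | rfl <;> norm_num
    rw [reverseFlip_metric, hs, smul_smul, h', neg_smul, one_smul, two_smul]
    noncomm_ring
  rw [assocMap, ← smul_mul_assoc, ← mul_smul_comm, h]
  simp only [mul_assoc]

namespace IsFlippable

variable (hD : D.IsFlippable om L)
include hD

lemma trace_reflection (p : M) : (1 - 2 • D.proj L p).trace = 0 := by
  rw [Matrix.trace_sub, Matrix.trace_smul, hD.trace_proj, Matrix.trace_one, Fintype.card_fin]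
  norm_num

lemma det_reflection (p : M) : (1 - 2 • D.proj L p).det = -1 := by
  have h : 1 - 2 • D.proj L p = -(D.proj L p - (1 - D.proj L p)) := by
    rw [two_smul]
    abel
  rw [h, Matrix.det_neg, det_flip (hD.proj_mul_self p) (hD.trace_proj p)]
  simp

/-- Only the diagonal parts `om S` and `om̄ S` of `Φ̂` and `Φ̂^†` contribute to the trace with the
reflection `S = 1 - 2 P`, and `tr S² = 2`. -/
lemma trace_higgsSum_mul (p : M) (v : TangentSpace 𝓘(ℝ, ℂ) p) :
    (D.higgsSum p v * (1 - 2 • D.proj L p)).trace = 2 * (om p v + star (om p v)) := by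
  have hP := hD.proj_mul_self p
  have htr := hD.trace_proj p
  have hc := mapsIn_block hP (D.higgs p v)
  have hg := mapsOut_block hP (D.higgsAdj p v)
  change ((D.higgs p v + D.higgsAdj p v) * _).trace = _
  rw [hD.higgs_split p v, hD.higgsAdj_split p v]
  generalize D.proj L p * D.higgs p v * (1 - D.proj L p) = c at *
  generalize (1 - D.proj L p) * D.higgsAdj p v * D.proj L p = g at *
  simp only [two_smul, add_mul, smul_mul_assoc, mul_sub, mul_add, sub_mul, mul_one, one_mul, hP,
    hc.right, hg.right, Matrix.trace_add, Matrix.trace_sub, Matrix.trace_smul, htr,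
    hc.trace_eq_zero, hg.trace_eq_zero, Matrix.trace_one, Fintype.card_fin, Matrix.trace_zero,
    smul_eq_mul]
  push_cast
  ring

lemma conjTranspose_reflection (p : M) :
    (1 - 2 • D.proj L p)ᴴ * D.metric p = D.metric p * (1 - 2 • D.proj L p) := by
  have h := hD.conjTranspose_proj p
  simp only [two_smul, Matrix.conjTranspose_sub, Matrix.conjTranspose_add, sub_mul, add_mul, h,
    mul_sub, mul_add, mul_one, one_mul, Matrix.conjTranspose_one]

lemma isHermitian_frame (x : X) {Y : Mat2} (hY : Yᴴ * D.metric (π x) = D.metric (π x) * Y) :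
    ((F x)ᴴ * D.metric (π x) * Y * F x).IsHermitian := by
  rw [Matrix.IsHermitian, Matrix.conjTranspose_mul, Matrix.conjTranspose_mul,
    Matrix.conjTranspose_mul, Matrix.conjTranspose_conjTranspose, (hD.pair.hermitian _).eq]
  simp only [mul_assoc]
  rw [← mul_assoc Yᴴ, hY, mul_assoc]


variable [TopologicalSpace X] [ChartedSpace ℂ X]


/-- The map `Y ↦ F* ĥ Y F` is an anti-isometry for the Minkowski form, as `det ĥ = -1`. -/
lemma mink_frame (hF : D.IsParallelFrame π F) (x : X) (Y Z : Mat2) :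
    mink ((F x)ᴴ * D.metric (π x) * Y * F x) ((F x)ᴴ * D.metric (π x) * Z * F x) = -mink Y Z := by
  rw [mink_mul_mul, Matrix.det_mul, Matrix.det_conjTranspose, hF.det_eq, hD.pair.det_metric]
  simp

end IsFlippable

variable [TopologicalSpace X] [ChartedSpace ℂ X]
variable [IsManifold 𝓘(ℂ) ω M] [IsManifold 𝓘(ℂ) ω X]

lemma diff_assocMap_inChart (hp : D.IsUnitaryPair d) (hπ : IsLocalHomeomorph π)
    (hol : ContMDiff 𝓘(ℂ) 𝓘(ℂ) ω π) (hF : D.IsParallelFrame π F)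
    {e : OpenPartialHomeomorph X ℂ} (he : e ∈ holCharts X) {e' : OpenPartialHomeomorph M ℂ}
    (he' : e' ∈ holCharts M) {z : ℂ} (hz : z ∈ e'.target) (hsub : e'.target ⊆ e.target)
    (hsymm : ⇑e'.symm = π ∘ e.symm) (v : ℂ) :
    (diff (D.assocMap π F)).inChart e z v = (-2 : ℂ) •
      ((F (e.symm z))ᴴ * D.metric (e'.symm z) * D.higgsSum.inChart e' z v * F (e.symm z)) := by
  have hπ' := contMDiff_real_of_isLocalHomeomorph hπ hol
  have h₁ := (smoothMap_assocMap hp hπ' hF.smooth).diff_inChart he (hsub hz) v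
  rw [assocMap_comp_symm D hsymm] at h₁
  rw [mul_assoc]
  exact h₁.trans ((hF.isLocalFrame hπ' he hsub hsymm).fderiv_localMap hp he' hz v)

namespace IsFlippable

variable (hD : D.IsFlippable om L)
include hD

omit [IsManifold 𝓘(ℂ) ω X] in
/-- The two off-diagonal blocks of `Φ̂` and `Φ̂^†` are adjoint for the indefinite metric, hence
negative adjoint for the definite flipped metric, so the trace of their product is minus a squared
norm. -/
lemma trace_block_mul_neg [ConnectedSpace M] (p : M) (v : TangentSpace 𝓘(ℝ, ℂ) p)
    (hc : D.proj L p * D.higgs p v * (1 - D.proj L p) ≠ 0) :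
    (D.proj L p * D.higgs p v * (1 - D.proj L p) *
      ((1 - D.proj L p) * D.higgsAdj p v * D.proj L p)).trace < 0 := by
  have hg := mapsOut_block (hD.proj_mul_self p) (D.higgsAdj p v)
  refine trace_mul_neg (hD.isSU2Solution_flip.posDef p) ?_ hc
  rw [reverseFlip_metric, mul_smul_comm, ← mul_assoc,
    conjTranspose_block (hD.conjTranspose_proj p) (hD.pair.conjTranspose_higgs p v),
    smul_mul_assoc, ← smul_neg]
  generalize (1 - D.proj L p) * D.higgsAdj p v * D.proj L p = g at *
  congr 1
  simp only [mul_assoc, mul_sub, sub_mul, mul_one, hg.right, hg.left, mul_zero]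
  abel

/-- At an immersive point the off-diagonal block of the Higgs field is nonzero: otherwise
`Φ̂ + Φ̂^† = (om + om̄) S` there, which has a kernel, and so has `dN`. -/
lemma block_ne_zero (hπ : IsLocalHomeomorph π)
    (hol : ContMDiff 𝓘(ℂ) 𝓘(ℂ) ω π) (hF : D.IsParallelFrame π F)
    {e : OpenPartialHomeomorph X ℂ} (he : e ∈ holCharts X) {e' : OpenPartialHomeomorph M ℂ}
    (he' : e' ∈ holCharts M) {z : ℂ} (hz : z ∈ e'.target) (hsub : e'.target ⊆ e.target)
    (hsymm : ⇑e'.symm = π ∘ e.symm)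
    (hinj : Function.Injective (diff (D.assocMap π F) (e.symm z))) :
    D.proj L (e'.symm z) * D.higgs.inChart e' z 1 * (1 - D.proj L (e'.symm z)) ≠ 0 := by
  intro hc
  set P := D.proj L (e'.symm z)
  set w := om.inChart e' z 1
  have hφ : D.higgs.inChart e' z 1 = w • (1 - 2 • P) := by
    have h : D.higgs.inChart e' z 1 = w • (1 - 2 • P) +
      P * D.higgs.inChart e' z 1 * (1 - P) :=
        hD.higgs_split (e'.symm z) (mfderiv 𝓘(ℝ, ℂ) 𝓘(ℝ, ℂ) e'.symm z (1 : ℂ))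
    rwa [hc, add_zero] at h
  have hψ : D.higgsAdj.inChart e' z 1 = star w • (1 - 2 • P) := by
    have h : D.higgsAdj.inChart e' z 1 = star w • (1 - 2 • P) +
      (1 - P) * D.higgsAdj.inChart e' z 1 * P :=
        hD.higgsAdj_split (e'.symm z) (mfderiv 𝓘(ℝ, ℂ) 𝓘(ℝ, ℂ) e'.symm z (1 : ℂ))
    have h₁ : (1 - P) * D.higgsAdj.inChart e' z 1 * P = 0 :=
      eq_zero_of_conjTranspose_mul (hD.pair.isUnit_det (e'.symm z))
        (conjTranspose_block (hD.conjTranspose_proj (e'.symm z)) (hD.pair.conjTranspose_higgs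
          (e'.symm z) (mfderiv 𝓘(ℝ, ℂ) 𝓘(ℝ, ℂ) e'.symm z (1 : ℂ)))) hc
    rwa [h₁, add_zero] at h
  have hsum (a b : ℝ) : D.higgsSum.inChart e' z (a + b * Complex.I) =
      ((2 * (a * w.re - b * w.im) : ℝ) : ℂ) • (1 - 2 • P) := by
    have h₁ : (a + b * Complex.I : ℂ) = a • (1 : ℂ) + b • Complex.I := by simp
    have h₂ : D.higgsSum.inChart e' z 1 =
      D.higgs.inChart e' z 1 + D.higgsAdj.inChart e' z 1 := rfl
    have h₃ := hD.pair.higgsSum_I he' hz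
    rw [h₁, map_add, map_smul, map_smul, h₂, h₃, hφ, hψ, ← add_smul, ← sub_smul, smul_smul,
      ← smul_assoc, ← smul_assoc, ← add_smul]
    congr 1
    apply Complex.ext
    · simp
      ring
    · simp
  -- a nonzero vector on which `om` is purely imaginary
  obtain ⟨v, hv, hv₀⟩ : ∃ v : ℂ, D.higgsSum.inChart e' z v = 0 ∧ v ≠ 0 := by
    by_cases hw : w = 0
    · refine ⟨1, ?_, one_ne_zero⟩
      simpa [hw] using hsum 1 0
    · refine ⟨(w.im : ℂ) + (w.re : ℂ) * Complex.I, ?_, fun h => hw ?_⟩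
      · rw [hsum, show 2 * (w.im * w.re - w.re * w.im) = 0 by ring, Complex.ofReal_zero, zero_smul]
      · rw [Complex.ext_iff] at h
        apply Complex.ext
        · simpa using h.2
        · simpa using h.1
  have h₁ := diff_assocMap_inChart hD.pair hπ hol hF he he' hz hsub hsymm v
  rw [hv, mul_zero, zero_mul, smul_zero] at h₁
  have h₂ : diff (D.assocMap π F) (e.symm z) (mfderiv 𝓘(ℝ, ℂ) 𝓘(ℝ, ℂ) e.symm z v) =
    diff (D.assocMap π F) (e.symm z) 0 := h₁.trans (map_zero _).symm
  have h₃ : mfderiv 𝓘(ℝ, ℂ) 𝓘(ℝ, ℂ) e.symm z v = mfderiv 𝓘(ℝ, ℂ) 𝓘(ℝ, ℂ) e.symm z 0 :=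
    (hinj h₂).trans (map_zero _).symm
  exact hv₀ ((mdifferentiable_chart he).symm.mfderiv_injective (x := z) (hsub hz) h₃)

omit [IsManifold 𝓘(ℂ) ω M] in
/-- The triple product that determines the orientation of the dual map. -/
lemma trace_higgsSum_mul_mul {e : OpenPartialHomeomorph M ℂ} (he : e ∈ holCharts M) {z : ℂ}
    (hz : z ∈ e.target) :
    ((1 - 2 • D.proj L (e.symm z)) * D.higgsSum.inChart e z 1 *
      D.higgsSum.inChart e z Complex.I).trace = Complex.I * (2 *
      (D.proj L (e.symm z) * D.higgs.inChart e z 1 * (1 - D.proj L (e.symm z)) *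
      ((1 - D.proj L (e.symm z)) * D.higgsAdj.inChart e z 1 * D.proj L (e.symm z))).trace) := by
  have h₁ : D.higgsSum.inChart e z 1 = D.higgs.inChart e z 1 + D.higgsAdj.inChart e z 1 := rfl
  have hφ : D.higgs.inChart e z 1 = _ :=
    hD.higgs_split (e.symm z) (mfderiv 𝓘(ℝ, ℂ) 𝓘(ℝ, ℂ) e.symm z (1 : ℂ))
  have hψ : D.higgsAdj.inChart e z 1 = _ :=
    hD.higgsAdj_split (e.symm z) (mfderiv 𝓘(ℝ, ℂ) 𝓘(ℝ, ℂ) e.symm z (1 : ℂ))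
  have hc := mapsIn_block (hD.proj_mul_self (e.symm z)) (D.higgs.inChart e z 1)
  have hg := mapsOut_block (hD.proj_mul_self (e.symm z)) (D.higgsAdj.inChart e z 1)
  have h := trace_flip_mul (w := om.inChart e z 1) (w' := star (om.inChart e z 1))
      (hD.proj_mul_self (e.symm z)) (hD.trace_proj (e.symm z)) hc hg
  rw [← h, h₁, hD.pair.higgsSum_I he hz, mul_smul_comm, Matrix.trace_smul, smul_eq_mul]
  congr 4
  · exact congrArg₂ (· + ·) hφ hψ

/-- Up to sign, the map associated to the flipped data is the dual map. -/
lemma isDualMap [ConnectedSpace M] (hdet : ∀ p v, (D.higgs p v).det = -(om p v) ^ 2)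
    {ε : ℝ} (hε : ε = 1 ∨ ε = -1) (hs : ∀ p, D.signOn L p = -ε) (hπ : IsLocalHomeomorph π)
    (hol : ContMDiff 𝓘(ℂ) 𝓘(ℂ) ω π) (hF : D.IsParallelFrame π F) :
    IsDualMap (D.assocMap π F) (fun x => ε • (D.reverseFlip om L).assocMap π F x)
      ((-2 : ℝ) • om.pullback π) := by
  have hπ' := contMDiff_real_of_isLocalHomeomorph hπ hol
  have hf (x : X) := smul_assocMap_flip (om := om) (π := π) (F := F) hε hs x
  have hη {e : OpenPartialHomeomorph X ℂ} (he : e ∈ holCharts X) {e' : OpenPartialHomeomorph M ℂ}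
      {z : ℂ} (hz : z ∈ e.target) (hsymm : ⇑e'.symm = π ∘ e.symm) (v : ℂ) :
      OneForm.inChart ((-2 : ℝ) • om.pullback π) e z v = -2 * om.inChart e' z v := by
    have h := DFunLike.congr_fun (pullback_inChart hπ' he hsymm om hz) v
    rw [← h]
    change (-2 : ℝ) • (om.pullback π).inChart e z v = _
    rw [Complex.real_smul]
    push_cast
    rfl
  have hN {e : OpenPartialHomeomorph X ℂ} (he : e ∈ holCharts X) {e' : OpenPartialHomeomorph M ℂ}
      (he' : e' ∈ holCharts M) {z : ℂ} (hz : z ∈ e'.target) (hsub : e'.target ⊆ e.target)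
      (hsymm : ⇑e'.symm = π ∘ e.symm) (v : ℂ) :
      (diff (D.assocMap π F)).inChart e z v = (-2 : ℂ) • ((F (e.symm z))ᴴ *
        D.metric (π (e.symm z)) * D.higgsSum.inChart e' z v * F (e.symm z)) := by
    have h := diff_assocMap_inChart hD.pair hπ hol hF he he' hz hsub hsymm v
    rwa [congrFun hsymm z] at h
  refine ⟨?_, ?_, ?_, ?_, ?_, ?_⟩
  · intro e he z hz v
    obtain ⟨e', he', hz', -, hsymm⟩ := exists_chart_of_isLocalHomeomorph hπ hol he hz
    rw [hη he hz hsymm, hη he hz hsymm, hD.type_om e' he' z hz' v, smul_eq_mul, smul_eq_mul]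
    ring
  · intro e he z hz
    obtain ⟨e', he', hz', hsub, hsymm⟩ := exists_chart_of_isLocalHomeomorph hπ hol he hz
    have h₁ : D.higgsSum.inChart e' z 1 =
      D.higgs.inChart e' z 1 + D.higgsAdj.inChart e' z 1 := rfl
    have h₃ : dz (D.assocMap π F) e z = (-2 : ℂ) • ((F (e.symm z))ᴴ *
        D.metric (π (e.symm z)) * D.higgs.inChart e' z 1 * F (e.symm z)) := by
      rw [dz, hN he he' hz' hsub hsymm, hN he he' hz' hsub hsymm, h₁,
        hD.pair.higgsSum_I he' hz']
      exact dz_frame _ _ _ _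
    have h₄ : (D.higgs.inChart e' z 1).det = -(om.inChart e' z 1) ^ 2 := hdet _ _
    rw [hη he hz hsymm, h₃, mink_smul_left, mink_smul_right, hD.mink_frame hF, mink_self, h₄]
    ring
  · intro x
    rw [hf]
    refine ⟨hD.isHermitian_frame x (hD.conjTranspose_reflection _), ?_⟩
    rw [hD.mink_frame hF, mink_self, hD.det_reflection, neg_neg]
  · intro x
    rw [hf, assocMap_eq, hD.mink_frame hF, mink, hD.trace_reflection, mul_one,
      hD.trace_reflection]
    simp
  · intro x v
    have he := chartAt_mem_holCharts x
    have hx := mem_chart_source ℂ x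
    obtain ⟨u, hu⟩ := inChart_surjective he hx v
    have hex := (chartAt ℂ x).left_inv hx
    obtain ⟨e', he', hz', hsub, hsymm⟩ :=
      exists_chart_of_isLocalHomeomorph hπ hol he ((chartAt ℂ x).map_source hx)
    rw [hu, hu, hη he (hsub hz') hsymm, hN he he' hz' hsub hsymm, hex, hf, mink_smul_left,
      hD.mink_frame hF, mink_of_trace_eq_zero (hD.trace_reflection _)]
    have h := hD.trace_higgsSum_mul _ (mfderiv 𝓘(ℝ, ℂ) 𝓘(ℝ, ℂ) e'.symm (chartAt ℂ x x) u)
    have h' : e'.symm (chartAt ℂ x x) = π x := by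
      rw [hsymm, Function.comp_apply, hex]
    rw [← h']
    have h₁ : (D.higgsSum.inChart e' (chartAt ℂ x x) u *
      (1 - 2 • D.proj L (e'.symm (chartAt ℂ x x)))).trace = 2 * (om.inChart e' (chartAt ℂ x x) u +
        star (om.inChart e' (chartAt ℂ x x) u)) := h
    rw [h₁, star_mul']
    simp
    ring
  · intro e he z hz hinj
    obtain ⟨e', he', hz', hsub, hsymm⟩ := exists_chart_of_isLocalHomeomorph hπ hol he hz
    have hc := hD.block_ne_zero hπ hol hF he he' hz' hsub hsymm hinj
    have hp : e'.symm z = π (e.symm z) := congrFun hsymm z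
    have hneg := hD.trace_block_mul_neg (e'.symm z)
      (mfderiv 𝓘(ℝ, ℂ) 𝓘(ℝ, ℂ) e'.symm z (1 : ℂ)) hc
    have htr := hD.trace_higgsSum_mul_mul he' hz'
    have hadjS := adjugate_of_trace_eq_zero (hD.trace_reflection (π (e.symm z)))
    have hadjI : ((-2 : ℂ) • D.higgsSum.inChart e' z Complex.I).adjugate =
        (2 : ℂ) • D.higgsSum.inChart e' z Complex.I := by
      rw [adjugate_of_trace_eq_zero, neg_smul, neg_neg]
      rw [Matrix.trace_smul]
      exact (congrArg _ (hD.pair.trace_higgsSum hD.sol.trace_higgs _ _)).trans (smul_zero _)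
    have hH (u : ℂ) : ((-2 : ℂ) • D.higgsSum.inChart e' z u)ᴴ * D.metric (π (e.symm z)) =
        D.metric (π (e.symm z)) * ((-2 : ℂ) • D.higgsSum.inChart e' z u) := by
      have h : (D.higgsSum.inChart e' z u)ᴴ * D.metric (e'.symm z) =
        D.metric (e'.symm z) * D.higgsSum.inChart e' z u := hD.pair.conjTranspose_higgsSum _ _
      rw [hp] at h
      rw [Matrix.conjTranspose_smul, smul_mul_assoc, h, mul_smul_comm]
      simp
    have hN' (u : ℂ) : (diff (D.assocMap π F)).inChart e z u = (F (e.symm z))ᴴ *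
        D.metric (π (e.symm z)) * ((-2 : ℂ) • D.higgsSum.inChart e' z u) * F (e.symm z) := by
      rw [hN he he' hz' hsub hsymm, mul_smul_comm, smul_mul_assoc]
    have hone : (1 : Mat2)ᴴ * D.metric (π (e.symm z)) = D.metric (π (e.symm z)) * 1 := by
      rw [Matrix.conjTranspose_one, one_mul, mul_one]
    rw [hN', hN', assocMap_eq, hf, det_minkCoord (hD.isHermitian_frame _ hone)
      (hD.isHermitian_frame _ (hD.conjTranspose_reflection _)) (hD.isHermitian_frame _ (hH 1))
      (hD.isHermitian_frame _ (hH Complex.I)), trace_mul_adjugate_mul, hadjS, hadjI,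
      Matrix.det_mul, Matrix.det_conjTranspose, hF.det_eq, hD.pair.det_metric]
    have hfin (S Y Z : Mat2) : (1 * -S * ((-2 : ℂ) • Y) * ((2 : ℂ) • Z)).trace =
        4 * (S * Y * Z).trace := by
      simp only [one_mul, neg_mul, mul_smul_comm, smul_mul_assoc, Matrix.trace_smul,
        Matrix.trace_neg, smul_eq_mul]
      ring
    rw [hfin, ← hp, htr]
    have hre := (Complex.lt_def.mp hneg).1
    have hre' : (D.proj L (e'.symm z) * D.higgs.inChart e' z 1 * (1 - D.proj L (e'.symm z)) *
      ((1 - D.proj L (e'.symm z)) * D.higgsAdj.inChart e' z 1 * D.proj L (e'.symm z))).trace.re <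
        0 := hre
    simp only [star_one, one_mul, mul_one, neg_one_sq, Complex.mul_im, Complex.I_im, Complex.I_re,
      Complex.mul_re, Complex.re_ofNat, Complex.im_ofNat]
    linarith

end IsFlippable
end Data

/-! ### Deck transformations and holonomy -/

section Holonomy

variable {M : Type*} [TopologicalSpace M] [ChartedSpace ℂ M]
variable {X : Type*} [TopologicalSpace X] [ChartedSpace ℂ X] [IsManifold 𝓘(ℂ) ω X]
variable {π : X → M} {F G : X → Mat2} {D : Data M}

omit [IsManifold 𝓘(ℂ) ω X] in
lemma diff_comp {V : Type*} [NormedAddCommGroup V] [NormedSpace ℝ V] {f : X → V} {g : X → X}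
    (hf : SmoothMap f) (hg : ContMDiff 𝓘(ℝ, ℂ) 𝓘(ℝ, ℂ) ∞ g) (x : X)
    (v : TangentSpace 𝓘(ℝ, ℂ) x) :
    diff (f ∘ g) x v = diff f (g x) (mfderiv 𝓘(ℝ, ℂ) 𝓘(ℝ, ℂ) g x v) :=
  DFunLike.congr_fun (mfderiv_comp x (hf.mdifferentiableAt (by simp))
    (hg.mdifferentiableAt (by simp))) v

/-- A map of a connected surface with vanishing differential is constant. -/
lemma eq_of_diff_eq_zero [ConnectedSpace X] {f : X → Mat2} (hf : SmoothMap f)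
    (h : ∀ x v, diff f x v = 0) (x y : X) : f x = f y := by
  have hloc : IsLocallyConstant f := by
    rw [IsLocallyConstant.iff_eventually_eq]
    intro x
    have he := chartAt_mem_holCharts x
    set e := chartAt ℂ x
    have hx : x ∈ e.source := mem_chart_source ℂ x
    obtain ⟨r, hr, hball⟩ := Metric.isOpen_iff.mp e.open_target _ (e.map_source hx)
    filter_upwards [e.continuousAt hx (Metric.ball_mem_nhds _ hr), e.open_source.mem_nhds hx]
      with y hy hys
    have hc := Metric.isOpen_ball.is_const_of_fderiv_eq_zero (𝕜 := ℝ)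
      (convex_ball (e x) r).isPreconnected (f := f ∘ e.symm)
      (fun z hz => (hf.differentiableAt_comp_symm he (hball hz)).differentiableWithinAt)
      (fun z hz => by
        ext1 v
        exact (hf.diff_inChart he (hball hz) v).symm.trans (h _ _)) hy (Metric.mem_ball_self hr)
    simpa [e.left_inv hx, e.left_inv hys] using hc
  exact hloc.apply_eq_of_isPreconnected isPreconnected_univ (Set.mem_univ x) (Set.mem_univ y)

namespace Data

/-- Parallel frames on a connected surface differ by a constant matrix, as the derivative of
`F⁻¹ G` vanishes; the inverse of a frame of determinant one is its adjugate. -/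
lemma IsParallelFrame.adjugate_mul_eq [ConnectedSpace X] (hF : D.IsParallelFrame π F)
    (hG : D.IsParallelFrame π G) (x y : X) :
    (F x).adjugate * G x = (F y).adjugate * G y := by
  have hA : SmoothMap fun x => (F x).adjugate := by
    have h : SmoothMap fun x => adjugateCLM (F x) := adjugateCLM.contDiff.contMDiff.comp hF.smooth
    simpa only [adjugateCLM_apply] using! h
  have hFA (x : X) : F x * (F x).adjugate = 1 := by
    rw [Matrix.mul_adjugate, hF.det_eq, one_smul]
  have hAF : (fun x => (F x).adjugate * F x) = fun _ => 1 := by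
    funext x
    rw [Matrix.adjugate_mul, hF.det_eq, one_smul]
  refine eq_of_diff_eq_zero (f := fun x => (F x).adjugate * G x) (smoothMap_mul hA hG.smooth)
    (fun x v => ?_) x y
  have h₁ := diff_mul hA hF.smooth x v
  have h₂ : diff (fun _ : X => (1 : Mat2)) x v = 0 :=
    DFunLike.congr_fun (mvfderiv_const (I := 𝓘(ℝ, ℂ)) (1 : Mat2) (x := x)) v
  have h₃ := eq_neg_of_add_eq_zero_left (hF.parallel x v)
  have h₄ := eq_neg_of_add_eq_zero_left (hG.parallel x v)
  rw [hAF, h₂, h₃] at h₁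
  have h₅ := congrArg (fun Z => Z * (F x).adjugate) h₁
  simp only [zero_mul, add_mul, mul_neg, neg_mul, mul_assoc, hFA, mul_one] at h₅
  rw [diff_mul hA hG.smooth, h₄, eq_neg_of_add_eq_zero_left h₅.symm]
  noncomm_ring

variable [IsManifold 𝓘(ℂ) ω M]

/-- A homeomorphism over `M` is smooth, being locally a composition of `π` and a local inverse
of `π`. -/
lemma contMDiff_deck (hπ : IsLocalHomeomorph π) (hol : ContMDiff 𝓘(ℂ) 𝓘(ℂ) ω π)
    (g : deckGroup π) : ContMDiff 𝓘(ℝ, ℂ) 𝓘(ℝ, ℂ) ∞ g.1 := by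
  intro x
  have he := chartAt_mem_holCharts (g.1 x)
  have hx := mem_chart_source ℂ (g.1 x)
  set e := chartAt ℂ (g.1 x)
  obtain ⟨e', he', hz, hsub, hsymm⟩ := exists_chart_of_isLocalHomeomorph hπ hol he (e.map_source hx)
  have hkey {y : X} (hy : g.1 y ∈ e.source) (hy' : e (g.1 y) ∈ e'.target) :
      e'.symm (e (g.1 y)) = π y := by
    rw [hsymm, Function.comp_apply, e.left_inv hy]
    exact g.2 y
  have hxs : π x ∈ e'.source := by
    rw [← hkey hx hz]
    exact e'.map_target hz
  have hxe : e' (π x) = e (g.1 x) := by rw [← hkey hx hz, e'.right_inv hz]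
  have h₁ := (contMDiffAt_of_mem_maximalAtlas (mem_maximalAtlas_real he') hxs).comp x
    (contMDiff_real_of_isLocalHomeomorph hπ hol x)
  have h₂ : ContMDiffAt 𝓘(ℝ, ℂ) 𝓘(ℝ, ℂ) ∞ e.symm ((e' ∘ π) x) := by
    rw [Function.comp_apply, hxe]
    exact contMDiffAt_symm_of_mem_maximalAtlas (mem_maximalAtlas_real he) (e.map_source hx)
  refine (h₂.comp x h₁).congr_of_eventuallyEq ?_
  have hcont : ContinuousAt (fun y => e (g.1 y)) x :=
    (e.continuousAt hx).comp g.1.continuous.continuousAt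
  filter_upwards [g.1.continuous.continuousAt (e.open_source.mem_nhds hx),
    hcont (e'.open_target.mem_nhds hz)] with y hy hy'
  rw [Function.comp_apply, Function.comp_apply, ← hkey hy hy', e'.right_inv hy', e.left_inv hy]

/-- As `π ∘ g = π`, the pulled back connection is invariant under `g`. -/
lemma IsParallelFrame.comp_deck (hF : D.IsParallelFrame π F) (hπ : IsLocalHomeomorph π)
    (hol : ContMDiff 𝓘(ℂ) 𝓘(ℂ) ω π) (g : deckGroup π) : D.IsParallelFrame π (F ∘ g.1) where
  smooth := ContMDiff.comp hF.smooth (contMDiff_deck hπ hol g)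
  det_eq x := hF.det_eq _
  parallel x v := by
    have hg := contMDiff_deck hπ hol g
    have hπ' := contMDiff_real_of_isLocalHomeomorph hπ hol
    have hcomp : π ∘ g.1 = π := funext g.2
    have h₁ : D.totalForm.pullback (π ∘ g.1) x v =
        D.totalForm.pullback π (g.1 x) (mfderiv 𝓘(ℝ, ℂ) 𝓘(ℝ, ℂ) g.1 x v) := by
      have h := mfderiv_comp x (hπ'.mdifferentiableAt (by simp)) (hg.mdifferentiableAt (by simp))
      rw [OneForm.pullback, h]
      rfl
    rw [hcomp] at h₁
    rw [diff_comp hF.smooth hg, h₁]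
    exact hF.parallel _ _

/-- The holonomy of a parallel frame. The conjugate transpose makes `ρ` a homomorphism, rather than
an antihomomorphism, and fits the action `A ↦ g A g*`. -/
lemma IsParallelFrame.exists_holonomy [ConnectedSpace X] (hF : D.IsParallelFrame π F)
    (hπ : IsLocalHomeomorph π) (hol : ContMDiff 𝓘(ℂ) 𝓘(ℂ) ω π) :
    ∃ ρ : deckGroup π →* Matrix.SpecialLinearGroup (Fin 2) ℂ,
      ∀ g x, F (g.1 x) = F x * (ρ g : Mat2)ᴴ := by
  have hFA (x : X) : F x * (F x).adjugate = 1 := by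
    rw [Matrix.mul_adjugate, hF.det_eq, one_smul]
  have hcancel (x : X) {A B : Mat2} (h : F x * A = F x * B) : A = B := by
    have h' := congrArg (fun Z => (F x).adjugate * Z) h
    simpa [← mul_assoc, Matrix.adjugate_mul, hF.det_eq] using h'
  obtain ⟨x₀⟩ : Nonempty X := inferInstance
  have hex (g : deckGroup π) : ∃ A : Matrix.SpecialLinearGroup (Fin 2) ℂ,
      ∀ x, F (g.1 x) = F x * (A : Mat2)ᴴ := by
    refine ⟨⟨((F x₀).adjugate * F (g.1 x₀))ᴴ, ?_⟩, fun x => ?_⟩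
    · rw [Matrix.det_conjTranspose, Matrix.det_mul, Matrix.det_adjugate, hF.det_eq, hF.det_eq]
      simp
    · have h := hF.adjugate_mul_eq (hF.comp_deck hπ hol g) x x₀
      simp only [Function.comp_apply] at h
      simp only [Matrix.conjTranspose_conjTranspose, ← h]
      rw [← mul_assoc, hFA, one_mul]
  choose ρ hρ using hex
  refine ⟨MonoidHom.mk' ρ fun a b => ?_, hρ⟩
  have h : F x₀ * (ρ (a * b) : Mat2)ᴴ = F x₀ * ((ρ a : Mat2) * (ρ b : Mat2))ᴴ := by
    rw [Matrix.conjTranspose_mul, ← mul_assoc, ← hρ b, ← hρ a, ← hρ (a * b)]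
    rfl
  have h' := congrArg Matrix.conjTranspose (hcancel x₀ h)
  rw [Matrix.conjTranspose_conjTranspose, Matrix.conjTranspose_conjTranspose] at h'
  exact Subtype.ext h'

omit [ChartedSpace ℂ X] [IsManifold 𝓘(ℂ) ω X] [IsManifold 𝓘(ℂ) ω M] in
lemma isEquivariant_assocMap (D : Data M) {ρ : deckGroup π →* Matrix.SpecialLinearGroup (Fin 2) ℂ}
    (hρ : ∀ g x, F (g.1 x) = F x * (ρ g : Mat2)ᴴ) : IsEquivariant ρ (D.assocMap π F) := by
  intro g x
  rw [assocMap, assocMap, hρ, g.2 x, Matrix.conjTranspose_mul, Matrix.conjTranspose_conjTranspose]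
  simp only [mul_assoc]

end Data

end Holonomy

/-! ### The associated maps and their targets -/

namespace Data

variable {M : Type*} [TopologicalSpace M] [ChartedSpace ℂ M]
variable {X : Type*} [TopologicalSpace X] [ChartedSpace ℂ X]
variable {D : Data M} {π : X → M} {F : X → Mat2}

lemma IsSU11Solution.assocMap_mem (hD : D.IsSU11Solution) (hF : D.IsParallelFrame π F) (x : X) :
    D.assocMap π F x ∈ deSitter3 := by
  constructor
  · have h := (hD.hermitian (π x)).eq
    simp [Matrix.IsHermitian, assocMap, Matrix.conjTranspose_mul, h, mul_assoc]
  · rw [mink_self, assocMap, Matrix.det_mul, Matrix.det_mul, Matrix.det_conjTranspose, hF.det_eq,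
      hD.det_metric]
    simp

lemma IsSU2Solution.assocMap_mem (hD : D.IsSU2Solution) (hF : D.IsParallelFrame π F) (x : X) :
    D.assocMap π F x ∈ hyp3 := by
  constructor
  · refine (hD.posDef (π x)).conjTranspose_mul_mul_same (Matrix.mulVec_injective_of_isUnit ?_)
    rw [Matrix.isUnit_iff_isUnit_det, hF.det_eq]
    exact isUnit_one
  · rw [assocMap, Matrix.det_mul, Matrix.det_mul, Matrix.det_conjTranspose, hF.det_eq,
      hD.det_metric]
    simp

lemma IsFlippable.isParallelFrame_flip [IsManifold 𝓘(ℂ) ω M] [ConnectedSpace M] {om : OneForm M ℂ}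
    {L : M → ℙ ℂ (Fin 2 → ℂ)} (hD : D.IsFlippable om L) (hF : D.IsParallelFrame π F) :
    (D.reverseFlip om L).IsParallelFrame π F where
  smooth := hF.smooth
  det_eq := hF.det_eq
  parallel := by
    rw [hD.totalForm_flip]
    exact hF.parallel

end Data

end Hitchin

theorem mainTheorem7 {M : Type*} [TopologicalSpace M] [T2Space M] [ConnectedSpace M]
    [ChartedSpace ℂ M] [IsManifold 𝓘(ℂ) ω M]
    (D : Hitchin.Data M) (om : Hitchin.OneForm M ℂ) (L : M → ℙ ℂ (Fin 2 → ℂ))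
    (hD : D.IsSU11Solution)
    (hom : Hitchin.SmoothForm om) (hom10 : Hitchin.IsType10 om)
    (hdet : ∀ p v, (D.higgs p v).det = -(om p v) ^ 2)
    (hL : D.IsEigenline (-om) L) (hnull : D.NowhereNull L) :
    (D.reverseFlip om L).IsSU2Solution ∧
    ∃ ε : ℝ, (ε = 1 ∨ ε = -1) ∧ (∀ p, D.signOn L p = -ε) ∧
      ∀ {X : Type*} [TopologicalSpace X] [T2Space X] [ConnectedSpace X] [ChartedSpace ℂ X]
        [IsManifold 𝓘(ℂ) ω X] (π : X → M) (_ : IsLocalHomeomorph π)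
        (_ : ContMDiff 𝓘(ℂ) 𝓘(ℂ) ω π) (F : X → Mat2) (_ : D.IsParallelFrame π F),
        (D.reverseFlip om L).IsParallelFrame π F ∧
        Hitchin.IsHarmonicInto Hitchin.deSitter3 (D.assocMap π F) ∧
        Hitchin.IsHarmonicInto Hitchin.hyp3 ((D.reverseFlip om L).assocMap π F) ∧
        (∃ ρ : Hitchin.deckGroup π →* Matrix.SpecialLinearGroup (Fin 2) ℂ,
          Hitchin.IsEquivariant ρ (D.assocMap π F) ∧
          Hitchin.IsEquivariant ρ ((D.reverseFlip om L).assocMap π F)) ∧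
        Hitchin.IsDualMap (D.assocMap π F)
          (fun x => ε • (D.reverseFlip om L).assocMap π F x)
          ((-2 : ℝ) • om.pullback π) := by
  have hflip : D.IsFlippable om L := ⟨hD, hom, hom10, hL, hnull⟩
  obtain ⟨ε, hε, hs⟩ := hflip.signOn_const
  have hSU2 := hflip.isSU2Solution_flip
  refine ⟨hSU2, ε, hε, hs, fun π hπ hol F hF => ?_⟩
  have hF' := hflip.isParallelFrame_flip hF
  obtain ⟨ρ, hρ⟩ := hF.exists_holonomy hπ hol
  exact ⟨hF',
    Hitchin.Data.isHarmonicInto_assocMap hflip.pair hD.toSelfDual hπ hol hF (hD.assocMap_mem hF),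
    Hitchin.Data.isHarmonicInto_assocMap hflip.pair_flip hSU2.toSelfDual hπ hol hF'
      (hSU2.assocMap_mem hF'),
    ⟨ρ, Hitchin.Data.isEquivariant_assocMap D hρ, Hitchin.Data.isEquivariant_assocMap _ hρ⟩,
    hflip.isDualMap hdet hε hs hπ hol hF⟩
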